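/- Let $\mathcal R$ be the class of functions $f:(0,1)^2\to[0,\infty)$ such that $f$ is bounded on $[\varepsilon,1-\varepsilon]^2$ for every $0<\varepsilon<1/2$, the set of discontinuities of $f$ in $(0,1)^2$ has Lebesgue measure zero, and $f(x,y)=f(y,x)$ for all $(x,y)\in(0,1)^2$. Fix $f\in\mathcal R$. Let $\{X_{i,j}:1\le i\le j\}$ be i.i.d. standard normal random variables, and for $N\ge1$ let $Z_N$ be the random symmetric $N\times N$ matrix $$Z_N(i,j)=f\Big(\frac i{N+1},\frac j{N+1}\Big)\,N^{-1/2}X_{i\wedge j,\,i\vee j},\qquad 1\le i,j\le N,$$ that is, the Hadamard product of $A_{f,N}=\big(f(\frac i{N+1},\frac j{N+1})\big)_{i,j}$ with the scaled Gaussian Wigner matrix $W_N=(N^{-1/2}X_{i\wedge j,\,i\vee j})_{i,j}$. Let $\mathrm{ESD}(Z_N)=\frac1N\sum_{i=1}^N\delta_{\lambda_i}$, where $\lambda_1,\dots,\lambda_N$ are the eigenvalues of $Z_N$, counted with multiplicity. For $m\ge1$ let $NC_2(2m)$ be the set of non-crossing pair partitions of $\{1,\dots,2m\}$. The Kreweras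 complement of $\sigma\in NC_2(2m)$ is the maximal (coarsest) partition $\overline\sigma$ of $\{\overline1,\dots,\overline{2m}\}$ such that $\sigma\cup\overline\sigma$ is a non-crossing partition of $\{1<\overline1<2<\overline2<\dots<2m<\overline{2m}\}$; it has exactly $m+1$ blocks, which we label $V_1,\dots,V_{m+1}$ in the increasing order of their maximal elements. Let $\mathcal T_\sigma(i)$ be the index with $\overline i\in V_{\mathcal T_\sigma(i)}$, $1\le i\le 2m$, and put $$L_{\sigma,f}(x_1,\dots,x_{m+1})=\prod_{(u,v)\in\sigma}f^2\big(x_{\mathcal T_\sigma(u)},x_{\mathcal T_\sigma(v)}\big),\qquad (x_1,\dots,x_{m+1})\in(0,1)^{m+1}.$$ **Theorem.** There exists a non-random probability measure $\mu_f$ on $\mathbb R$, symmetric about zero and depending only on $f$, such that $\mathrm{ESD}(Z_N)\to\mu_f$ weakly in probability as $N\to\infty$; that is, $\int\varphi\,d\,\mathrm{ESD}(Z_N)\to\int\varphi\,d\mu_f$ in probability for every bounded continuous $\varphi:\mathbb R\to\mathbb R$. If, in addition, $f\in L^\infty((0,1)^2)$, that is, $f$ is essentially bounded, then $\mu_f$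 is compactly supported, and for every $n\ge1$ the $2n$-th moment of $\mu_f$ is finite, each $L_{\sigma,f}$ with $\sigma\in NC_2(2n)$ is integrable on $(0,1)^{n+1}$, and $$\int_{\mathbb R}x^{2n}\,\mu_f(dx)=\sum_{\sigma\in NC_2(2n)}\int_{(0,1)^{n+1}}L_{\sigma,f}(x_1,\dots,x_{n+1})\,dx_1\cdots dx_{n+1}.$$ -/

import Mathlib

open MeasureTheory ProbabilityTheory Filter Set

open scoped ENNReal Classical

/-! ### The random matrices -/

/-- The class of functions on `(0,1)²`; the values of `f` outside `(0,1)²` play no role. -/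
structure ClassR (f : ℝ → ℝ → ℝ) : Prop where
  nonneg : ∀ x ∈ Ioo (0 : ℝ) 1, ∀ y ∈ Ioo (0 : ℝ) 1, 0 ≤ f x y
  bounded : ∀ ε : ℝ, 0 < ε → ε < 1 / 2 →
    ∃ M : ℝ, ∀ x ∈ Icc ε (1 - ε), ∀ y ∈ Icc ε (1 - ε), f x y ≤ M
  discont_null :
    volume {p : ℝ × ℝ | p ∈ Ioo (0 : ℝ) 1 ×ˢ Ioo (0 : ℝ) 1 ∧
      ¬ ContinuousAt (Function.uncurry f) p} = 0
  symm : ∀ x ∈ Ioo (0 : ℝ) 1, ∀ y ∈ Ioo (0 : ℝ) 1, f x y = f y x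

/-- The grid point `i / (N + 1)`, `1 ≤ i ≤ N` (here `i : Fin N` stands for `i + 1`). -/
noncomputable def gridPoint (N : ℕ) (i : Fin N) : ℝ := ((i : ℝ) + 1) / ((N : ℝ) + 1)

/-- The deterministic matrix `A_{f,N}(i,j) = f (i/(N+1), j/(N+1))`. -/
noncomputable def gridMatrix (f : ℝ → ℝ → ℝ) (N : ℕ) : Matrix (Fin N) (Fin N) ℝ :=
  Matrix.of fun i j => f (gridPoint N i) (gridPoint N j)

/-- The matrix `W_N(i,j) = N^{-1/2} X_{i ∧ j, i ∨ j}`, `1 ≤ i, j ≤ N`, built from an array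
`x` of real numbers of which only the entries `x a b` with `1 ≤ a ≤ b` are used. -/
noncomputable def wignerMatrix (x : ℕ → ℕ → ℝ) (N : ℕ) : Matrix (Fin N) (Fin N) ℝ :=
  Matrix.of fun i j =>
    (Real.sqrt N)⁻¹ * x (min ((i : ℕ) + 1) ((j : ℕ) + 1)) (max ((i : ℕ) + 1) ((j : ℕ) + 1))

/-- The Hadamard (entrywise) product `Z_N = A_{f,N} ∘ W_N`. -/
noncomputable def hadamardZ (f : ℝ → ℝ → ℝ) (x : ℕ → ℕ → ℝ) (N : ℕ) :
    Matrix (Fin N) (Fin N) ℝ :=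
  Matrix.hadamard (gridMatrix f N) (wignerMatrix x N)

theorem gridPoint_mem (N : ℕ) (i : Fin N) : gridPoint N i ∈ Ioo (0 : ℝ) 1 := by
  have hi : ((i : ℕ) : ℝ) < N := by exact_mod_cast i.isLt
  unfold gridPoint
  constructor
  · positivity
  · rw [div_lt_one (by positivity)]
    linarith

theorem hadamardZ_isHermitian {f : ℝ → ℝ → ℝ} (hf : ClassR f) (x : ℕ → ℕ → ℝ) (N : ℕ) :
    (hadamardZ f x N).IsHermitian := by
  ext i j
  simp only [hadamardZ, gridMatrix, wignerMatrix, Matrix.conjTranspose_apply,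
    Matrix.hadamard_apply, Matrix.of_apply, star_trivial]
  rw [hf.symm _ (gridPoint_mem N j) _ (gridPoint_mem N i), min_comm, max_comm]

/-- The empirical spectral distribution `N⁻¹ ∑ δ_{λ_i}` of a real symmetric matrix, the
eigenvalues being counted with multiplicity. -/
noncomputable def esd {N : ℕ} {A : Matrix (Fin N) (Fin N) ℝ} (hA : A.IsHermitian) :
    Measure ℝ :=
  (N : ℝ≥0∞)⁻¹ • ∑ i : Fin N, Measure.dirac (hA.eigenvalues i)

/-- Weak convergence in probability of random measures `ν N` on the line to a deterministic
measure `μ`: for every bounded continuous test function, the integrals converge in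
probability. -/
def WeaklyInProbability {Ω : Type*} [MeasurableSpace Ω] (P : Measure Ω)
    (ν : ℕ → Ω → Measure ℝ) (μ : Measure ℝ) : Prop :=
  ∀ φ : BoundedContinuousFunction ℝ ℝ,
    TendstoInMeasure P (fun N ω => ∫ t, φ t ∂(ν N ω)) atTop (fun _ => ∫ t, φ t ∂μ)

/-! ### Non-crossing pair partitions and Kreweras complements

A partition is given by its equivalence relation; `r ≤ s` means that `r` is finer than `s`. -/

/-- A partition of a linearly ordered set is non-crossing if there are no `a < b < c < d`
with `a, c` in one block and `b, d` in another one. -/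
def IsNonCrossing {α : Type*} [LinearOrder α] (r : Setoid α) : Prop :=
  ∀ a b c d : α, a < b → b < c → c < d → r a c → r b d → r a b

/-- All blocks have exactly two elements. -/
def IsPairing {α : Type*} (r : Setoid α) : Prop :=
  ∀ B ∈ r.classes, B.ncard = 2

/-- The partition `σ ∪ τ` of `{1 < 1̄ < 2 < 2̄ < ⋯ < n < n̄}`, where `σ` lives on the unbarred
elements `(i, false)` and `τ` on the barred elements `(i, true)`. -/
def unionPartition {n : ℕ} (σ τ : Setoid (Fin n)) : Setoid (Fin n ×ₗ Bool) where
  r a b := (ofLex a).2 = (ofLex b).2 ∧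
    if (ofLex a).2 then τ (ofLex a).1 (ofLex b).1 else σ (ofLex a).1 (ofLex b).1
  iseqv := by
    refine ⟨fun a => ⟨rfl, ?_⟩, ?_, ?_⟩
    · split_ifs
      exacts [τ.refl _, σ.refl _]
    · rintro a b ⟨h, h'⟩
      refine ⟨h.symm, ?_⟩
      rw [← h]
      split_ifs at h' ⊢
      exacts [τ.symm h', σ.symm h']
    · rintro a b c ⟨h, h'⟩ ⟨k, k'⟩
      refine ⟨h.trans k, ?_⟩
      rw [← h] at k'
      split_ifs at h' k' ⊢
      exacts [τ.trans h' k', σ.trans h' k']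

/-- The Kreweras complement of `σ`: the maximal (that is, coarsest) partition `τ` such that
`σ ∪ τ` is non-crossing. -/
def kreweras {n : ℕ} (σ : Setoid (Fin n)) : Setoid (Fin n) :=
  sSup {τ : Setoid (Fin n) | IsNonCrossing (unionPartition σ τ)}

/-- The largest element of the block of `i`. -/
noncomputable def blockMax {n : ℕ} (r : Setoid (Fin n)) (i : Fin n) : Fin n :=
  (Finset.univ.filter fun j => r i j).max' ⟨i, by simp⟩

/-- The set of the largest elements of the blocks of a partition. -/
noncomputable def blockMaxima {n : ℕ} (r : Setoid (Fin n)) : Finset (Fin n) :=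
  Finset.univ.image (blockMax r)

/-- `NC₂(2m)`, the non-crossing pair partitions of a set of `2m` ordered elements. -/
def NCPair (m : ℕ) : Type :=
  {σ : Setoid (Fin (2 * m)) // IsPairing σ ∧ IsNonCrossing σ}

noncomputable instance (m : ℕ) : Fintype (NCPair m) :=
  have : Finite (Setoid (Fin (2 * m))) :=
    Finite.of_injective (fun s : Setoid (Fin (2 * m)) => fun i j => s i j)
      (fun _ _ h => Setoid.ext fun i j => iff_of_eq (congrFun (congrFun h i) j))
  have : Finite (NCPair m) := inferInstanceAs (Finite (Subtype _))
  Fintype.ofFinite _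

/-! The supremum that defines the Kreweras complement is attained. -/

/-- `ī` and `j̄` are related if no block of `σ` separates them. -/
def unseparated {n : ℕ} (σ : Setoid (Fin n)) : Setoid (Fin n) where
  r i j := ∀ u v, σ u v → ((i < u ↔ i < v) ↔ (j < u ↔ j < v))
  iseqv := ⟨fun _ _ _ _ => Iff.rfl, fun h u v k => (h u v k).symm,
    fun h h' u v k => (h u v k).trans (h' u v k)⟩

theorem isGreatest_unseparated {n : ℕ} {σ : Setoid (Fin n)} (hσ : IsNonCrossing σ) :
    IsGreatest {τ : Setoid (Fin n) | IsNonCrossing (unionPartition σ τ)} (unseparated σ) := by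
  constructor
  · rintro ⟨a, a'⟩ ⟨b, b'⟩ ⟨c, c'⟩ ⟨d, d'⟩ hab hbc hcd ⟨h1, h2⟩ ⟨h3, h4⟩
    change a' = c' at h1
    change b' = d' at h3
    subst h1 h3
    have hab : toLex (a, a') < toLex (b, b') := hab
    have hbc : toLex (b, b') < toLex (c, a') := hbc
    have hcd : toLex (c, a') < toLex (d, b') := hcd
    rw [Prod.Lex.toLex_lt_toLex] at hab hbc hcd
    change a' = b' ∧ if a' then unseparated σ a b else σ a b
    change (if a' then unseparated σ a c else σ a c) at h2
    change (if b' then unseparated σ b d else σ b d) at h4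
    cases a' <;> cases b' <;> simp at hab hbc hcd h2 h4 ⊢
    · exact hσ a b c d hab hbc hcd h2 h4
    · have := h4 a c h2
      have tf : ¬ (true < false) := by decide
      grind
    · have := h2 b d h4
      have tf : ¬ (true < false) := by decide
      grind
    · intro u v huv
      have := h2 u v huv
      have := h4 u v huv
      grind
  · intro τ hτ i j hij
    have key : ∀ i j u v : Fin n, τ i j → σ u v → u < v → u ≤ i → i < v →
        (j < u ∨ v ≤ j) → False := by
      intro i j u v hij huv h0 h1 h2 h3
      have bl : ∀ x y : Fin n, x < y → (toLex (x, true) : Fin n ×ₗ Bool) < toLex (y, false) := by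
        intro x y h; rw [Prod.Lex.toLex_lt_toLex]; exact Or.inl h
      have lb : ∀ x y : Fin n, x ≤ y → (toLex (x, false) : Fin n ×ₗ Bool) < toLex (y, true) := by
        intro x y h
        rw [Prod.Lex.toLex_lt_toLex]
        rcases h.lt_or_eq with h | h
        · exact Or.inl h
        · exact Or.inr ⟨h, by simp⟩
      have hS : unionPartition σ τ (toLex (u, false)) (toLex (v, false)) := ⟨rfl, by simpa using huv⟩
      have hT : unionPartition σ τ (toLex (i, true)) (toLex (j, true)) := ⟨rfl, by simpa using hij⟩
      rcases h3 with h3 | h3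
      · have := (hτ _ _ _ _ (bl _ _ h3) (lb _ _ h1) (bl _ _ h2)
          ((unionPartition σ τ).symm hT) hS).1
        simp at this
      · have := (hτ _ _ _ _ (lb _ _ h1) (bl _ _ h2) (lb _ _ h3) hS hT).1
        simp at this
    intro u v huv
    have k1 := key i j u v hij huv
    have k2 := key j i u v (τ.symm hij) huv
    have k3 := key i j v u hij (σ.symm huv)
    have k4 := key j i v u (τ.symm hij) (σ.symm huv)
    grind

theorem kreweras_eq {n : ℕ} {σ : Setoid (Fin n)} (hσ : IsNonCrossing σ) :
    kreweras σ = unseparated σ :=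
  (isGreatest_unseparated hσ).isLUB.sSup_eq

theorem isGreatest_kreweras {n : ℕ} {σ : Setoid (Fin n)} (hσ : IsNonCrossing σ) :
    IsGreatest {τ : Setoid (Fin n) | IsNonCrossing (unionPartition σ τ)} (kreweras σ) :=
  kreweras_eq hσ ▸ isGreatest_unseparated hσ

/-! The Kreweras complement of an element of `NC₂(2m)` has `m + 1` blocks, for `m ≥ 1`. -/

theorem mem_blockMaxima {n : ℕ} {r : Setoid (Fin n)} {i : Fin n} :
    i ∈ blockMaxima r ↔ ∀ j, r i j → j ≤ i := by
  constructor
  · intro h j hj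
    obtain ⟨k, -, rfl⟩ := Finset.mem_image.1 h
    have hk : blockMax r k ∈ Finset.univ.filter fun j => r k j := Finset.max'_mem _ _
    refine Finset.le_max' _ _ ?_
    simp only [Finset.mem_filter, Finset.mem_univ, true_and] at hk ⊢
    exact r.trans hk hj
  · intro h
    refine Finset.mem_image.2 ⟨i, Finset.mem_univ _, le_antisymm ?_ ?_⟩
    · exact Finset.max'_le _ _ _ fun j hj => h j (by simpa using hj)
    · exact Finset.le_max' _ _ (by simp)

theorem IsPairing.exists_partner {n : ℕ} {σ : Setoid (Fin n)} (hσ : IsPairing σ) :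
    ∃ p : Fin n → Fin n, ∀ i j, σ i j ↔ (j = i ∨ j = p i) ∧ p i ≠ i := by
  have : ∀ i, ∃ q, ∀ j, σ i j ↔ (j = i ∨ j = q) ∧ q ≠ i := by
    intro i
    obtain ⟨x, y, hxy, h⟩ := Set.ncard_eq_two.1 (hσ _ (σ.mem_classes i))
    have hm : ∀ j, σ j i ↔ j = x ∨ j = y := fun j => by
      have := Set.ext_iff.1 h j
      simpa using this
    have hi := (hm i).1 (σ.refl i)
    rcases hi with rfl | rfl
    · exact ⟨y, fun j => by rw [σ.comm', hm]; simp [hxy.symm]⟩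
    · exact ⟨x, fun j => by rw [σ.comm', hm]; simp [hxy, or_comm]⟩
  choose p hp using this
  exact ⟨p, hp⟩

theorem card_blockMaxima_kreweras {m : ℕ} (hm : 0 < m) (σ : NCPair m) :
    (blockMaxima (kreweras σ.1)).card = m + 1 := by
  obtain ⟨σ, hσ, hnc⟩ := σ
  change (blockMaxima (kreweras σ)).card = m + 1
  rw [kreweras_eq hnc]
  obtain ⟨p, hp⟩ := hσ.exists_partner
  have hne : ∀ i, p i ≠ i := fun i => ((hp i i).1 (σ.refl i)).2
  have hr : ∀ i, σ i (p i) := fun i => (hp i _).2 ⟨Or.inr rfl, hne i⟩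
  have hpp : ∀ i, p (p i) = i := fun i =>
    (((hp (p i) i).1 (σ.symm (hr i))).1.resolve_left (hne i).symm).symm
  set C : Finset (Fin (2 * m)) := Finset.univ.filter fun i => p i < i with hC
  set O : Finset (Fin (2 * m)) := Finset.univ.filter fun i => ¬ p i < i with hO
  have hCO : C.card + O.card = 2 * m := by
    have := Finset.card_filter_add_card_filter_not (s := (Finset.univ : Finset (Fin (2 * m))))
      (fun i => p i < i)
    rw [Finset.card_univ, Fintype.card_fin] at this
    convert this using 2
  have hcard : C.card = O.card := by
    refine Finset.card_bij' (fun i _ => p i) (fun i _ => p i) ?_ ?_ ?_ ?_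
    · intro i hi
      simp only [hC, hO, Finset.mem_filter, Finset.mem_univ, true_and, hpp] at hi ⊢
      exact hi.le.not_gt
    · intro i hi
      simp only [hC, hO, Finset.mem_filter, Finset.mem_univ, true_and, hpp] at hi ⊢
      exact lt_of_le_of_ne (not_lt.1 hi) (hne i).symm
    · intro i _; exact hpp i
    · intro i _; exact hpp i
  have hCm : C.card = m := by omega
  let pr : Fin (2 * m) → Fin (2 * m) := fun v => ⟨v.1 - 1, by omega⟩
  have hinj : Set.InjOn pr C := by
    intro x hx y hy hxy
    simp only [hC, Finset.coe_filter, Finset.mem_univ, true_and, Set.mem_ofPred_eq] at hx hy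
    have : x.1 - 1 = y.1 - 1 := congrArg Fin.val hxy
    ext
    have := Fin.lt_def.1 hx
    have := Fin.lt_def.1 hy
    omega
  have hmax : blockMaxima (unseparated σ) = insert ⟨2 * m - 1, by omega⟩ (C.image pr) := by
    ext i
    rw [mem_blockMaxima, Finset.mem_insert, Finset.mem_image]
    constructor
    · intro h
      by_contra hcon
      push Not at hcon
      obtain ⟨h1, h2⟩ := hcon
      have hi : i.1 + 1 < 2 * m := by
        have : i.1 ≠ 2 * m - 1 := fun h => h1 (Fin.ext h)
        omega
      set w : Fin (2 * m) := ⟨i.1 + 1, hi⟩ with hw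
      have hwO : ¬ p w < w := fun h' =>
        h2 w (by simpa [hC] using h') (Fin.ext (by simp [pr, hw]))
      have hwlt : w < p w := lt_of_le_of_ne (not_lt.1 hwO) (hne w).symm
      have : unseparated σ i (p w) := by
        intro u v huv
        have hcases := ((hp u v).1 huv).1
        rcases hcases with rfl | rfl
        · simp
        have n1 := hnc u w (p u) (p w)
        have n2 := hnc (p u) w u (p w)
        have n3 := hnc w u (p w) (p u)
        have n4 := hnc w (p u) (p w) u
        have e1 := (hp u w)
        have e2 := (hp (p u) w)
        have e3 := (hp w u)
        have e4 := (hp w (p u))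
        have r1 := hr u
        have r2 := hr w
        have r3 := σ.symm (hr u)
        have b1 := hpp u
        have b2 := hpp w
        have hiw : ∀ x : Fin (2 * m), i < x ↔ w ≤ x := fun x => by
          rw [Fin.lt_def, Fin.le_def]; exact Nat.lt_iff_add_one_le
        rw [hiw, hiw]
        grind
      have h3 := h _ this
      have := Fin.lt_def.1 hwlt
      have := Fin.le_def.1 h3
      simp only [hw] at *
      omega
    · rintro (rfl | ⟨v, hv, rfl⟩) j hj
      · rw [Fin.le_def]
        simp only
        omega
      · have hv' : p v < v := by simpa [hC] using hv
        have := hj v (p v) (hr v)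
        have hv'' := Fin.lt_def.1 hv'
        simp only [Fin.lt_def, Fin.le_def, pr] at this ⊢
        omega
  rw [hmax, Finset.card_insert_of_notMem, Finset.card_image_of_injOn hinj, hCm]
  intro h
  obtain ⟨v, hv, h⟩ := Finset.mem_image.1 h
  have hv' : p v < v := by simpa [hC] using hv
  have hv'' := Fin.lt_def.1 hv'
  have := congrArg Fin.val h
  simp only [pr] at this
  omega

/-- The map `T_σ`: the blocks `V_1, …, V_{m+1}` of the Kreweras complement are listed in the
increasing order of their largest elements, and `T_σ(i)` is the index of the block of `i`
(the indices are `0, …, m` here). -/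
noncomputable def blockIndex {m : ℕ} (σ : NCPair m) (i : Fin (2 * m)) : Fin (m + 1) :=
  ((blockMaxima (kreweras σ.1)).orderIsoOfFin
    (card_blockMaxima_kreweras (by have := i.isLt; omega) σ)).symm
    ⟨blockMax (kreweras σ.1) i, Finset.mem_image_of_mem _ (Finset.mem_univ i)⟩

/-- `L_{σ,f}(x_1, …, x_{m+1}) = ∏_{(u,v) ∈ σ} f(x_{T_σ(u)}, x_{T_σ(v)})²`, the product being
over the pairs `u < v` of `σ`. -/
noncomputable def Lfun {m : ℕ} (σ : NCPair m) (f : ℝ → ℝ → ℝ) (x : Fin (m + 1) → ℝ) : ℝ :=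
  ∏ p : Fin (2 * m) × Fin (2 * m) with p.1 < p.2 ∧ σ.1 p.1 p.2,
    f (x (blockIndex σ p.1)) (x (blockIndex σ p.2)) ^ 2

/-- The open unit cube `(0,1)^k`. -/
def unitCube (k : ℕ) : Set (Fin k → ℝ) := Set.univ.pi fun _ => Ioo (0 : ℝ) 1

/-!
The limit law is found by the moment method for bounded `f`, and by truncation in general.

*Bounded `f`.* The entries of `Z_N` are treated as polynomials in independent standard normal
variables (`polyWigner`), and expectation as a linear functional `gaussianExp` on polynomials that
satisfies Gaussian integration by parts (`gaussianExp_X_mul`). Expanding one factor of a product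
of entries of powers of `Z_N` by this rule lowers the total degree by two, and up to `O(1/N)` only
the terms survive in which the factor is contracted with another one of the same power and cuts it
into two diagonal entries. By induction on the degree, the expectation of a product of entries of
powers is, up to `O(1/N)`, the product of the values given by the Catalan type recursion
`IsMomentSeq` (`exists_momentApprox`). Applied to one and to two traces, this gives a bound
`O(1/N)` for the mean square distance of `N⁻¹ tr Z_N^k` from the average of the solution of the
recursion (`gaussianExp_trace_sub_sq_le`). The solution is a sum over binary trees
(`treeMoment`). Binary trees with `m` nodes correspond to non-crossing pairings of `2m` points,
the first return decomposition of a pairing being the decomposition of a tree at its root, and the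
vertices of the plane tree of a pairing are the blocks of its Kreweras complement; so the average
is a Riemann sum of the functions `L_σ` (`avg_treeMoment_eq_sum_avg_Lfun`), which converges since
`f` is bounded and almost everywhere continuous (`tendsto_avg_Lfun`). The limits of the moments
grow at most geometrically, hence they are the moments of a compactly supported law and
determine convergence to it (`exists_measure_of_moments`, `exists_moment_criterion`,
`exists_limit_of_bounded`).

*General `f`.* Replacing `f` by zero within distance `ε` of the boundary of the square changes only
the rows and columns of a proportion at most `4 ε` of the indices, and a dimension count shows that
the eigenvalue counting functions then change by at most that proportion
(`card_eigenvalues_le_card_add`). The truncated functions are bounded, and their limit laws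
form a tight sequence, any limit point of which is the limit law of `f` (`exists_limit`). If `f` is
essentially bounded, the limit laws of the truncations are supported in a common interval, and the
moment formula passes to the limit by dominated convergence.

The statement about an arbitrary array of independent normal variables follows because the
spectral distribution depends only on the entries on and above the diagonal, the joint law of which
is the Gaussian product measure (`hasLaw_arrayRestrict`).
-/

/-! ### Gaussian integration by parts for polynomials -/

theorem integrable_pow_gaussianReal (n : ℕ) :
    Integrable (fun x : ℝ => x ^ n) (gaussianReal 0 1) := by
  have h := (memLp_id_gaussianReal (μ := 0) (v := 1) n).integrable_norm_pow'
  refine h.mono (by fun_prop) (Eventually.of_forall fun x => ?_)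
  simp

theorem integral_pow_succ_gaussianReal (n : ℕ) :
    ∫ x, x ^ (n + 1) ∂gaussianReal 0 1 = n * ∫ x, x ^ (n - 1) ∂gaussianReal 0 1 := by
  have key : ∀ k : ℕ, Integrable (fun x : ℝ => x ^ k * gaussianPDFReal 0 1 x) := by
    intro k
    have h := integrable_pow_gaussianReal k
    rw [gaussianReal_of_var_ne_zero _ one_ne_zero,
      integrable_withDensity_iff_integrable_smul' (by fun_prop)
        (Eventually.of_forall fun x => by simp [gaussianPDF])] at h
    refine h.congr (Eventually.of_forall fun x => ?_)
    simp [gaussianPDF, ENNReal.toReal_ofReal (gaussianPDFReal_nonneg 0 1 x), mul_comm]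
  have hd : ∀ x : ℝ, HasDerivAt (fun x => -gaussianPDFReal 0 1 x)
      (x * gaussianPDFReal 0 1 x) x := by
    intro x
    have h1 : HasDerivAt (fun x : ℝ => -(x - 0) ^ 2 / (2 * ((1 : NNReal) : ℝ))) (-x) x := by
      have := (((hasDerivAt_id x).sub_const 0).pow 2).neg.div_const (2 * ((1 : NNReal) : ℝ))
      refine this.congr_deriv ?_
      simp
      ring
    have h2 := (h1.exp.const_mul (Real.sqrt (2 * Real.pi * ((1 : NNReal) : ℝ)))⁻¹).neg
    unfold gaussianPDFReal
    refine h2.congr_deriv ?_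
    ring
  have hi := integral_mul_deriv_eq_deriv_mul_of_integrable
    (u := fun x : ℝ => x ^ n) (u' := fun x => n * x ^ (n - 1))
    (v := fun x => -gaussianPDFReal 0 1 x) (v' := fun x => x * gaussianPDFReal 0 1 x)
    (fun x _ => hasDerivAt_pow n x) (fun x _ => hd x)
    ((key (n + 1)).congr (Eventually.of_forall fun x => by simp [pow_succ, mul_assoc]))
    (((key (n - 1)).const_mul (-(n : ℝ))).congr
      (Eventually.of_forall fun x => by simp [mul_assoc]))
    ((key n).neg.congr (Eventually.of_forall fun x => by simp))
  rw [integral_gaussianReal_eq_integral_smul one_ne_zero,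
    integral_gaussianReal_eq_integral_smul one_ne_zero, ← integral_const_mul]
  calc _ = ∫ x : ℝ, x ^ n * (x * gaussianPDFReal 0 1 x) := by
        congr 1; ext x; simp; ring
    _ = _ := by
        rw [hi, ← integral_neg]
        congr 1; ext x; simp; ring

section GaussianPolynomial

variable {S : Type*} [Fintype S]

/-- The law of a family of independent standard normal variables indexed by `S`. -/
noncomputable abbrev stdGaussianPi (S : Type*) [Fintype S] : Measure (S → ℝ) :=
  Measure.pi fun _ : S => gaussianReal 0 1

theorem integrable_eval_monomial (u : S →₀ ℕ) (a : ℝ) :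
    Integrable (fun x => MvPolynomial.eval x (MvPolynomial.monomial u a)) (stdGaussianPi S) := by
  have h : Integrable (fun x : S → ℝ => ∏ s, x s ^ u s) (stdGaussianPi S) :=
    Integrable.fintype_prod (f := fun s (x : ℝ) => x ^ u s)
      fun s => integrable_pow_gaussianReal (u s)
  refine (h.const_mul a).congr (Eventually.of_forall fun x => ?_)
  simp [MvPolynomial.eval_monomial, Finsupp.prod_fintype]

theorem integrable_eval (p : MvPolynomial S ℝ) :
    Integrable (fun x => MvPolynomial.eval x p) (stdGaussianPi S) := by
  induction p using MvPolynomial.induction_on' with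
  | monomial u a => exact integrable_eval_monomial u a
  | add p q hp hq =>
    simp only [map_add]
    exact hp.add hq

/-- The expectation of a polynomial in independent standard normal variables. -/
noncomputable def gaussianExp : MvPolynomial S ℝ →ₗ[ℝ] ℝ where
  toFun p := ∫ x, MvPolynomial.eval x p ∂stdGaussianPi S
  map_add' p q := by
    simp only [map_add]
    exact integral_add (integrable_eval p) (integrable_eval q)
  map_smul' c p := by
    simp only [MvPolynomial.smul_eval, RingHom.id_apply, smul_eq_mul]
    exact integral_const_mul c _

theorem gaussianExp_apply (p : MvPolynomial S ℝ) :
    gaussianExp p = ∫ x, MvPolynomial.eval x p ∂stdGaussianPi S := rfl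

theorem gaussianExp_one : gaussianExp (1 : MvPolynomial S ℝ) = 1 := by
  simp [gaussianExp_apply]

theorem gaussianExp_monomial (u : S →₀ ℕ) (a : ℝ) :
    gaussianExp (MvPolynomial.monomial u a) = a * ∏ s, ∫ x, x ^ u s ∂gaussianReal 0 1 := by
  rw [gaussianExp_apply, ← integral_fintype_prod_eq_prod (f := fun s (x : ℝ) => x ^ u s),
    ← integral_const_mul]
  congr 1
  ext x
  simp [MvPolynomial.eval_monomial, Finsupp.prod_fintype]

/-- Gaussian integration by parts: `E[x_s p(x)] = E[∂_s p(x)]`. -/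
theorem gaussianExp_X_mul (s : S) (p : MvPolynomial S ℝ) :
    gaussianExp (MvPolynomial.X s * p) = gaussianExp (MvPolynomial.pderiv s p) := by
  induction p using MvPolynomial.induction_on' with
  | add p q hp hq => rw [mul_add, map_add, map_add, map_add, hp, hq]
  | monomial u a =>
    rw [MvPolynomial.pderiv_monomial, MvPolynomial.X, MvPolynomial.monomial_mul, one_mul,
      gaussianExp_monomial, gaussianExp_monomial,
      ← Finset.mul_prod_erase Finset.univ _ (Finset.mem_univ s),
      ← Finset.mul_prod_erase Finset.univ (fun t => ∫ x, x ^ (u - Finsupp.single s 1 : S →₀ ℕ) t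
        ∂gaussianReal 0 1) (Finset.mem_univ s)]
    have h1 : ∀ t ∈ Finset.univ.erase s, ∫ x, x ^ (Finsupp.single s 1 + u : S →₀ ℕ) t ∂gaussianReal 0 1
        = ∫ x, x ^ (u - Finsupp.single s 1 : S →₀ ℕ) t ∂gaussianReal 0 1 := by
      intro t ht
      have : s ≠ t := (Finset.ne_of_mem_erase ht).symm
      simp [this]
    rw [Finset.prod_congr rfl h1]
    have h2 : (Finsupp.single s 1 + u : S →₀ ℕ) s = u s + 1 := by simp [add_comm]
    have h3 : (u - Finsupp.single s 1 : S →₀ ℕ) s = u s - 1 := by simp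
    rw [h2, h3, integral_pow_succ_gaussianReal]
    ring

end GaussianPolynomial

/-! ### Mixed moments of the entries of powers -/

section MixedMoments

variable {N : ℕ}

/-- The matrix with entries `c i j N^{-1/2} x_{ij}`, as a symmetric matrix of polynomials in
variables indexed by unordered pairs. -/
noncomputable def polyWigner (c : Fin N → Fin N → ℝ) :
    Matrix (Fin N) (Fin N) (MvPolynomial (Sym2 (Fin N)) ℝ) :=
  Matrix.of fun i j => (c i j * (Real.sqrt N)⁻¹) • MvPolynomial.X s(i, j)

/-- The derivation `F ↦ c p j N^{-1/2} ∂F/∂x_{pj}`: by Gaussian integration by parts, its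
expectation is that of `F` multiplied by the entry `(p, j)` of `polyWigner c`. -/
noncomputable def entryDeriv (c : Fin N → Fin N → ℝ) (p j : Fin N) :
    Derivation ℝ (MvPolynomial (Sym2 (Fin N)) ℝ) (MvPolynomial (Sym2 (Fin N)) ℝ) :=
  (c p j * (Real.sqrt N)⁻¹) • MvPolynomial.pderiv s(p, j)

theorem gaussianExp_polyWigner_mul (c : Fin N → Fin N → ℝ) (p j : Fin N)
    (F : MvPolynomial (Sym2 (Fin N)) ℝ) :
    gaussianExp (polyWigner c p j * F) = gaussianExp (entryDeriv c p j F) := by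
  simp only [polyWigner, entryDeriv, Matrix.of_apply, smul_mul_assoc, map_smul,
    Derivation.smul_apply, gaussianExp_X_mul]

theorem entryDeriv_polyWigner {c : Fin N → Fin N → ℝ} (hc : ∀ i j, c i j = c j i)
    (p j a b : Fin N) :
    entryDeriv c p j (polyWigner c a b) = (c p j ^ 2 / N) •
      ((if a = p then if j = b then 1 else 0 else 0) +
        if j = p then 0 else if a = j then if p = b then 1 else 0 else 0) := by
  have hsq : (Real.sqrt N)⁻¹ * (Real.sqrt N)⁻¹ = (N : ℝ)⁻¹ := by
    rw [← mul_inv, Real.mul_self_sqrt (Nat.cast_nonneg N)]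
  have key : (c p j * (Real.sqrt N)⁻¹) * (c p j * (Real.sqrt N)⁻¹) = c p j ^ 2 / N := by
    rw [div_eq_mul_inv, ← hsq]; ring
  simp only [polyWigner, entryDeriv, Matrix.of_apply, Derivation.smul_apply, Derivation.map_smul,
    MvPolynomial.pderiv_X, Pi.single_apply, Sym2.eq_iff]
  rw [smul_smul]
  by_cases h1 : a = p ∧ b = j
  · obtain ⟨rfl, rfl⟩ := h1
    simp only [key]
    by_cases h : b = a <;> simp [h, Ne.symm]
  · by_cases h2 : a = j ∧ b = p
    · obtain ⟨rfl, rfl⟩ := h2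
      have hne : a ≠ b := fun h => h1 ⟨h, h.symm⟩
      rw [hc a b]
      simp [key, hne]
    · rw [if_neg (by tauto)]
      have : ((if a = p then if j = b then 1 else 0 else 0 : MvPolynomial (Sym2 (Fin N)) ℝ) +
        if j = p then 0 else if a = j then if p = b then 1 else 0 else 0) = 0 := by
        split_ifs <;> simp_all
      rw [this, smul_zero, smul_zero]

/-- The derivative of an entry of a power, by the Leibniz rule. -/
theorem entryDeriv_pow_succ {c : Fin N → Fin N → ℝ} (hc : ∀ i j, c i j = c j i)
    (p j : Fin N) (m : ℕ) (a b : Fin N) :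
    entryDeriv c p j ((polyWigner c ^ (m + 1)) a b) = (c p j ^ 2 / N) •
      ∑ xy ∈ Finset.HasAntidiagonal.antidiagonal m,
        ((polyWigner c ^ xy.1) a p * (polyWigner c ^ xy.2) j b +
          if j = p then 0 else (polyWigner c ^ xy.1) a j * (polyWigner c ^ xy.2) p b) := by
  have last : ∀ (m : ℕ) (a b : Fin N),
      ∑ k, (polyWigner c ^ m) a k * entryDeriv c p j (polyWigner c k b) =
      (c p j ^ 2 / N) • ((polyWigner c ^ m) a p * (1 : Matrix _ _ _) j b +
          if j = p then 0 else (polyWigner c ^ m) a j * (1 : Matrix _ _ _) p b) := by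
    intro m a b
    simp only [entryDeriv_polyWigner hc, mul_smul_comm, ← Finset.smul_sum, mul_add,
      Finset.sum_add_distrib, Matrix.one_apply]
    congr 2
    · simp
    · by_cases h : j = p <;> simp [h]
  induction m generalizing b with
  | zero =>
    have := last 0 a b
    simp only [pow_zero, Matrix.one_apply, ite_mul, one_mul, zero_mul, Finset.sum_ite_eq,
      Finset.mem_univ, if_true] at this
    simp only [zero_add, pow_one, this, Finset.Nat.antidiagonal_zero, Finset.sum_singleton, pow_zero,
      Matrix.one_apply]
    congr 2
    · split_ifs <;> simp
    · split_ifs <;> simp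
  | succ m ih =>
    rw [pow_succ, Matrix.mul_apply, map_sum]
    simp only [Derivation.leibniz, smul_eq_mul]
    rw [Finset.sum_add_distrib, last, Finset.Nat.sum_antidiagonal_succ']
    conv_rhs => rw [smul_add, pow_zero]
    congr 1
    simp only [ih, mul_smul_comm, ← Finset.smul_sum, Finset.mul_sum]
    rw [Finset.sum_comm]
    congr 1
    refine Finset.sum_congr rfl fun xy _ => ?_
    rw [pow_succ, Matrix.mul_apply, Matrix.mul_apply]
    by_cases h : j = p
    · simp only [h, if_true, add_zero, Finset.mul_sum]
      exact Finset.sum_congr rfl fun k _ => by ring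
    · simp only [h, if_false, Finset.mul_sum, ← Finset.sum_add_distrib]
      exact Finset.sum_congr rfl fun k _ => by ring

/-- The recursion that the limits of the diagonal entries of the powers satisfy, with a bound
on their growth. -/
structure IsMomentSeq (c : Fin N → Fin N → ℝ) (R : ℝ) (a : ℕ → Fin N → ℝ) : Prop where
  zero : ∀ i, a 0 i = 1
  one : ∀ i, a 1 i = 0
  succ_succ : ∀ m i, a (m + 2) i =
    ∑ xy ∈ Finset.HasAntidiagonal.antidiagonal m, ((N : ℝ)⁻¹ * ∑ j, c i j ^ 2 * a xy.1 j) * a xy.2 i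
  bound : ∀ k i, |a k i| ≤ R ^ k

/-- The entry `(p, q)` of the `k`-th power of `polyWigner c`, for `e = (k, p, q)`. -/
noncomputable def powEntry (c : Fin N → Fin N → ℝ) (e : ℕ × Fin N × Fin N) :
    MvPolynomial (Sym2 (Fin N)) ℝ := (polyWigner c ^ e.1) e.2.1 e.2.2

/-- The approximate value of `powEntry`: off-diagonal entries are negligible. -/
noncomputable def entryValue (a : ℕ → Fin N → ℝ) (e : ℕ × Fin N × Fin N) : ℝ :=
  if e.2.1 = e.2.2 then a e.1 e.2.1 else 0

/-- The expectation of a product of entries of powers differs from the product of the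
approximate values by at most `C / N`, if there are at most `r` factors and the total degree is
at most `d`. -/
def MomentApprox (c : Fin N → Fin N → ℝ) (a : ℕ → Fin N → ℝ) (r d : ℕ) (C : ℝ) : Prop :=
  ∀ l : List (ℕ × Fin N × Fin N), l.length ≤ r → (l.map Prod.fst).sum ≤ d →
    |gaussianExp (l.map (powEntry c)).prod - (l.map (entryValue a)).prod| ≤ C / N

variable {c : Fin N → Fin N → ℝ} {a : ℕ → Fin N → ℝ} {R M C : ℝ} {r d : ℕ}

theorem abs_prod_entryValue_le (hR : 1 ≤ R) (ha : IsMomentSeq c R a)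
    (l : List (ℕ × Fin N × Fin N)) (hl : (l.map Prod.fst).sum ≤ d) :
    |(l.map (entryValue a)).prod| ≤ R ^ d := by
  refine le_trans ?_ (pow_le_pow_right₀ hR hl)
  clear hl
  induction l with
  | nil => simp
  | cons e l ih =>
    simp only [List.map_cons, List.prod_cons, List.sum_cons, abs_mul, pow_add]
    gcongr
    unfold entryValue
    split_ifs
    · exact ha.bound _ _
    · simp; positivity

theorem entryDeriv_one_apply (c : Fin N → Fin N → ℝ) (p j a b : Fin N) :
    entryDeriv c p j ((1 : Matrix (Fin N) (Fin N) (MvPolynomial (Sym2 (Fin N)) ℝ)) a b) = 0 := by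
  rw [Matrix.one_apply]
  split_ifs <;> simp

/-- In `D_{pj} Q`, each term has an entry of the form `(j, ·)`; multiplied by the entry
`(j, q)` it is negligible unless `j = q`. -/
theorem abs_gaussianExp_entryDeriv_le (hc : ∀ i j, c i j = c j i) (hM : ∀ i j, |c i j| ≤ M)
    (hR : 1 ≤ R) (hC : 0 ≤ C) (ha : IsMomentSeq c R a) (H : MomentApprox c a (r + 2) d C)
    (k : ℕ) (p j q : Fin N) (Q₁ Q₂ : List (ℕ × Fin N × Fin N))
    (hlen : Q₁.length + Q₂.length ≤ r)
    (hsum : k + (Q₁.map Prod.fst).sum + (Q₂.map Prod.fst).sum ≤ d + 1) :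
    |gaussianExp ((polyWigner c ^ k) j q * (Q₂.map (powEntry c)).prod *
      entryDeriv c p j (Q₁.map (powEntry c)).prod)| ≤
      M ^ 2 / N * ((Q₁.map Prod.fst).sum : ℕ) * (2 * (C / N + if j = q then R ^ d else 0)) := by
  have hE : 0 ≤ C / N + (if j = q then R ^ d else 0) := by
    have : 0 ≤ C / N := by positivity
    split_ifs <;> positivity
  have hb : ∀ l : List (ℕ × Fin N × Fin N), l.length ≤ r + 1 →
      k + (l.map Prod.fst).sum ≤ d →
      |gaussianExp ((polyWigner c ^ k) j q * (l.map (powEntry c)).prod)| ≤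
        C / N + if j = q then R ^ d else 0 := by
    intro l h1 h2
    have h := H ((k, j, q) :: l) (by simp; omega) (by simpa using h2)
    have hv := abs_prod_entryValue_le (d := d) hR ha ((k, j, q) :: l) (by simpa using h2)
    simp only [List.map_cons, List.prod_cons] at h hv
    have e1 : powEntry c (k, j, q) = (polyWigner c ^ k) j q := rfl
    rw [e1] at h
    by_cases hjq : j = q
    · rw [if_pos hjq]
      have := abs_sub_abs_le_abs_sub (gaussianExp ((polyWigner c ^ k) j q *
        (l.map (powEntry c)).prod)) (entryValue a (k, j, q) * (l.map (entryValue a)).prod)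
      linarith
    · have e2 : entryValue a (k, j, q) = 0 := by simp [entryValue, hjq]
      rw [e2, zero_mul, sub_zero] at h
      simpa [hjq] using h
  generalize C / (N : ℝ) + (if j = q then R ^ d else 0) = E at hE hb ⊢
  induction Q₁ generalizing Q₂ with
  | nil => simp
  | cons e Q₁ ih =>
    obtain ⟨m, u, v⟩ := e
    simp only [List.length_cons, List.map_cons, List.sum_cons] at hlen hsum
    have h1 := ih ((m, u, v) :: Q₂) (by simp; omega) (by simp; omega)
    simp only [List.map_cons, List.prod_cons, List.sum_cons, Derivation.leibniz, smul_eq_mul,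
      Nat.cast_add] at h1 ⊢
    have h2 : |gaussianExp ((polyWigner c ^ k) j q * (Q₂.map (powEntry c)).prod *
        ((Q₁.map (powEntry c)).prod * entryDeriv c p j (powEntry c (m, u, v))))| ≤
        M ^ 2 / N * m * (2 * E) := by
      cases m with
      | zero =>
        have : entryDeriv c p j (powEntry c (0, u, v)) = 0 := entryDeriv_one_apply c p j u v
        simp [this]
      | succ m =>
        have e0 : powEntry c (m + 1, u, v) = (polyWigner c ^ (m + 1)) u v := rfl
        rw [e0, entryDeriv_pow_succ hc]
        simp only [mul_smul_comm, Finset.mul_sum, map_smul, map_sum, smul_eq_mul]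
        rw [← Finset.mul_sum, abs_mul, mul_assoc (M ^ 2 / N)]
        have hcM : |c p j ^ 2 / N| ≤ M ^ 2 / N := by
          rw [abs_of_nonneg (by positivity)]
          exact div_le_div_of_nonneg_right (sq_le_sq' (by linarith [neg_abs_le (c p j), hM p j])
            (le_trans (le_abs_self _) (hM p j))) (Nat.cast_nonneg N)
        refine mul_le_mul hcM ?_ (abs_nonneg _) (by positivity)
        refine (Finset.abs_sum_le_sum_abs _ _).trans ?_
        have : ∀ xy ∈ Finset.HasAntidiagonal.antidiagonal m, |gaussianExp ((polyWigner c ^ k) j q *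
            (Q₂.map (powEntry c)).prod * ((Q₁.map (powEntry c)).prod *
            ((polyWigner c ^ xy.1) u p * (polyWigner c ^ xy.2) j v +
            if j = p then 0 else (polyWigner c ^ xy.1) u j * (polyWigner c ^ xy.2) p v)))| ≤
            2 * E := by
          rintro ⟨x, y⟩ hxy
          have hxy : x + y = m := by simpa using hxy
          have t1 := hb ((x, u, p) :: (y, j, v) :: (Q₁ ++ Q₂)) (by simp; omega)
            (by simp; omega)
          have t2 := hb ((x, u, j) :: (y, p, v) :: (Q₁ ++ Q₂)) (by simp; omega)
            (by simp; omega)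
          simp only [List.map_cons, List.prod_cons, List.map_append, List.prod_append,
            powEntry] at t1 t2
          simp only [mul_add, map_add]
          refine (abs_add_le _ _).trans ?_
          rw [two_mul]
          refine add_le_add ?_ ?_
          · refine le_of_eq_of_le ?_ t1
            congr 2
            ring
          · by_cases hjp : j = p
            · simpa [hjp] using hE
            · refine le_of_eq_of_le ?_ t2
              rw [if_neg hjp]
              congr 2
              ring
        refine (Finset.sum_le_sum this).trans ?_
        simp
    rw [mul_add, map_add]
    refine (abs_add_le _ _).trans ?_
    have e3 : (polyWigner c ^ k) j q * (Q₂.map (powEntry c)).prod *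
        (powEntry c (m, u, v) * entryDeriv c p j (Q₁.map (powEntry c)).prod) =
        (polyWigner c ^ k) j q * (powEntry c (m, u, v) * (Q₂.map (powEntry c)).prod) *
        entryDeriv c p j (Q₁.map (powEntry c)).prod := by ring
    rw [e3]
    linarith

/-- One step of the induction on the degree: the first factor `Z_{pj}` of `(Z^{k+1})_{pq}` is
removed by Gaussian integration by parts. -/
theorem MomentApprox.step_cons (hN : 0 < N) (hc : ∀ i j, c i j = c j i)
    (hM : ∀ i j, |c i j| ≤ M) (hR : 1 ≤ R) (hC : 0 ≤ C) (ha : IsMomentSeq c R a)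
    (H : MomentApprox c a (r + 2) d C) (k : ℕ) (p q : Fin N) (Q : List (ℕ × Fin N × Fin N))
    (hlen : Q.length ≤ r) (hsum : k + (Q.map Prod.fst).sum ≤ d) :
    |gaussianExp ((polyWigner c ^ (k + 1)) p q * (Q.map (powEntry c)).prod) -
      entryValue a (k + 1, p, q) * (Q.map (entryValue a)).prod| ≤
      (M ^ 2 * (d + 1) * (4 * C + 2 * R ^ d)) / N := by
  have hN' : (0 : ℝ) < N := by exact_mod_cast hN
  have hcM : ∀ j, c p j ^ 2 ≤ M ^ 2 := fun j =>
    sq_le_sq' (by linarith [neg_abs_le (c p j), hM p j]) (le_trans (le_abs_self _) (hM p j))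
  have e1 : gaussianExp ((polyWigner c ^ (k + 1)) p q * (Q.map (powEntry c)).prod) =
      ∑ j, gaussianExp ((Q.map (powEntry c)).prod * entryDeriv c p j ((polyWigner c ^ k) j q)) +
      ∑ j, gaussianExp ((polyWigner c ^ k) j q * (([] : List (ℕ × Fin N × Fin N)).map
        (powEntry c)).prod * entryDeriv c p j (Q.map (powEntry c)).prod) := by
    rw [pow_succ', Matrix.mul_apply, Finset.sum_mul, map_sum, ← Finset.sum_add_distrib]
    refine Finset.sum_congr rfl fun j _ => ?_
    rw [mul_assoc, gaussianExp_polyWigner_mul, Derivation.leibniz, map_add, add_comm]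
    simp
  have b2 : |∑ j, gaussianExp ((polyWigner c ^ k) j q * (([] : List (ℕ × Fin N × Fin N)).map
        (powEntry c)).prod * entryDeriv c p j (Q.map (powEntry c)).prod)| ≤
        (M ^ 2 * (d + 1) * (2 * C + 2 * R ^ d)) / N := by
    refine (Finset.abs_sum_le_sum_abs _ _).trans ?_
    refine (Finset.sum_le_sum fun j _ => abs_gaussianExp_entryDeriv_le hc hM hR hC ha H k p j q
      Q [] (by simpa using hlen) (by simp; omega)).trans ?_
    rw [← Finset.mul_sum, ← Finset.mul_sum, Finset.sum_add_distrib, Finset.sum_ite_eq',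
      if_pos (Finset.mem_univ q), Finset.sum_const, Finset.card_univ, Fintype.card_fin,
      nsmul_eq_mul, mul_div_cancel₀ _ hN'.ne']
    have : (((Q.map Prod.fst).sum : ℕ) : ℝ) ≤ d + 1 := by
      have : (Q.map Prod.fst).sum ≤ d + 1 := by omega
      exact_mod_cast this
    calc M ^ 2 / N * (((Q.map Prod.fst).sum : ℕ) : ℝ) * (2 * (C + R ^ d))
        ≤ M ^ 2 / N * (d + 1) * (2 * (C + R ^ d)) := by gcongr
      _ = _ := by ring
  have b1 : |∑ j, gaussianExp ((Q.map (powEntry c)).prod *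
      entryDeriv c p j ((polyWigner c ^ k) j q)) -
      entryValue a (k + 1, p, q) * (Q.map (entryValue a)).prod| ≤
        (M ^ 2 * (d + 1) * (2 * C)) / N := by
    cases k with
    | zero =>
      have : entryValue a (0 + 1, p, q) = 0 := by simp [entryValue, ha.one]
      rw [this]
      simp only [pow_zero, entryDeriv_one_apply]
      simp
      positivity
    | succ m =>
      set V := (Q.map (entryValue a)).prod with hV
      have hval : entryValue a (m + 1 + 1, p, q) * V =
          ∑ j, c p j ^ 2 / N * ∑ xy ∈ Finset.HasAntidiagonal.antidiagonal m,
            a xy.1 j * entryValue a (xy.2, p, q) * V := by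
        unfold entryValue
        by_cases hpq : p = q
        · simp only [hpq, if_true, ha.succ_succ, Finset.sum_mul, Finset.mul_sum]
          rw [Finset.sum_comm]
          exact Finset.sum_congr rfl fun j _ => Finset.sum_congr rfl fun xy _ => by ring
        · simp [hpq]
      rw [hval, ← Finset.sum_sub_distrib]
      refine (Finset.abs_sum_le_sum_abs _ _).trans ?_
      have hj : ∀ j ∈ Finset.univ, |gaussianExp ((Q.map (powEntry c)).prod *
          entryDeriv c p j ((polyWigner c ^ (m + 1)) j q)) - c p j ^ 2 / N *
          ∑ xy ∈ Finset.HasAntidiagonal.antidiagonal m,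
            a xy.1 j * entryValue a (xy.2, p, q) * V| ≤
          M ^ 2 / N * ((d + 1) * (2 * (C / N))) := by
        intro j _
        rw [entryDeriv_pow_succ hc, mul_smul_comm, map_smul, smul_eq_mul, ← mul_sub,
          Finset.mul_sum, map_sum, ← Finset.sum_sub_distrib, abs_mul]
        rw [abs_of_nonneg (by positivity)]
        refine mul_le_mul (div_le_div_of_nonneg_right (hcM j) hN'.le) ?_ (abs_nonneg _)
          (by positivity)
        refine (Finset.abs_sum_le_sum_abs _ _).trans ?_
        have hxy : ∀ xy ∈ Finset.HasAntidiagonal.antidiagonal m,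
            |gaussianExp ((Q.map (powEntry c)).prod *
            ((polyWigner c ^ xy.1) j p * (polyWigner c ^ xy.2) j q +
            if j = p then 0 else (polyWigner c ^ xy.1) j j * (polyWigner c ^ xy.2) p q)) -
            a xy.1 j * entryValue a (xy.2, p, q) * V| ≤ 2 * (C / N) := by
          rintro ⟨x, y⟩ hxy
          have hxy : x + y = m := by simpa using hxy
          have t1 := H ((x, j, p) :: (y, j, q) :: Q) (by simp; omega) (by simp; omega)
          have t2 := H ((x, j, j) :: (y, p, q) :: Q) (by simp; omega) (by simp; omega)
          simp only [List.map_cons, List.prod_cons, ← hV] at t1 t2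
          have hCN : 0 ≤ C / N := by positivity
          by_cases hjp : j = p
          · subst hjp
            have : entryValue a (x, j, j) = a x j := by simp [entryValue]
            rw [this] at t1
            refine le_trans (le_of_eq ?_) (t1.trans (by linarith))
            simp only [powEntry, if_true, add_zero]
            congr 2
            · congr 1; ring
            · ring
          · have h0 : entryValue a (x, j, p) = 0 := by simp [entryValue, hjp]
            have h1 : entryValue a (x, j, j) = a x j := by simp [entryValue]
            rw [h0, zero_mul, sub_zero] at t1
            rw [h1] at t2
            rw [if_neg hjp, mul_add, map_add, add_sub_assoc]
            refine (abs_add_le _ _).trans ?_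
            rw [two_mul]
            refine add_le_add (le_trans (le_of_eq ?_) t1) (le_trans (le_of_eq ?_) t2)
            · congr 2
              simp only [powEntry]
              ring
            · congr 2
              · congr 1
                simp only [powEntry]
                ring
              · ring
        refine (Finset.sum_le_sum hxy).trans ?_
        rw [Finset.sum_const, Finset.Nat.card_antidiagonal, nsmul_eq_mul]
        have : ((m + 1 : ℕ) : ℝ) ≤ d + 1 := by
          have : m + 1 ≤ d + 1 := by omega
          exact_mod_cast this
        gcongr
      refine (Finset.sum_le_sum hj).trans (le_of_eq ?_)
      rw [Finset.sum_const, Finset.card_univ, Fintype.card_fin, nsmul_eq_mul]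
      field_simp
  rw [e1, add_sub_right_comm]
  refine (abs_add_le _ _).trans ((add_le_add b1 b2).trans (le_of_eq ?_))
  ring

theorem momentApprox_zero (ha : IsMomentSeq c R a) (l : List (ℕ × Fin N × Fin N))
    (hl : ∀ e ∈ l, e.1 = 0) :
    gaussianExp (l.map (powEntry c)).prod = (l.map (entryValue a)).prod := by
  have : (l.map (powEntry c)).prod = MvPolynomial.C (l.map (entryValue a)).prod := by
    induction l with
    | nil => simp
    | cons e l ih =>
      simp only [List.map_cons, List.prod_cons, map_mul]
      rw [ih fun e he => hl e (List.mem_cons_of_mem _ he)]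
      congr 1
      have := hl e List.mem_cons_self
      simp only [powEntry, entryValue, this, pow_zero, Matrix.one_apply, ha.zero]
      split_ifs <;> simp
  rw [this, ← mul_one (MvPolynomial.C _), ← MvPolynomial.smul_eq_C_mul, map_smul,
    gaussianExp_one, smul_eq_mul, mul_one]

theorem MomentApprox.step (hN : 0 < N) (hc : ∀ i j, c i j = c j i)
    (hM : ∀ i j, |c i j| ≤ M) (hR : 1 ≤ R) (hC : 0 ≤ C) (ha : IsMomentSeq c R a)
    (H : MomentApprox c a (r + 2) d C) :
    MomentApprox c a (r + 1) (d + 1) (M ^ 2 * (d + 1) * (4 * C + 2 * R ^ d)) := by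
  intro l hlen hsum
  by_cases hl : ∀ e ∈ l, e.1 = 0
  · rw [momentApprox_zero ha l hl, sub_self, abs_zero]
    positivity
  · push Not at hl
    obtain ⟨e, he, hk⟩ := hl
    have hperm := List.perm_cons_erase he
    obtain ⟨k, p, q⟩ := e
    obtain ⟨k, rfl⟩ := Nat.exists_eq_succ_of_ne_zero hk
    rw [(hperm.map (powEntry c)).prod_eq, (hperm.map (entryValue a)).prod_eq]
    have h1 := hperm.length_eq
    have h2 := (hperm.map Prod.fst).sum_eq
    simp only [List.length_cons, List.map_cons, List.sum_cons] at h1 h2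
    exact H.step_cons hN hc hM hR hC ha k p q _ (by omega) (by omega)

/-- The constants of the moment approximation depend only on the number of factors, the degree
and the bounds. -/
theorem exists_momentApprox (M R : ℝ) (hR : 1 ≤ R) (d r : ℕ) :
    ∃ C : ℝ, 0 ≤ C ∧ ∀ (N : ℕ) (c : Fin N → Fin N → ℝ) (a : ℕ → Fin N → ℝ), 0 < N →
      (∀ i j, c i j = c j i) → (∀ i j, |c i j| ≤ M) → IsMomentSeq c R a →
      MomentApprox c a r d C := by
  induction d generalizing r with
  | zero =>
    refine ⟨0, le_rfl, fun N c a _ _ _ ha l _ hl => ?_⟩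
    rw [momentApprox_zero ha l, sub_self, abs_zero, zero_div]
    intro e he
    have := List.single_le_sum (l := l.map Prod.fst) (by simp) e.1
      (List.mem_map_of_mem he)
    omega
  | succ d ih =>
    obtain ⟨C, hC, h⟩ := ih (r + 2)
    refine ⟨M ^ 2 * (d + 1) * (4 * C + 2 * R ^ d), by positivity,
      fun N c a hN hc hM ha l hl => ?_⟩
    exact (h N c a hN hc hM ha).step hN hc hM hR hC ha l (by omega)

/-- The second moment of the fluctuation of a normalized trace. -/
theorem gaussianExp_trace_sub_sq_le (hN : 0 < N) (hR : 1 ≤ R) (ha : IsMomentSeq c R a) (k : ℕ)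
    (H : MomentApprox c a 2 (2 * k) C) :
    ∫ x, ((N : ℝ)⁻¹ * ∑ i, MvPolynomial.eval x ((polyWigner c ^ k) i i) -
      (N : ℝ)⁻¹ * ∑ i, a k i) ^ 2 ∂stdGaussianPi (Sym2 (Fin N)) ≤ (C + 2 * R ^ k * C) / N := by
  have hN' : (0 : ℝ) < N := by exact_mod_cast hN
  set T : MvPolynomial (Sym2 (Fin N)) ℝ := ∑ i, (polyWigner c ^ k) i i with hT
  set A : ℝ := ∑ i, a k i with hA
  have hAle : |A| ≤ N * R ^ k := by
    refine (Finset.abs_sum_le_sum_abs _ _).trans ((Finset.sum_le_sum fun i _ =>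
      ha.bound k i).trans ?_)
    simp
  have hT1 : |gaussianExp T - A| ≤ C := by
    rw [hT, hA, map_sum, ← Finset.sum_sub_distrib]
    refine (Finset.abs_sum_le_sum_abs _ _).trans ?_
    have : ∀ i ∈ Finset.univ, |gaussianExp ((polyWigner c ^ k) i i) - a k i| ≤ C / N := by
      intro i _
      have := H [(k, i, i)] (by simp) (by simp; omega)
      simpa [powEntry, entryValue] using this
    refine (Finset.sum_le_sum this).trans (le_of_eq ?_)
    rw [Finset.sum_const, Finset.card_univ, Fintype.card_fin, nsmul_eq_mul]
    field_simp
  have hT2 : |gaussianExp (T * T) - A * A| ≤ C * N := by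
    rw [hT, hA, Finset.sum_mul_sum, Finset.sum_mul_sum, map_sum, ← Finset.sum_sub_distrib]
    refine (Finset.abs_sum_le_sum_abs _ _).trans ?_
    have : ∀ i ∈ Finset.univ, |gaussianExp (∑ j, (polyWigner c ^ k) i i *
        (polyWigner c ^ k) j j) - ∑ j, a k i * a k j| ≤ C := by
      intro i _
      rw [map_sum, ← Finset.sum_sub_distrib]
      refine (Finset.abs_sum_le_sum_abs _ _).trans ?_
      have : ∀ j ∈ Finset.univ, |gaussianExp ((polyWigner c ^ k) i i * (polyWigner c ^ k) j j) -
          a k i * a k j| ≤ C / N := by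
        intro j _
        have := H [(k, i, i), (k, j, j)] (by simp) (by simp; omega)
        simpa [powEntry, entryValue] using this
      refine (Finset.sum_le_sum this).trans (le_of_eq ?_)
      rw [Finset.sum_const, Finset.card_univ, Fintype.card_fin, nsmul_eq_mul]
      field_simp
    refine (Finset.sum_le_sum this).trans (le_of_eq ?_)
    rw [Finset.sum_const, Finset.card_univ, Fintype.card_fin, nsmul_eq_mul, mul_comm]
  have e : ∫ x, ((N : ℝ)⁻¹ * ∑ i, MvPolynomial.eval x ((polyWigner c ^ k) i i) -
      (N : ℝ)⁻¹ * A) ^ 2 ∂stdGaussianPi (Sym2 (Fin N)) =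
      (N : ℝ)⁻¹ ^ 2 * (gaussianExp (T * T) - A * A - 2 * A * (gaussianExp T - A)) := by
    have : gaussianExp ((T - MvPolynomial.C A) * (T - MvPolynomial.C A)) =
        gaussianExp (T * T) - A * A - 2 * A * (gaussianExp T - A) := by
      have : (T - MvPolynomial.C A) * (T - MvPolynomial.C A) =
          T * T - (2 * A) • T + (A * A) • 1 := by
        simp only [MvPolynomial.smul_eq_C_mul, map_mul, map_ofNat]
        ring
      rw [this, map_add, map_sub, map_smul, map_smul, gaussianExp_one]
      simp only [smul_eq_mul]
      ring
    rw [← this, gaussianExp_apply, ← integral_const_mul]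
    congr 1
    ext x
    simp only [hT, map_mul, map_sub, map_sum, MvPolynomial.eval_C]
    ring
  rw [e]
  have h3 : |2 * A * (gaussianExp T - A)| ≤ 2 * (N * R ^ k) * C := by
    rw [abs_mul, abs_mul, abs_two]
    gcongr
  have h4 : gaussianExp (T * T) - A * A - 2 * A * (gaussianExp T - A) ≤
      N * (C + 2 * R ^ k * C) := by
    linarith [le_abs_self (gaussianExp (T * T) - A * A),
      neg_abs_le (2 * A * (gaussianExp T - A))]
  calc _ ≤ (N : ℝ)⁻¹ ^ 2 * (N * (C + 2 * R ^ k * C)) := by gcongr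
    _ = _ := by field_simp

end MixedMoments

/-! ### Rooted weights of binary trees -/

section TreeWeight

variable {N : ℕ}

/-- The weight of a binary tree at a root label `i`, that is, the contribution of the
corresponding non-crossing pairing to the limit of the diagonal entry `(Z^{2n})_{ii}`. The tree
with subtrees `l` and `r` stands for the pairing in which the first point is paired so that `l`
is enclosed and `r` follows. -/
noncomputable def treeWeight (c : Fin N → Fin N → ℝ) : BinaryTree Unit → Fin N → ℝ
  | .nil, _ => 1
  | .node _ l r, i => treeWeight c r i * ((N : ℝ)⁻¹ * ∑ j, c i j ^ 2 * treeWeight c l j)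

/-- The limit of the diagonal entry `(Z^k)_{ii}`. -/
noncomputable def treeMoment (c : Fin N → Fin N → ℝ) (k : ℕ) (i : Fin N) : ℝ :=
  if Even k then ∑ t ∈ BinaryTree.treesOfNumNodesEq (k / 2), treeWeight c t i else 0

theorem treeMoment_two_mul (c : Fin N → Fin N → ℝ) (n : ℕ) (i : Fin N) :
    treeMoment c (2 * n) i = ∑ t ∈ BinaryTree.treesOfNumNodesEq n, treeWeight c t i := by
  simp [treeMoment]

theorem treeMoment_of_odd (c : Fin N → Fin N → ℝ) {k : ℕ} (hk : Odd k) (i : Fin N) :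
    treeMoment c k i = 0 := by
  simp [treeMoment, Nat.not_even_iff_odd.2 hk]

theorem sum_treesOfNumNodesEq_succ {A : Type*} [AddCommMonoid A] (F : BinaryTree Unit → A)
    (n : ℕ) :
    ∑ t ∈ BinaryTree.treesOfNumNodesEq (n + 1), F t =
      ∑ xy ∈ Finset.HasAntidiagonal.antidiagonal n,
        ∑ l ∈ BinaryTree.treesOfNumNodesEq xy.1, ∑ r ∈ BinaryTree.treesOfNumNodesEq xy.2,
          F (.node () l r) := by
  rw [BinaryTree.treesOfNumNodesEq_succ, Finset.sum_biUnion]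
  · refine Finset.sum_congr rfl fun xy _ => ?_
    rw [BinaryTree.pairwiseNode, Finset.sum_map, Finset.sum_product]
    rfl
  · simp_rw [Set.PairwiseDisjoint, Set.Pairwise, Finset.disjoint_left]
    aesop

theorem catalan_le_four_pow (n : ℕ) : catalan n ≤ 4 ^ n :=
  calc catalan n ≤ (n + 1) * catalan n := Nat.le_mul_of_pos_left _ n.succ_pos
    _ = n.centralBinom := succ_mul_catalan_eq_centralBinom n
    _ ≤ 4 ^ n := n.centralBinom_le_four_pow

theorem abs_treeWeight_le {c : Fin N → Fin N → ℝ} {M : ℝ} (hM : ∀ i j, |c i j| ≤ M)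
    (t : BinaryTree Unit) (i : Fin N) : |treeWeight c t i| ≤ M ^ (2 * t.numNodes) := by
  induction t generalizing i with
  | nil => simp [treeWeight]
  | node u l r ihl ihr =>
    have hN : 0 < N := lt_of_le_of_lt (Nat.zero_le _) i.isLt
    have hN' : (0 : ℝ) < N := by exact_mod_cast hN
    have hM0 : 0 ≤ M := (abs_nonneg _).trans (hM i i)
    have h1 : |(N : ℝ)⁻¹ * ∑ j, c i j ^ 2 * treeWeight c l j| ≤ M ^ 2 * M ^ (2 * l.numNodes) := by
      rw [abs_mul, abs_of_pos (by positivity : (0 : ℝ) < (N : ℝ)⁻¹)]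
      have : |∑ j, c i j ^ 2 * treeWeight c l j| ≤ N * (M ^ 2 * M ^ (2 * l.numNodes)) := by
        refine (Finset.abs_sum_le_sum_abs _ _).trans ?_
        refine (Finset.sum_le_sum (g := fun _ => M ^ 2 * M ^ (2 * l.numNodes))
          fun j _ => ?_).trans (by simp)
        rw [abs_mul, abs_pow]
        gcongr
        · exact hM i j
        · exact ihl j
      calc _ ≤ (N : ℝ)⁻¹ * (N * (M ^ 2 * M ^ (2 * l.numNodes))) := by gcongr
        _ = _ := by field_simp
    simp only [treeWeight, BinaryTree.numNodes, abs_mul] at h1 ⊢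
    calc _ ≤ M ^ (2 * r.numNodes) * (M ^ 2 * M ^ (2 * l.numNodes)) := by
          gcongr
          exact ihr i
      _ = _ := by ring

theorem isMomentSeq_treeMoment {c : Fin N → Fin N → ℝ} {M R : ℝ} (hM : ∀ i j, |c i j| ≤ M)
    (hR : 0 ≤ R) (hMR : 2 * M ≤ R) : IsMomentSeq c R (treeMoment c) where
  zero i := by
    have := treeMoment_two_mul c 0 i
    simpa [treeWeight] using this
  one i := treeMoment_of_odd c odd_one i
  succ_succ m i := by
    rcases Nat.even_or_odd m with hm | hm
    · obtain ⟨n, rfl⟩ := hm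
      have e : n + n + 2 = 2 * (n + 1) := by ring
      rw [e, treeMoment_two_mul, sum_treesOfNumNodesEq_succ]
      refine Finset.sum_of_injOn (fun xy => (2 * xy.1, 2 * xy.2)) ?_ ?_ ?_ ?_
      · rintro ⟨a, b⟩ _ ⟨a', b'⟩ _ h
        simpa using h
      · rintro ⟨a, b⟩ h
        have h : a + b = n := by simpa using h
        simp
        omega
      · rintro ⟨a, b⟩ h h'
        have h : a + b = n + n := by simpa using h
        have hodd : Odd b := by
          rw [← Nat.not_even_iff_odd]
          rintro ⟨y, hy⟩
          refine h' ⟨(n - y, y), ?_, ?_⟩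
          · simp
            omega
          · simp
            omega
        rw [treeMoment_of_odd c hodd, mul_zero]
      · rintro ⟨a, b⟩ _
        simp only [treeMoment_two_mul, treeWeight]
        have e : (N : ℝ)⁻¹ * ∑ j, c i j ^ 2 * ∑ t ∈ BinaryTree.treesOfNumNodesEq a,
            treeWeight c t j = ∑ t ∈ BinaryTree.treesOfNumNodesEq a,
              ((N : ℝ)⁻¹ * ∑ j, c i j ^ 2 * treeWeight c t j) := by
          simp_rw [Finset.mul_sum]
          rw [Finset.sum_comm]
        rw [e, Finset.sum_mul_sum]
        exact Finset.sum_congr rfl fun l _ => Finset.sum_congr rfl fun r _ => mul_comm _ _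
    · rw [treeMoment_of_odd c (hm.add_even even_two)]
      symm
      refine Finset.sum_eq_zero ?_
      rintro ⟨a, b⟩ h
      have h : a + b = m := by simpa using h
      rcases Nat.even_or_odd a with ha | ha
      · rw [treeMoment_of_odd c (k := b), mul_zero]
        rw [← h] at hm
        exact (Nat.odd_add'.1 hm).2 ha
      · have : ∀ j, treeMoment c a j = 0 := fun j => treeMoment_of_odd c ha j
        simp [this]
  bound k i := by
    rcases Nat.even_or_odd' k with ⟨n, rfl | rfl⟩
    · have hM0 : 0 ≤ M := (abs_nonneg _).trans (hM i i)
      rw [treeMoment_two_mul]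
      refine (Finset.abs_sum_le_sum_abs _ _).trans ?_
      have : ∀ t ∈ BinaryTree.treesOfNumNodesEq n, |treeWeight c t i| ≤ M ^ (2 * n) := by
        intro t ht
        rw [← BinaryTree.mem_treesOfNumNodesEq.1 ht]
        exact abs_treeWeight_le hM t i
      refine (Finset.sum_le_sum this).trans ?_
      rw [Finset.sum_const, BinaryTree.treesOfNumNodesEq_card_eq_catalan, nsmul_eq_mul]
      have h4 : (catalan n : ℝ) ≤ 4 ^ n := by exact_mod_cast catalan_le_four_pow n
      calc (catalan n : ℝ) * M ^ (2 * n) ≤ 4 ^ n * M ^ (2 * n) := by gcongr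
        _ = (2 * M) ^ (2 * n) := by rw [mul_pow, pow_mul 2]; norm_num
        _ ≤ R ^ (2 * n) := by gcongr
    · rw [treeMoment_of_odd c ⟨n, rfl⟩, abs_zero]
      positivity

end TreeWeight

/-! ### Non-crossing pairings and binary trees -/

section TreePairing

/-- The non-crossing pairing of the interval `[s, s + 2n)` encoded by a binary tree with `n`
nodes, as an involution: `s` is paired so that it encloses the pairing of the left subtree, and
the pairing of the right subtree follows. Points outside of the interval are fixed. -/
def treePartner : BinaryTree Unit → ℕ → ℕ → ℕ
  | .nil, _, i => i
  | .node _ l r, s, i =>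
    if i = s then s + 2 * l.numNodes + 1
    else if i = s + 2 * l.numNodes + 1 then s
    else if i < s + 2 * l.numNodes + 1 then treePartner l (s + 1) i
    else treePartner r (s + 2 * l.numNodes + 2) i

/-- `p` is the involution of a non-crossing pairing of `[s, e)`. -/
structure IsNCInvolution (p : ℕ → ℕ) (s e : ℕ) : Prop where
  outside : ∀ i, i < s ∨ e ≤ i → p i = i
  ne : ∀ i, s ≤ i → i < e → p i ≠ i
  invol : ∀ i, p (p i) = i
  nested : ∀ a b, a < b → b < p a → a < p b ∧ p b < p a

theorem IsNCInvolution.mem {p : ℕ → ℕ} {s e : ℕ} (h : IsNCInvolution p s e) {i : ℕ} (h1 : s ≤ i)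
    (h2 : i < e) : s ≤ p i ∧ p i < e := by
  by_contra hcon
  have := h.outside (p i) (by omega)
  rw [h.invol] at this
  exact h.ne i h1 h2 this.symm

theorem isNCInvolution_treePartner (t : BinaryTree Unit) (s : ℕ) :
    IsNCInvolution (treePartner t s) s (s + 2 * t.numNodes) := by
  induction t generalizing s with
  | nil =>
    refine ⟨fun i _ => rfl, fun i h1 h2 => ?_, fun i => rfl, fun a b h1 h2 => ?_⟩
    · simp at h2; omega
    · simp only [treePartner] at h2; omega
  | node u l r ihl ihr =>
    have hl := ihl (s + 1)
    have hr := ihr (s + 2 * l.numNodes + 2)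
    have hlm := fun i => hl.mem (i := i)
    have hrm := fun i => hr.mem (i := i)
    have hlo := hl.outside
    have hro := hr.outside
    simp only [BinaryTree.numNodes] at *
    refine ⟨fun i hi => ?_, fun i h1 h2 => ?_, fun i => ?_, fun a b h1 h2 => ?_⟩
    · simp only [treePartner]
      rw [if_neg (by omega), if_neg (by omega)]
      split_ifs with h
      · exact hlo i (by omega)
      · exact hro i (by omega)
    · simp only [treePartner]
      split_ifs with h3 h4 h5
      · omega
      · omega
      · exact hl.ne i (by omega) (by omega)
      · exact hr.ne i (by omega) (by omega)
    · have a1 := hlm i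
      have a2 := hrm i
      have a3 := hl.invol i
      have a4 := hr.invol i
      have a5 := hlo i
      have a6 := hro i
      simp only [treePartner]
      by_cases h3 : i = s
      · simp [h3]
      by_cases h4 : i = s + 2 * l.numNodes + 1
      · simp [h4]
      by_cases h5 : i < s + 2 * l.numNodes + 1
      · simp only [h3, h4, h5, if_true, if_false]
        by_cases h6 : i < s
        · rw [a5 (by omega)]
          simp only [h3, h4, h5, if_true, if_false]
          rw [a5 (by omega)]
        · rw [if_neg (by omega), if_neg (by omega), if_pos (by omega), a3]
      · simp only [h3, h4, h5, if_false]
        by_cases h6 : s + 2 * l.numNodes + 2 + 2 * r.numNodes ≤ i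
        · rw [a6 (by omega)]
          simp only [h3, h4, h5, if_false]
          rw [a6 (by omega)]
        · rw [if_neg (by omega), if_neg (by omega), if_neg (by omega), a4]
    · have a1 := hlm a
      have a2 := hrm a
      have b1 := hlm b
      have b2 := hrm b
      have a3 := hl.nested a b h1
      have a4 := hr.nested a b h1
      have a5 := hlo a
      have a6 := hro a
      have b5 := hlo b
      have b6 := hro b
      simp only [treePartner] at h2 ⊢
      split_ifs at h2 ⊢ <;> omega

theorem treePartner_injective {t t' : BinaryTree Unit} {s : ℕ}
    (h : ∀ i, treePartner t s i = treePartner t' s i) : t = t' := by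
  induction t generalizing t' s with
  | nil =>
    cases t' with
    | nil => rfl
    | node u l r =>
      have := h s
      simp [treePartner] at this
      omega
  | node u l r ihl ihr =>
    cases t' with
    | nil =>
      have := h s
      simp [treePartner] at this
      omega
    | node u' l' r' =>
      have hlen : l.numNodes = l'.numNodes := by
        have := h s
        simp [treePartner] at this
        omega
      have h1 : l = l' := by
        refine ihl (s := s + 1) fun i => ?_
        have o := (isNCInvolution_treePartner l (s + 1)).outside i
        have o' := (isNCInvolution_treePartner l' (s + 1)).outside i
        have hi := h i
        simp only [treePartner] at hi
        split_ifs at hi <;> omega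
      have h2 : r = r' := by
        refine ihr (s := s + 2 * l.numNodes + 2) fun i => ?_
        have o := (isNCInvolution_treePartner r (s + 2 * l.numNodes + 2)).outside i
        have o' := (isNCInvolution_treePartner r' (s + 2 * l.numNodes + 2)).outside i
        have hi := h i
        simp only [treePartner, ← hlen] at hi
        split_ifs at hi <;> omega
      rw [h1, h2]

theorem IsNCInvolution.exists_tree {p : ℕ → ℕ} {s n : ℕ} (h : IsNCInvolution p s (s + n)) :
    ∃ t : BinaryTree Unit, 2 * t.numNodes = n ∧ ∀ i, p i = treePartner t s i := by
  induction n using Nat.strong_induction_on generalizing p s with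
  | _ n ih =>
  rcases Nat.eq_zero_or_pos n with rfl | hn
  · exact ⟨.nil, rfl, fun i => h.outside i (by omega)⟩
  have hs := h.mem (le_refl s) (by omega)
  have hsne := h.ne s le_rfl (by omega)
  have hv := h.invol s
  set v := p s with hvdef
  have hin : ∀ i, s < i → i < v → s < p i ∧ p i < v := fun i h1 h2 => h.nested s i h1 h2
  have hout : ∀ i, v < i → i < s + n → v < p i ∧ p i < s + n := by
    intro i h1 h2
    have h3 := h.mem (i := i) (by omega) h2
    refine ⟨?_, h3.2⟩
    by_contra hcon
    have h5 := h.invol i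
    rcases Nat.lt_or_ge s (p i) with h4 | h4
    · rcases Nat.lt_or_ge (p i) v with h6 | h6
      · have := hin (p i) h4 h6
        omega
      · have h7 : p i = v := by omega
        rw [h7] at h5
        omega
    · have h7 : p i = s := by omega
      rw [h7] at h5
      omega
  have hL : IsNCInvolution (fun i => if s < i ∧ i < v then p i else i) (s + 1)
      (s + 1 + (v - s - 1)) := by
    refine ⟨fun i hi => if_neg (by omega), fun i h1 h2 => ?_, fun i => ?_, fun a b h1 h2 => ?_⟩
    · rw [if_pos (by omega)]
      exact h.ne i (by omega) (by omega)
    · by_cases hi : s < i ∧ i < v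
      · simp only [hi, and_self, if_true, hin i hi.1 hi.2, h.invol]
      · simp only [hi, if_false]
    · by_cases ha : s < a ∧ a < v
      · have := hin a ha.1 ha.2
        simp only [ha, and_self, if_true] at h2 ⊢
        rw [if_pos (by omega)]
        exact h.nested a b h1 h2
      · simp only [ha, if_false] at h2
        omega
  have hR : IsNCInvolution (fun i => if v < i ∧ i < s + n then p i else i) (v + 1)
      (v + 1 + (s + n - v - 1)) := by
    refine ⟨fun i hi => if_neg (by omega), fun i h1 h2 => ?_, fun i => ?_, fun a b h1 h2 => ?_⟩
    · rw [if_pos (by omega)]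
      exact h.ne i (by omega) (by omega)
    · by_cases hi : v < i ∧ i < s + n
      · simp only [hi, and_self, if_true, hout i hi.1 hi.2, h.invol]
      · simp only [hi, if_false]
    · by_cases ha : v < a ∧ a < s + n
      · have := hout a ha.1 ha.2
        simp only [ha, and_self, if_true] at h2 ⊢
        rw [if_pos (by omega)]
        exact h.nested a b h1 h2
      · simp only [ha, if_false] at h2
        omega
  obtain ⟨l, hl, hl'⟩ := ih _ (by omega) hL
  obtain ⟨r, hr, hr'⟩ := ih _ (by omega) hR
  have e1 : s + 2 * l.numNodes + 1 = v := by omega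
  refine ⟨.node () l r, ?_, fun i => ?_⟩
  · simp only [BinaryTree.numNodes]
    omega
  · have e2 : s + 2 * l.numNodes + 2 = v + 1 := by omega
    simp only [treePartner, e1, e2, ← hl', ← hr']
    by_cases h1 : i = s
    · simp [h1, hvdef]
    by_cases h2 : i = v
    · simp [h2, hv]
      omega
    by_cases h3 : i < v
    · simp only [h1, h2, h3, if_true, if_false, and_true]
      by_cases h4 : s < i
      · simp [h4]
      · simp only [h4, if_false]
        exact h.outside i (by omega)
    · simp only [h1, h2, h3, if_false]
      by_cases h4 : i < s + n
      · rw [if_pos (by omega)]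
      · rw [if_neg (by omega)]
        exact h.outside i (by omega)

end TreePairing

section TreeSetoid

/-- The pair partition of `{0, …, 2m - 1}` encoded by a binary tree with `m` nodes. -/
def treeSetoid (m : ℕ) (t : BinaryTree Unit) : Setoid (Fin (2 * m)) where
  r i j := i = j ∨ (j : ℕ) = treePartner t 0 i
  iseqv := by
    have h := (isNCInvolution_treePartner t 0).invol
    refine ⟨fun i => Or.inl rfl, ?_, ?_⟩
    · rintro i j (rfl | hj)
      · exact Or.inl rfl
      · exact Or.inr (by rw [hj, h])
    · rintro i j k (rfl | hj) (rfl | hk)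
      · exact Or.inl rfl
      · exact Or.inr hk
      · exact Or.inr hj
      · left
        rw [hj, h] at hk
        exact Fin.ext hk.symm

theorem treeSetoid_apply {m : ℕ} {t : BinaryTree Unit} {i j : Fin (2 * m)} :
    treeSetoid m t i j ↔ i = j ∨ (j : ℕ) = treePartner t 0 i := Iff.rfl

theorem isNonCrossing_treeSetoid (m : ℕ) (t : BinaryTree Unit) :
    IsNonCrossing (treeSetoid m t) := by
  intro a b c d hab hbc hcd hac hbd
  rw [treeSetoid_apply] at hac hbd
  rcases hac with rfl | hac
  · exact absurd hab hbc.asymm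
  rcases hbd with rfl | hbd
  · exact absurd hbc hcd.asymm
  have := (isNCInvolution_treePartner t 0).nested a b hab (hac ▸ hbc)
  rw [← hac, ← hbd] at this
  have := Fin.lt_def.1 hcd
  omega

theorem isPairing_treeSetoid {m : ℕ} {t : BinaryTree Unit} (ht : t.numNodes = m) :
    IsPairing (treeSetoid m t) := by
  have h := isNCInvolution_treePartner t 0
  rw [ht, zero_add] at h
  rintro B ⟨i, rfl⟩
  have hi := h.mem (i := i) (Nat.zero_le _) i.isLt
  rw [Set.ncard_eq_two]
  refine ⟨i, ⟨treePartner t 0 i, hi.2⟩, ?_, ?_⟩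
  · intro hcon
    exact h.ne i (Nat.zero_le _) i.isLt (congrArg Fin.val hcon).symm
  · ext j
    simp only [Set.mem_ofPred_eq, treeSetoid_apply, Set.mem_insert_iff, Set.mem_singleton_iff,
      Fin.ext_iff]
    refine or_congr_right ⟨fun hj => ?_, fun hj => ?_⟩
    · rw [hj, h.invol]
    · rw [hj, h.invol]

/-- The element of `NC₂(2m)` encoded by a binary tree with `m` nodes. -/
def treeNCPair {m : ℕ} (t : BinaryTree Unit) (ht : t.numNodes = m) : NCPair m :=
  ⟨treeSetoid m t, isPairing_treeSetoid ht, isNonCrossing_treeSetoid m t⟩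

theorem treeNCPair_injective {m : ℕ} {t t' : BinaryTree Unit} (ht : t.numNodes = m)
    (ht' : t'.numNodes = m) (h : treeNCPair t ht = treeNCPair t' ht') : t = t' := by
  refine treePartner_injective (s := 0) fun i => ?_
  have h1 := isNCInvolution_treePartner t 0
  have h2 := isNCInvolution_treePartner t' 0
  rw [ht, zero_add] at h1
  rw [ht', zero_add] at h2
  by_cases hi : i < 2 * m
  · have h0 : treeSetoid m t = treeSetoid m t' := congrArg Subtype.val h
    have h3 : treeSetoid m t ⟨i, hi⟩ ⟨_, (h1.mem (Nat.zero_le i) hi).2⟩ := Or.inr rfl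
    rw [h0, treeSetoid_apply] at h3
    rcases h3 with h3 | h3
    · exact absurd (congrArg Fin.val h3).symm (h1.ne i (Nat.zero_le i) hi)
    · exact h3
  · rw [h1.outside i (by omega), h2.outside i (by omega)]

theorem exists_treeNCPair {m : ℕ} (σ : NCPair m) :
    ∃ (t : BinaryTree Unit) (ht : t.numNodes = m), treeNCPair t ht = σ := by
  obtain ⟨σ, hσ, hnc⟩ := σ
  obtain ⟨p, hp⟩ := hσ.exists_partner
  have hne : ∀ i, p i ≠ i := fun i => ((hp i i).1 (σ.refl i)).2
  have hr : ∀ i, σ i (p i) := fun i => (hp i _).2 ⟨Or.inr rfl, hne i⟩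
  have hpp : ∀ i, p (p i) = i := fun i =>
    (((hp (p i) i).1 (σ.symm (hr i))).1.resolve_left (hne i).symm).symm
  have hq : ∀ i : Fin (2 * m), (if h : (i : ℕ) < 2 * m then ((p ⟨i, h⟩ : Fin (2 * m)) : ℕ)
      else i) = p i := fun i => by simp
  have hinv : IsNCInvolution (fun i => if h : i < 2 * m then (p ⟨i, h⟩ : ℕ) else i) 0
      (0 + 2 * m) := by
    refine ⟨fun i hi => dif_neg (by omega), fun i h1 h2 => ?_, fun i => ?_, fun a b h1 h2 => ?_⟩
    · have h3 : i < 2 * m := by omega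
      simp only [h3, dif_pos]
      intro hcon
      exact hne ⟨i, h3⟩ (Fin.ext hcon)
    · by_cases hi : i < 2 * m
      · simp [hi, hpp]
      · simp [hi]
    · by_cases ha : a < 2 * m
      · simp only [ha, dif_pos] at h2 ⊢
        have hb : b < 2 * m := h2.trans (p ⟨a, ha⟩).isLt
        simp only [hb, dif_pos]
        have h1' : (⟨a, ha⟩ : Fin (2 * m)) < ⟨b, hb⟩ := h1
        have h2' : (⟨b, hb⟩ : Fin (2 * m)) < p ⟨a, ha⟩ := h2
        rw [← Fin.lt_def]
        change (⟨a, ha⟩ : Fin (2 * m)) < p ⟨b, hb⟩ ∧ _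
        generalize (⟨a, ha⟩ : Fin (2 * m)) = u at *
        generalize (⟨b, hb⟩ : Fin (2 * m)) = v at *
        have hnab : ¬ σ u v := fun hcon => by
          rcases ((hp u v).1 hcon).1 with h | h
          · exact absurd h h1'.ne'
          · exact absurd h h2'.ne
        constructor
        · by_contra hcon
          rcases (not_lt.1 hcon).lt_or_eq with h | h
          · exact hnab (σ.symm (σ.trans (hr v)
              (hnc (p v) u v (p u) h h1' h2' (σ.symm (hr v)) (hr u))))
          · exact hnab (σ.symm (h ▸ hr v))
        · by_contra hcon
          rcases (not_lt.1 hcon).lt_or_eq with h | h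
          · exact hnab (hnc u v (p u) (p v) h1' h2' h (hr u) (hr v))
          · exact hnab (σ.trans (hr u) (h ▸ σ.symm (hr v)))
      · simp only [ha, dif_neg, not_false_eq_true] at h2
        omega
  obtain ⟨t, ht, h⟩ := hinv.exists_tree
  refine ⟨t, by omega, Subtype.ext (Setoid.ext fun i j => ?_)⟩
  change treeSetoid m t i j ↔ σ i j
  rw [treeSetoid_apply, ← h, hq, hp]
  constructor
  · rintro (rfl | hj)
    · exact ⟨Or.inl rfl, hne _⟩
    · exact ⟨Or.inr (Fin.ext hj), hne i⟩
  · rintro ⟨rfl | rfl, -⟩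
    · exact Or.inl rfl
    · exact Or.inr rfl

theorem sum_NCPair_eq_sum_trees {A : Type*} [AddCommMonoid A] {m : ℕ} (F : NCPair m → A)
    (G : BinaryTree Unit → A)
    (h : ∀ (t : BinaryTree Unit) (ht : t.numNodes = m), F (treeNCPair t ht) = G t) :
    ∑ σ, F σ = ∑ t ∈ BinaryTree.treesOfNumNodesEq m, G t := by
  symm
  refine Finset.sum_bij (fun t ht => treeNCPair t (BinaryTree.mem_treesOfNumNodesEq.1 ht))
    (fun _ _ => Finset.mem_univ _) (fun t ht t' ht' h => treeNCPair_injective _ _ h) ?_ ?_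
  · intro σ _
    obtain ⟨t, ht, h⟩ := exists_treeNCPair σ
    exact ⟨t, BinaryTree.mem_treesOfNumNodesEq.2 ht, h⟩
  · intro t ht
    exact (h t _).symm

theorem card_NCPair (m : ℕ) : Fintype.card (NCPair m) = catalan m := by
  rw [← BinaryTree.treesOfNumNodesEq_card_eq_catalan, Finset.card_eq_sum_ones,
    Fintype.card_eq_sum_ones]
  exact sum_NCPair_eq_sum_trees _ _ fun _ _ => rfl

/-- If `σ` does not pair a point of `(i, j]` with a point outside of it, then `i` and `j` belong
to the same block of the Kreweras complement. -/
theorem kreweras_treeSetoid_of_closed {m : ℕ} (t : BinaryTree Unit) {i j : Fin (2 * m)}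
    (hij : i ≤ j)
    (h : ∀ k : ℕ, (i : ℕ) < k → k ≤ j → (i : ℕ) < treePartner t 0 k ∧ treePartner t 0 k ≤ j) :
    kreweras (treeSetoid m t) i j := by
  rw [kreweras_eq (isNonCrossing_treeSetoid m t)]
  intro u v huv
  rw [treeSetoid_apply] at huv
  rcases huv with rfl | huv
  · simp
  · have h1 := h u
    have h2 := h v
    have h3 := (isNCInvolution_treePartner t 0).invol u
    rw [← huv] at h1 h3
    rw [h3] at h2
    simp only [Fin.lt_def, Fin.le_def] at *
    omega

theorem blockMax_eq_of_rel {n : ℕ} {r : Setoid (Fin n)} {i j : Fin n} (h : r i j) :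
    blockMax r i = blockMax r j := by
  unfold blockMax
  congr 1
  ext k
  simp only [Finset.mem_filter, Finset.mem_univ, true_and]
  exact ⟨fun hk => r.trans (r.symm h) hk, fun hk => r.trans h hk⟩

theorem blockMax_eq_self {n : ℕ} {r : Setoid (Fin n)} {i : Fin n} (h : ∀ j, r i j → j ≤ i) :
    blockMax r i = i :=
  le_antisymm (Finset.max'_le _ _ _ fun j hj => h j (by simpa using hj))
    (Finset.le_max' _ _ (by simp))

/-- The point before the larger element of a pair is the maximum of its block. -/
theorem blockMax_kreweras_pred {m : ℕ} (t : BinaryTree Unit) {i j : Fin (2 * m)}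
    (hij : i ≤ j) (h : treePartner t 0 i = j + 1) (hj : (j : ℕ) + 1 < 2 * m) :
    blockMax (kreweras (treeSetoid m t)) j = j := by
  refine blockMax_eq_self fun k hk => ?_
  rw [kreweras_eq (isNonCrossing_treeSetoid m t)] at hk
  have := hk i ⟨j + 1, hj⟩ (Or.inr h.symm)
  simp only [Fin.lt_def, Fin.le_def] at *
  omega

theorem blockMax_kreweras_last {m : ℕ} (t : BinaryTree Unit) {j : Fin (2 * m)}
    (hj : (j : ℕ) + 1 = 2 * m) :
    blockMax (kreweras (treeSetoid m t)) j = j :=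
  blockMax_eq_self fun k _ => by rw [Fin.le_def]; omega

end TreeSetoid

/-! ### Averages over labellings -/

section PathWeight

/-- The product of `F` over the pairs of the pairing of `[s, s + 2n)` encoded by a tree, where a
block of the Kreweras complement is labelled by its largest element: a pair `(u, v)` of a
subinterval ending at `e` contributes `F x_{v-1} x_{e-1}`. -/
def pathWeight {α : Type*} (F : α → α → ℝ) : BinaryTree Unit → ℕ → (ℕ → α) → ℝ
  | .nil, _, _ => 1
  | .node _ l r, s, x =>
    F (x (s + 2 * l.numNodes)) (x (s + 2 * l.numNodes + 1 + 2 * r.numNodes)) *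
      pathWeight F l (s + 1) x * pathWeight F r (s + 2 * l.numNodes + 2) x

theorem pathWeight_comp {α β : Type*} (F : α → α → ℝ) (φ : β → α) (t : BinaryTree Unit) (s : ℕ)
    (x : ℕ → β) :
    pathWeight F t s (fun i => φ (x i)) = pathWeight (fun a b => F (φ a) (φ b)) t s x := by
  induction t generalizing s with
  | nil => rfl
  | node u l r ihl ihr => simp only [pathWeight, ihl, ihr]

theorem pathWeight_update {α : Type*} (F : α → α → ℝ) (t : BinaryTree Unit) (s : ℕ) (x : ℕ → α)
    (k : ℕ) (a : α) (hk : k < s ∨ s + 2 * t.numNodes ≤ k) :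
    pathWeight F t s (Function.update x k a) = pathWeight F t s x := by
  induction t generalizing s with
  | nil => rfl
  | node u l r ihl ihr =>
    simp only [BinaryTree.numNodes] at hk
    simp only [pathWeight]
    rw [ihl _ (by omega), ihr _ (by omega), Function.update_of_ne (by omega),
      Function.update_of_ne (by omega)]

theorem prod_treePartner_eq_pathWeight {α : Type*} (F : α → α → ℝ) (t : BinaryTree Unit) (s : ℕ)
    (x : ℕ → α) (g : ℕ → ℕ)
    (h₁ : ∀ i j, s ≤ i → i ≤ j → j < s + 2 * t.numNodes →
      (∀ k, i < k → k ≤ j → i < treePartner t s k ∧ treePartner t s k ≤ j) → g i = g j)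
    (h₂ : ∀ i j, s ≤ i → i ≤ j → treePartner t s i = j + 1 → j + 1 < s + 2 * t.numNodes → g j = j)
    (h₃ : ∀ j, j + 1 = s + 2 * t.numNodes → s ≤ j → g j = j) :
    ∏ i ∈ Finset.Ico s (s + 2 * t.numNodes), (if i < treePartner t s i then
      F (x (g i)) (x (g (treePartner t s i))) else 1) = pathWeight F t s x := by
  induction t generalizing s with
  | nil => simp [pathWeight]
  | node u l r ihl ihr =>
    have hlmem := fun i => (isNCInvolution_treePartner l (s + 1)).mem (i := i)
    have hrmem := fun i => (isNCInvolution_treePartner r (s + 2 * l.numNodes + 2)).mem (i := i)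
    have ps : treePartner (.node u l r) s s = s + 2 * l.numNodes + 1 := by simp [treePartner]
    have pv : treePartner (.node u l r) s (s + 2 * l.numNodes + 1) = s := by simp [treePartner]
    have pl : ∀ i, s < i → i < s + 2 * l.numNodes + 1 →
        treePartner (.node u l r) s i = treePartner l (s + 1) i := by
      intro i h1 h2
      simp only [treePartner]
      rw [if_neg (by omega), if_neg (by omega), if_pos h2]
    have pr : ∀ i, s + 2 * l.numNodes + 2 ≤ i →
        treePartner (.node u l r) s i = treePartner r (s + 2 * l.numNodes + 2) i := by
      intro i h1
      simp only [treePartner]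
      rw [if_neg (by omega), if_neg (by omega), if_neg (by omega)]
    simp only [BinaryTree.numNodes] at h₁ h₂ h₃ ⊢
    have el := ihl (s + 1) ?_ ?_ ?_
    have er := ihr (s + 2 * l.numNodes + 2) ?_ ?_ ?_
    · have g1 : g s = s + 2 * l.numNodes := by
        rw [h₁ s (s + 2 * l.numNodes) le_rfl (by omega) (by omega)]
        · exact h₂ s _ le_rfl (by omega) ps (by omega)
        · intro k h1 h2
          rw [pl k h1 (by omega)]
          have := hlmem k (by omega) (by omega)
          omega
      have g2 : g (s + 2 * l.numNodes + 1) = s + 2 * l.numNodes + 1 + 2 * r.numNodes := by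
        rw [h₁ _ (s + 2 * l.numNodes + 1 + 2 * r.numNodes) (by omega) (by omega) (by omega)]
        · exact h₃ _ (by omega) (by omega)
        · intro k h1 h2
          rw [pr k (by omega)]
          have := hrmem k (by omega) (by omega)
          omega
      rw [← Finset.prod_Ico_consecutive _ (Nat.le_succ s)
        (by omega : s + 1 ≤ s + 2 * (l.numNodes + r.numNodes + 1)),
        ← Finset.prod_Ico_consecutive _ (by omega : s + 1 ≤ s + 1 + 2 * l.numNodes)
        (by omega : s + 1 + 2 * l.numNodes ≤ s + 2 * (l.numNodes + r.numNodes + 1)),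
        ← Finset.prod_Ico_consecutive _ (by omega : s + 1 + 2 * l.numNodes ≤ s + 2 * l.numNodes + 2)
        (by omega : s + 2 * l.numNodes + 2 ≤ s + 2 * (l.numNodes + r.numNodes + 1))]
      have e1 : s + 1 + 2 * l.numNodes = s + 2 * l.numNodes + 1 := by ring
      have e2 : s + 2 * (l.numNodes + r.numNodes + 1) =
        s + 2 * l.numNodes + 2 + 2 * r.numNodes := by ring
      have i1 : Finset.Ico s (s + 1) = {s} := by simp
      have i2 : Finset.Ico (s + 1 + 2 * l.numNodes) (s + 2 * l.numNodes + 2) =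
        {s + 2 * l.numNodes + 1} := by ext; simp; omega
      rw [i1, i2, Finset.prod_singleton, Finset.prod_singleton, ps, pv, if_pos (by omega),
        if_neg (by omega), g1, g2, one_mul, pathWeight, mul_assoc, ← el, ← er, e2]
      congr 2
      · refine Finset.prod_congr rfl fun i hi => ?_
        rw [Finset.mem_Ico] at hi
        rw [pl i (by omega) (by omega)]
      · refine Finset.prod_congr rfl fun i hi => ?_
        rw [Finset.mem_Ico] at hi
        rw [pr i (by omega)]
    · intro i j h1 h2 h3 h4
      refine h₁ i j (by omega) h2 (by omega) fun k h5 h6 => ?_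
      rw [pr k (by omega)]
      exact h4 k h5 h6
    · intro i j h1 h2 h3 h4
      exact h₂ i j (by omega) h2 ((pr i h1).trans h3) (by omega)
    · intro j h1 h2
      exact h₃ j (by omega) (by omega)
    · intro i j h1 h2 h3 h4
      refine h₁ i j (by omega) h2 (by omega) fun k h5 h6 => ?_
      rw [pl k (by omega) (by omega)]
      exact h4 k h5 h6
    · intro i j h1 h2 h3 h4
      exact h₂ i j (by omega) h2 ((pl i (by omega) (by omega)).trans h3) (by omega)
    · intro j h1 h2
      refine h₂ s j le_rfl (by omega) ?_ (by omega)
      rw [ps]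
      omega

/-- The largest elements of the blocks of the Kreweras complement, in increasing order. -/
noncomputable def blockLabel {m : ℕ} (hm : 0 < m) (σ : NCPair m) : Fin (m + 1) ↪o Fin (2 * m) :=
  (blockMaxima (kreweras σ.1)).orderEmbOfFin (card_blockMaxima_kreweras hm σ)

theorem blockLabel_blockIndex {m : ℕ} (hm : 0 < m) (σ : NCPair m) (i : Fin (2 * m)) :
    blockLabel hm σ (blockIndex σ i) = blockMax (kreweras σ.1) i := by
  unfold blockLabel blockIndex
  rw [← Finset.coe_orderIsoOfFin_apply, OrderIso.apply_symm_apply]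

theorem Lfun_treeNCPair {m : ℕ} (hm : 0 < m) {t : BinaryTree Unit} (ht : t.numNodes = m)
    (f : ℝ → ℝ → ℝ) (x : ℕ → ℝ) :
    Lfun (treeNCPair t ht) f (fun k => x (blockLabel hm (treeNCPair t ht) k)) =
      pathWeight (fun a b => f a b ^ 2) t 0 x := by
  set σ := treeNCPair t ht with hσ
  have hinv := isNCInvolution_treePartner t 0
  rw [ht, zero_add] at hinv
  let g : ℕ → ℕ := fun i => if h : i < 2 * m then blockMax (kreweras σ.1) ⟨i, h⟩ else i
  have hg : ∀ i (h : i < 2 * m), g i = blockMax (kreweras σ.1) ⟨i, h⟩ := fun i h => dif_pos h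
  have h1 : ∀ i : Fin (2 * m), ((blockLabel hm σ (blockIndex σ i) : Fin (2 * m)) : ℕ) = g i :=
    fun i => by rw [blockLabel_blockIndex, hg i i.isLt]
  rw [← prod_treePartner_eq_pathWeight (fun a b => f a b ^ 2) t 0 x g]
  · unfold Lfun
    simp only [h1]
    rw [Finset.prod_ite, Finset.prod_const_one, mul_one]
    have hne : ∀ {i j : Fin (2 * m)}, i < j → (σ.1 i j ↔ (j : ℕ) = treePartner t 0 i) := by
      intro i j hij
      change treeSetoid m t i j ↔ _
      rw [treeSetoid_apply]
      exact or_iff_right hij.ne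
    refine Finset.prod_bij (fun p _ => (p.1 : ℕ)) ?_ ?_ ?_ ?_
    · rintro ⟨i, j⟩ hp
      simp only [Finset.mem_filter, Finset.mem_univ, true_and, Finset.mem_Ico] at hp ⊢
      refine ⟨⟨Nat.zero_le _, by omega⟩, ?_⟩
      rw [← (hne hp.1).1 hp.2]
      exact hp.1
    · rintro ⟨i, j⟩ hp ⟨i', j'⟩ hp' hii
      simp only [Finset.mem_filter, Finset.mem_univ, true_and] at hp hp'
      have e1 := (hne hp.1).1 hp.2
      have e2 := (hne hp'.1).1 hp'.2
      have e3 : i = i' := Fin.ext hii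
      subst e3
      rw [Prod.mk.injEq]
      exact ⟨rfl, Fin.ext (e1.trans e2.symm)⟩
    · intro i hi
      simp only [Finset.mem_filter, Finset.mem_Ico, ht, zero_add] at hi
      have hi2 := (hinv.mem hi.1.1 hi.1.2).2
      refine ⟨(⟨i, hi.1.2⟩, ⟨_, hi2⟩), ?_, rfl⟩
      simp only [Finset.mem_filter, Finset.mem_univ, true_and]
      exact ⟨hi.2, (hne hi.2).2 rfl⟩
    · rintro ⟨i, j⟩ hp
      simp only [Finset.mem_filter, Finset.mem_univ, true_and] at hp
      simp only
      rw [← (hne hp.1).1 hp.2]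
  · intro i j _ hij hj hcl
    rw [ht, zero_add] at hj
    rw [hg i (by omega), hg j hj]
    congr 1
    exact blockMax_eq_of_rel (kreweras_treeSetoid_of_closed t hij hcl)
  · intro i j _ hij hp hj
    rw [ht, zero_add] at hj
    rw [hg j (by omega)]
    have := blockMax_kreweras_pred t (i := ⟨i, by omega⟩) (j := ⟨j, by omega⟩) hij hp hj
    exact congrArg Fin.val this
  · intro j hj _
    rw [ht, zero_add] at hj
    rw [hg j (by omega)]
    exact congrArg Fin.val (blockMax_kreweras_last t (j := ⟨j, by omega⟩) hj)

/-- Averaging over one coordinate first does not change an average. -/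
theorem sum_update {ι α : Type*} [Fintype ι] [DecidableEq ι] [Fintype α] (k : ι) (H : (ι → α) → ℝ) :
    ∑ x : ι → α, ∑ a, H (Function.update x k a) = Fintype.card α * ∑ x, H x := by
  have hinv : Function.Involutive
      (fun p : (ι → α) × α => (Function.update p.1 k p.2, p.1 k)) := by
    rintro ⟨x, a⟩
    simp
  have := Equiv.sum_comp hinv.toPerm (fun p => H p.1)
  rw [Fintype.sum_prod_type, Fintype.sum_prod_type] at this
  simp only [Function.Involutive.coe_toPerm, Finset.sum_const, Finset.card_univ,
    nsmul_eq_mul] at this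
  rw [this, Finset.mul_sum]

/-- The sum over all labellings only depends on the number of free labels. -/
theorem sum_comp_injective {ι κ α : Type*} [Fintype ι] [DecidableEq ι] [Fintype κ]
    [DecidableEq κ] [Fintype α] (e : κ → ι)
    (he : Function.Injective e) (H : (κ → α) → ℝ) :
    ∑ x : ι → α, H (fun k => x (e k)) =
      (Fintype.card α : ℝ) ^ (Fintype.card ι - Fintype.card κ) * ∑ y, H y := by
  rw [← Equiv.sum_comp (Equiv.piEquivPiSubtypeProd (fun i => i ∈ Set.range e)
    (fun _ => α)).symm, Fintype.sum_prod_type]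
  have e1 : ∀ (y : {i // i ∈ Set.range e} → α) (z : {i // i ∉ Set.range e} → α) (k : κ),
      (Equiv.piEquivPiSubtypeProd (fun i => i ∈ Set.range e) (fun _ => α)).symm (y, z) (e k) =
      y (Equiv.ofInjective e he k) := by
    intro y z k
    rw [Equiv.piEquivPiSubtypeProd_symm_apply]
    exact dif_pos (Set.mem_range_self k)
  simp only [e1, Finset.sum_const, Finset.card_univ, nsmul_eq_mul, ← Finset.mul_sum]
  congr 1
  · have : Fintype.card {i // i ∉ Set.range e} = Fintype.card ι - Fintype.card κ := by
      rw [Fintype.card_subtype_compl, ← Fintype.card_congr (Equiv.ofInjective e he)]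
    rw [Fintype.card_fun, this]
    push_cast
    rfl
  · exact Equiv.sum_comp ((Equiv.ofInjective e he).arrowCongr (Equiv.refl α)).symm H

variable {N : ℕ}

/-- The extension of a labelling of `K` points to all natural numbers. -/
def extendLabel (hN : 0 < N) {K : ℕ} (x : Fin K → Fin N) (i : ℕ) : Fin N :=
  if h : i < K then x ⟨i, h⟩ else ⟨0, hN⟩

theorem extendLabel_update (hN : 0 < N) {K : ℕ} (x : Fin K → Fin N) (k : Fin K) (a : Fin N) :
    extendLabel hN (Function.update x k a) = Function.update (extendLabel hN x) k a := by
  ext i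
  by_cases hi : i < K
  · by_cases h : i = k
    · subst h
      simp [extendLabel]
    · have : (⟨i, hi⟩ : Fin K) ≠ k := fun hcon => h (congrArg Fin.val hcon)
      simp [extendLabel, hi, Function.update_of_ne h, Function.update_of_ne this]
  · have : i ≠ k := fun h => hi (h ▸ k.isLt)
    simp [extendLabel, hi, Function.update_of_ne this]

theorem sum_mul_pathWeight (hN : 0 < N) {K : ℕ} {c : Fin N → Fin N → ℝ}
    (hc : ∀ i j, c i j = c j i) (t : BinaryTree Unit) (s e : ℕ) (hs : s + 2 * t.numNodes = e + 1)
    (he : e + 1 ≤ K) (G : (ℕ → Fin N) → ℝ)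
    (hG : ∀ x k a, s ≤ k → k < e → G (Function.update x k a) = G x) :
    ∑ x : Fin K → Fin N, G (extendLabel hN x) *
      pathWeight (fun i j => c i j ^ 2) t s (extendLabel hN x) =
    ∑ x : Fin K → Fin N, G (extendLabel hN x) * treeWeight c t (extendLabel hN x e) := by
  have hN' : (0 : ℝ) < N := by exact_mod_cast hN
  induction t generalizing s e G with
  | nil => simp [pathWeight, treeWeight]
  | node u l r ihl ihr =>
    simp only [BinaryTree.numNodes] at hs
    have hv : s + 2 * l.numNodes + 1 + 2 * r.numNodes = e := by omega
    set v := s + 2 * l.numNodes with hvdef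
    simp only [pathWeight, treeWeight, ← hvdef, hv]
    have h1 := ihr (v + 2) e (by omega) he
      (fun x => G x * c (x v) (x e) ^ 2 * pathWeight (fun i j => c i j ^ 2) l (s + 1) x) ?_
    have h2 := ihl (s + 1) v (by omega) (by omega)
      (fun x => G x * c (x v) (x e) ^ 2 * treeWeight c r (x e)) ?_
    · have h3 := sum_update (⟨v, by omega⟩ : Fin K) (fun x : Fin K → Fin N =>
        G (extendLabel hN x) * c (extendLabel hN x v) (extendLabel hN x e) ^ 2 *
          treeWeight c r (extendLabel hN x e) * treeWeight c l (extendLabel hN x v))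
      rw [Fintype.card_fin] at h3
      calc _ = _ := Finset.sum_congr rfl fun x _ => by ring
        _ = _ := h1
        _ = _ := Finset.sum_congr rfl fun x _ => by ring
        _ = _ := h2
        _ = (N : ℝ)⁻¹ * _ := (eq_inv_mul_iff_mul_eq₀ hN'.ne').2 h3.symm
        _ = _ := by
          rw [Finset.mul_sum]
          refine Finset.sum_congr rfl fun x _ => ?_
          simp only [Finset.mul_sum]
          refine Finset.sum_congr rfl fun a _ => ?_
          rw [extendLabel_update, Function.update_self,
            Function.update_of_ne (show e ≠ v by omega),
            hG _ _ _ (show s ≤ v by omega) (show v < e by omega), hc a]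
          ring
    · intro x k a h1 h2
      rw [hG _ _ _ (by omega) (by omega), Function.update_of_ne (by omega),
        Function.update_of_ne (by omega)]
    · intro x k a h1 h2
      rw [hG _ _ _ (by omega) (by omega), Function.update_of_ne (by omega),
        Function.update_of_ne (by omega), pathWeight_update _ _ _ _ _ _ (by omega)]

/-- The limiting normalized trace at size `N` is a sum of averages of `L_{σ,f}` over the grid. -/
theorem avg_treeMoment_eq_sum_avg_Lfun (hN : 0 < N) {m : ℕ} (hm : 0 < m) (f : ℝ → ℝ → ℝ)
    (hf : ∀ i j, f (gridPoint N i) (gridPoint N j) = f (gridPoint N j) (gridPoint N i)) :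
    (N : ℝ)⁻¹ * ∑ i, treeMoment (fun i j => f (gridPoint N i) (gridPoint N j)) (2 * m) i =
      ∑ σ : NCPair m, ((N : ℝ) ^ (m + 1))⁻¹ *
        ∑ y : Fin (m + 1) → Fin N, Lfun σ f (fun k => gridPoint N (y k)) := by
  have hN' : (0 : ℝ) < N := by exact_mod_cast hN
  simp only [treeMoment_two_mul]
  rw [Finset.sum_comm, Finset.mul_sum]
  refine (sum_NCPair_eq_sum_trees _ _ fun t ht => ?_).symm
  have h1 := sum_comp_injective (α := Fin N) (blockLabel hm (treeNCPair t ht))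
    (blockLabel hm (treeNCPair t ht)).injective
    (fun y => Lfun (treeNCPair t ht) f fun k => gridPoint N (y k))
  have h2 : ∀ x : Fin (2 * m) → Fin N, Lfun (treeNCPair t ht) f
      (fun k => gridPoint N (x (blockLabel hm (treeNCPair t ht) k))) =
      pathWeight (fun i j => f (gridPoint N i) (gridPoint N j) ^ 2) t 0 (extendLabel hN x) := by
    intro x
    rw [← pathWeight_comp (fun a b => f a b ^ 2) (gridPoint N), ← Lfun_treeNCPair hm ht]
    congr 1
    ext k
    simp [extendLabel]
  simp only [h2] at h1
  have h3 := sum_mul_pathWeight hN (K := 2 * m) hf t 0 (2 * m - 1) (by omega) (by omega)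
    (fun _ => 1) (fun _ _ _ _ _ => rfl)
  simp only [one_mul] at h3
  have h4 := sum_comp_injective (α := Fin N) (fun _ : Fin 1 => (⟨2 * m - 1, by omega⟩ : Fin (2 * m)))
    (fun _ _ _ => Subsingleton.elim _ _)
    (fun y => treeWeight (fun i j => f (gridPoint N i) (gridPoint N j)) t (y 0))
  have h5 : ∀ x : Fin (2 * m) → Fin N, extendLabel hN x (2 * m - 1) = x ⟨2 * m - 1, by omega⟩ :=
    fun x => dif_pos _
  simp only [h5] at h3
  rw [h3, h4] at h1
  simp only [Fintype.card_fin] at h1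
  have h6 : ∑ y : Fin 1 → Fin N, treeWeight (fun i j => f (gridPoint N i) (gridPoint N j)) t (y 0)
      = ∑ i, treeWeight (fun i j => f (gridPoint N i) (gridPoint N j)) t i :=
    Equiv.sum_comp (Equiv.funUnique (Fin 1) (Fin N)) _
  rw [h6] at h1
  have e1 : (N : ℝ) ^ (2 * m - 1) = N ^ (2 * m - (m + 1)) * N ^ m := by
    rw [← pow_add]; congr 1; omega
  rw [e1, mul_assoc] at h1
  have h7 := mul_left_cancel₀ (by positivity) h1
  rw [← h7, pow_succ]
  field_simp

end PathWeight

/-! ### Riemann sums over the grid -/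

section RiemannSums

open Topology

/-- The uniform distribution on the unit interval. -/
noncomputable def unitMeasure : Measure ℝ := volume.restrict (Ioo (0 : ℝ) 1)

instance : IsProbabilityMeasure unitMeasure := ⟨by simp [unitMeasure]⟩

theorem volume_restrict_unitCube (k : ℕ) :
    (volume : Measure (Fin k → ℝ)).restrict (unitCube k) =
      Measure.pi fun _ : Fin k => unitMeasure := by
  rw [volume_pi, unitCube, Measure.restrict_pi_pi]
  rfl

theorem map_pair_pi_unitMeasure {k : ℕ} {i j : Fin k} (hij : i ≠ j) :
    (Measure.pi fun _ : Fin k => unitMeasure).map (fun x => (x i, x j)) =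
      volume.restrict (Ioo (0 : ℝ) 1 ×ˢ Ioo (0 : ℝ) 1) := by
  have hind : iIndepFun (fun (i : Fin k) (x : Fin k → ℝ) => x i)
      (Measure.pi fun _ : Fin k => unitMeasure) :=
    iIndepFun_pi (X := fun _ (t : ℝ) => t) fun i => aemeasurable_id
  rw [(indepFun_iff_map_prod_eq_prod_map_map (measurable_pi_apply i).aemeasurable
    (measurable_pi_apply j).aemeasurable).1 (hind.indepFun hij),
    (measurePreserving_eval (fun _ : Fin k => unitMeasure) i).map_eq,
    (measurePreserving_eval (fun _ : Fin k => unitMeasure) j).map_eq, unitMeasure,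
    Measure.prod_restrict, Measure.volume_eq_prod]

theorem ae_pi_unitMeasure_of_ae {k : ℕ} {i j : Fin k} (hij : i ≠ j) {p : ℝ × ℝ → Prop}
    (h : ∀ᵐ z ∂(volume.restrict (Ioo (0 : ℝ) 1 ×ˢ Ioo (0 : ℝ) 1)), p z) :
    ∀ᵐ x ∂(Measure.pi fun _ : Fin k => unitMeasure), p (x i, x j) := by
  rw [← map_pair_pi_unitMeasure hij] at h
  exact ae_of_ae_map (by fun_prop) h

/-- The two elements of a pair belong to different blocks of the Kreweras complement. -/
theorem blockIndex_ne {m : ℕ} (σ : NCPair m) {u v : Fin (2 * m)} (h : u < v) (huv : σ.1 u v) :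
    blockIndex σ u ≠ blockIndex σ v := by
  intro hcon
  have h1 := congrArg (blockLabel (by have := u.isLt; omega) σ) hcon
  rw [blockLabel_blockIndex, blockLabel_blockIndex] at h1
  have hmem : ∀ i, kreweras σ.1 i (blockMax (kreweras σ.1) i) := fun i => by
    have : blockMax (kreweras σ.1) i ∈ Finset.univ.filter fun j => kreweras σ.1 i j :=
      Finset.max'_mem _ _
    simpa using this
  have h2 : kreweras σ.1 u v := (kreweras σ.1).trans (hmem u) (h1 ▸ (kreweras σ.1).symm (hmem v))
  rw [kreweras_eq σ.2.2] at h2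
  have := h2 u v huv
  simp [h, h.asymm] at this

theorem ae_continuousAt_pairs {f : ℝ → ℝ → ℝ} (hf : ClassR f) {m : ℕ} (σ : NCPair m) :
    ∀ᵐ x ∂(Measure.pi fun _ : Fin (m + 1) => unitMeasure), ∀ p : Fin (2 * m) × Fin (2 * m),
      p.1 < p.2 → σ.1 p.1 p.2 →
        ContinuousAt (Function.uncurry f) (x (blockIndex σ p.1), x (blockIndex σ p.2)) := by
  have h0 : ∀ᵐ z ∂(volume.restrict (Ioo (0 : ℝ) 1 ×ˢ Ioo (0 : ℝ) 1)),
      ContinuousAt (Function.uncurry f) z := by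
    rw [ae_restrict_iff' (measurableSet_Ioo.prod measurableSet_Ioo), ae_iff]
    simpa [and_assoc] using hf.discont_null
  rw [ae_all_iff]
  intro p
  by_cases hp : p.1 < p.2 ∧ σ.1 p.1 p.2
  · filter_upwards [ae_pi_unitMeasure_of_ae (blockIndex_ne σ hp.1 hp.2) h0] with x hx _ _
    exact hx
  · exact Eventually.of_forall fun x h1 h2 => absurd ⟨h1, h2⟩ hp

theorem ae_mem_unitCube (k : ℕ) :
    ∀ᵐ x ∂(Measure.pi fun _ : Fin k => unitMeasure), ∀ i, x i ∈ Ioo (0 : ℝ) 1 := by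
  rw [ae_all_iff]
  intro i
  have h : ∀ᵐ t ∂unitMeasure, t ∈ Ioo (0 : ℝ) 1 := ae_restrict_mem measurableSet_Ioo
  exact (measurePreserving_eval (fun _ : Fin k => unitMeasure) i).quasiMeasurePreserving.ae h

/-- The index of the cell `(i / N, (i + 1) / N]` that contains a point. -/
noncomputable def cellIndex {N : ℕ} (hN : 0 < N) (t : ℝ) : Fin N :=
  if h : ⌈(N : ℝ) * t⌉₊ - 1 < N then ⟨⌈(N : ℝ) * t⌉₊ - 1, h⟩ else ⟨0, hN⟩

theorem measurable_cellIndex {N : ℕ} (hN : 0 < N) : Measurable (cellIndex hN) := by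
  have h : Measurable fun n : ℕ => (if h : n - 1 < N then ⟨n - 1, h⟩ else ⟨0, hN⟩ : Fin N) :=
    measurable_from_nat
  exact h.comp (Nat.measurable_ceil.comp (measurable_const_mul (N : ℝ)))

theorem cellIndex_val {N : ℕ} (hN : 0 < N) {t : ℝ} (ht : t ∈ Ioc (0 : ℝ) 1) :
    ((cellIndex hN t : Fin N) : ℕ) + 1 = ⌈(N : ℝ) * t⌉₊ := by
  have hN' : (0 : ℝ) < N := by exact_mod_cast hN
  have h1 : ⌈(N : ℝ) * t⌉₊ ≤ N := by
    rw [Nat.ceil_le]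
    nlinarith [ht.2]
  have h2 : 0 < ⌈(N : ℝ) * t⌉₊ := Nat.ceil_pos.2 (mul_pos hN' ht.1)
  rw [cellIndex, dif_pos (by omega)]
  simp only
  omega

theorem unitMeasure_cellIndex {N : ℕ} (hN : 0 < N) (i : Fin N) :
    unitMeasure.real (cellIndex hN ⁻¹' {i}) = (N : ℝ)⁻¹ := by
  have hN' : (0 : ℝ) < N := by exact_mod_cast hN
  have hi : ((i : ℕ) : ℝ) + 1 ≤ N := by exact_mod_cast i.isLt
  have h1 : cellIndex hN ⁻¹' {i} ∩ Ioc (0 : ℝ) 1 = Ioc ((i : ℝ) / N) (((i : ℝ) + 1) / N) := by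
    ext t
    simp only [Set.mem_inter_iff, Set.mem_preimage, Set.mem_singleton_iff]
    have key : t ∈ Ioc (0 : ℝ) 1 → (cellIndex hN t = i ↔
        t ∈ Ioc ((i : ℝ) / N) (((i : ℝ) + 1) / N)) := by
      intro ht
      have : cellIndex hN t = i ↔ ⌈(N : ℝ) * t⌉₊ = (i : ℕ) + 1 := by
        rw [← cellIndex_val hN ht, Fin.ext_iff]
        omega
      rw [this, Nat.ceil_eq_iff (Nat.succ_ne_zero _), Set.mem_Ioc, div_lt_iff₀ hN',
        le_div_iff₀ hN', mul_comm t]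
      simp
    constructor
    · rintro ⟨h, ht⟩
      exact (key ht).1 h
    · intro h
      have ht : t ∈ Ioc (0 : ℝ) 1 :=
        ⟨lt_of_le_of_lt (by positivity) h.1, h.2.trans ((div_le_one hN').2 hi)⟩
      exact ⟨(key ht).2 h, ht⟩
  rw [unitMeasure, Measure.restrict_congr_set Ioo_ae_eq_Ioc, measureReal_restrict_apply
    (measurable_cellIndex hN (measurableSet_singleton i)), h1, Real.volume_real_Ioc_of_le]
  · field_simp
    ring
  · gcongr
    linarith

theorem integral_cellIndex {N : ℕ} (hN : 0 < N) {k : ℕ} (H : (Fin k → Fin N) → ℝ) :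
    ∫ x, H (fun i => cellIndex hN (x i)) ∂(Measure.pi fun _ : Fin k => unitMeasure) =
      ((N : ℝ) ^ k)⁻¹ * ∑ y, H y := by
  have hmeas : Measurable fun (x : Fin k → ℝ) (i : Fin k) => cellIndex hN (x i) :=
    measurable_pi_lambda _ fun i => (measurable_cellIndex hN).comp (measurable_pi_apply i)
  have hp := Measure.isProbabilityMeasure_map (μ := Measure.pi fun _ : Fin k => unitMeasure)
    hmeas.aemeasurable
  rw [← integral_map (f := H) hmeas.aemeasurable
    (Measurable.of_discrete (f := H)).aestronglyMeasurable,
    integral_fintype (Integrable.of_finite), Finset.mul_sum]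
  refine Finset.sum_congr rfl fun y _ => ?_
  rw [smul_eq_mul, map_measureReal_apply hmeas (measurableSet_singleton y)]
  congr 1
  have : (fun (x : Fin k → ℝ) (i : Fin k) => cellIndex hN (x i)) ⁻¹' {y} =
      Set.univ.pi fun i => cellIndex hN ⁻¹' {y i} := by
    ext x
    simp [funext_iff]
  rw [this, measureReal_def, Measure.pi_pi, ENNReal.toReal_prod]
  simp only [← measureReal_def, unitMeasure_cellIndex]
  simp

theorem tendsto_gridPoint_cellIndex {t : ℝ} (ht : t ∈ Ioo (0 : ℝ) 1) :
    Tendsto (fun n : ℕ => gridPoint (n + 1) (cellIndex n.succ_pos t)) atTop (𝓝 t) := by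
  rw [tendsto_iff_dist_tendsto_zero]
  refine squeeze_zero (fun _ => dist_nonneg) (fun n => ?_) tendsto_one_div_add_atTop_nhds_zero_nat
  have h1 := cellIndex_val n.succ_pos (Ioo_subset_Ioc_self ht)
  have h2 : ((cellIndex n.succ_pos t : Fin (n + 1)) : ℝ) + 1 = (⌈((n + 1 : ℕ) : ℝ) * t⌉₊ : ℝ) := by
    exact_mod_cast h1
  have hc1 := Nat.le_ceil (((n + 1 : ℕ) : ℝ) * t)
  have hc2 := Nat.ceil_lt_add_one (a := ((n + 1 : ℕ) : ℝ) * t)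
    (mul_nonneg (Nat.cast_nonneg _) ht.1.le)
  rw [← h2] at hc1 hc2
  rw [gridPoint, Real.dist_eq]
  push_cast at *
  have hn : (0 : ℝ) ≤ n := Nat.cast_nonneg n
  have h3 : 1 / ((n : ℝ) + 1 + 1) ≤ 1 / ((n : ℝ) + 1) := by gcongr; linarith
  refine le_trans ?_ h3
  have e : ((cellIndex n.succ_pos t : Fin (n + 1)) + 1 : ℝ) / (n + 1 + 1) - t =
      ((cellIndex n.succ_pos t : Fin (n + 1)) + 1 - (n + 1 + 1) * t) / ((n : ℝ) + 1 + 1) := by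
    field_simp
  rw [e, abs_div, abs_of_pos (by positivity : (0 : ℝ) < n + 1 + 1)]
  gcongr
  rw [abs_le]
  constructor <;> nlinarith [ht.1, ht.2]

theorem ae_tendsto_Lfun_cellIndex {f : ℝ → ℝ → ℝ} (hf : ClassR f) {m : ℕ} (σ : NCPair m) :
    ∀ᵐ x ∂(Measure.pi fun _ : Fin (m + 1) => unitMeasure),
      Tendsto (fun n : ℕ => Lfun σ f fun k => gridPoint (n + 1) (cellIndex n.succ_pos (x k)))
        atTop (𝓝 (Lfun σ f x)) := by
  filter_upwards [ae_continuousAt_pairs hf σ, ae_mem_unitCube (m + 1)] with x hx hx'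
  refine tendsto_finsetProd _ fun p hp => ?_
  simp only [Finset.mem_filter, Finset.mem_univ, true_and] at hp
  refine Tendsto.pow ?_ 2
  have h := hx p hp.1 hp.2
  exact h.tendsto.comp ((tendsto_gridPoint_cellIndex (hx' _)).prodMk_nhds
    (tendsto_gridPoint_cellIndex (hx' _)))

theorem measurable_comp_cellIndex {N : ℕ} (hN : 0 < N) {k : ℕ} (H : (Fin k → Fin N) → ℝ) :
    Measurable fun x : Fin k → ℝ => H fun i => cellIndex hN (x i) :=
  Measurable.comp (g := H) Measurable.of_discrete
    (measurable_pi_lambda _ fun i => (measurable_cellIndex hN).comp (measurable_pi_apply i))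

theorem measurable_Lfun_cellIndex (f : ℝ → ℝ → ℝ) {m : ℕ} (σ : NCPair m) (n : ℕ) :
    Measurable fun x : Fin (m + 1) → ℝ =>
      Lfun σ f fun k => gridPoint (n + 1) (cellIndex n.succ_pos (x k)) :=
  measurable_comp_cellIndex n.succ_pos fun y : Fin (m + 1) → Fin (n + 1) =>
      Lfun σ f fun k => gridPoint (n + 1) (y k)

theorem aestronglyMeasurable_Lfun {f : ℝ → ℝ → ℝ} (hf : ClassR f) {m : ℕ} (σ : NCPair m) :
    AEStronglyMeasurable (Lfun σ f) (Measure.pi fun _ : Fin (m + 1) => unitMeasure) :=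
  aestronglyMeasurable_of_tendsto_ae atTop
    (fun n => (measurable_Lfun_cellIndex f σ n).aestronglyMeasurable)
    (ae_tendsto_Lfun_cellIndex hf σ)

theorem pathWeight_const {α : Type*} (a : ℝ) (t : BinaryTree Unit) (s : ℕ) (x : ℕ → α) :
    pathWeight (fun _ _ => a) t s x = a ^ t.numNodes := by
  induction t generalizing s with
  | nil => simp [pathWeight]
  | node u l r ihl ihr =>
    simp only [pathWeight, ihl, ihr, BinaryTree.numNodes]
    ring

/-- There are `m` pairs. -/
theorem Lfun_const {m : ℕ} (hm : 0 < m) (σ : NCPair m) (M : ℝ) (x : Fin (m + 1) → ℝ) :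
    Lfun σ (fun _ _ => M) x = M ^ (2 * m) := by
  obtain ⟨t, ht, rfl⟩ := exists_treeNCPair σ
  have := Lfun_treeNCPair hm ht (fun _ _ => M) (fun _ => 0)
  rw [pathWeight_const, ht, ← pow_mul] at this
  exact this

theorem Lfun_nonneg {m : ℕ} (σ : NCPair m) (f : ℝ → ℝ → ℝ) (x : Fin (m + 1) → ℝ) :
    0 ≤ Lfun σ f x := Finset.prod_nonneg fun _ _ => sq_nonneg _

theorem Lfun_le {m : ℕ} (hm : 0 < m) (σ : NCPair m) {f : ℝ → ℝ → ℝ} {M : ℝ}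
    {x : Fin (m + 1) → ℝ}
    (h : ∀ p : Fin (2 * m) × Fin (2 * m), p.1 < p.2 → σ.1 p.1 p.2 →
      |f (x (blockIndex σ p.1)) (x (blockIndex σ p.2))| ≤ M) :
    Lfun σ f x ≤ M ^ (2 * m) := by
  rw [← Lfun_const hm σ M x]
  refine Finset.prod_le_prod (fun _ _ => sq_nonneg _) fun p hp => ?_
  simp only [Finset.mem_filter, Finset.mem_univ, true_and] at hp
  exact sq_le_sq.2 ((h p hp.1 hp.2).trans (le_abs_self M))

theorem tendsto_avg_Lfun {f : ℝ → ℝ → ℝ} (hf : ClassR f) {B : ℝ}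
    (hB : ∀ x ∈ Ioo (0 : ℝ) 1, ∀ y ∈ Ioo (0 : ℝ) 1, |f x y| ≤ B) {m : ℕ} (hm : 0 < m)
    (σ : NCPair m) :
    Tendsto (fun N : ℕ => ((N : ℝ) ^ (m + 1))⁻¹ *
      ∑ y : Fin (m + 1) → Fin N, Lfun σ f fun k => gridPoint N (y k)) atTop
      (𝓝 (∫ x in unitCube (m + 1), Lfun σ f x)) := by
  rw [← tendsto_add_atTop_iff_nat 1, volume_restrict_unitCube]
  have h := tendsto_integral_of_dominated_convergence
    (μ := Measure.pi fun _ : Fin (m + 1) => unitMeasure)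
    (F := fun (n : ℕ) x => Lfun σ f fun k => gridPoint (n + 1) (cellIndex n.succ_pos (x k)))
    (f := Lfun σ f) (fun _ => B ^ (2 * m))
    (fun n => (measurable_Lfun_cellIndex f σ n).aestronglyMeasurable)
    (integrable_const _) (fun n => Eventually.of_forall fun x => ?_)
    (ae_tendsto_Lfun_cellIndex hf σ)
  · refine h.congr fun n => ?_
    exact integral_cellIndex n.succ_pos
      (fun y => Lfun σ f fun k => gridPoint (n + 1) (y k))
  · rw [Real.norm_of_nonneg (Lfun_nonneg _ _ _)]
    exact Lfun_le hm σ fun p _ _ => hB _ (gridPoint_mem _ _) _ (gridPoint_mem _ _)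

theorem ae_Lfun_le {f : ℝ → ℝ → ℝ} {M : ℝ}
    (hM : ∀ᵐ z ∂(volume.restrict (Ioo (0 : ℝ) 1 ×ˢ Ioo (0 : ℝ) 1)),
      |Function.uncurry f z| ≤ M) {m : ℕ} (hm : 0 < m) (σ : NCPair m) :
    ∀ᵐ x ∂(Measure.pi fun _ : Fin (m + 1) => unitMeasure), Lfun σ f x ≤ M ^ (2 * m) := by
  have : ∀ᵐ x ∂(Measure.pi fun _ : Fin (m + 1) => unitMeasure),
      ∀ p : Fin (2 * m) × Fin (2 * m), p.1 < p.2 → σ.1 p.1 p.2 →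
        |f (x (blockIndex σ p.1)) (x (blockIndex σ p.2))| ≤ M := by
    rw [ae_all_iff]
    intro p
    by_cases hp : p.1 < p.2 ∧ σ.1 p.1 p.2
    · filter_upwards [ae_pi_unitMeasure_of_ae (blockIndex_ne σ hp.1 hp.2) hM] with x hx _ _
      exact hx
    · exact Eventually.of_forall fun x h1 h2 => absurd ⟨h1, h2⟩ hp
  filter_upwards [this] with x hx
  exact Lfun_le hm σ hx

theorem integrable_Lfun {f : ℝ → ℝ → ℝ} (hf : ClassR f) {M : ℝ}
    (hM : ∀ᵐ z ∂(volume.restrict (Ioo (0 : ℝ) 1 ×ˢ Ioo (0 : ℝ) 1)),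
      |Function.uncurry f z| ≤ M) {m : ℕ} (hm : 0 < m) (σ : NCPair m) :
    IntegrableOn (Lfun σ f) (unitCube (m + 1)) := by
  rw [IntegrableOn, volume_restrict_unitCube]
  refine (integrable_const (M ^ (2 * m))).mono' (aestronglyMeasurable_Lfun hf σ) ?_
  filter_upwards [ae_Lfun_le hM hm σ] with x hx
  rwa [Real.norm_of_nonneg (Lfun_nonneg _ _ _)]

theorem sum_integral_Lfun_le {f : ℝ → ℝ → ℝ} (hf : ClassR f) {M : ℝ}
    (hM : ∀ᵐ z ∂(volume.restrict (Ioo (0 : ℝ) 1 ×ˢ Ioo (0 : ℝ) 1)),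
      |Function.uncurry f z| ≤ M) {m : ℕ} (hm : 0 < m) :
    ∑ σ : NCPair m, ∫ x in unitCube (m + 1), Lfun σ f x ≤ (2 * M) ^ (2 * m) := by
  have h1 : ∀ σ ∈ (Finset.univ : Finset (NCPair m)),
      ∫ x in unitCube (m + 1), Lfun σ f x ≤ M ^ (2 * m) := by
    intro σ _
    have hi := integrable_Lfun hf hM hm σ
    rw [IntegrableOn] at hi
    rw [volume_restrict_unitCube] at hi ⊢
    refine (integral_mono_ae hi (integrable_const _) (ae_Lfun_le hM hm σ)).trans ?_
    simp
  refine (Finset.sum_le_sum h1).trans ?_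
  rw [Finset.sum_const, Finset.card_univ, card_NCPair, nsmul_eq_mul, mul_pow, pow_mul 2]
  have h4 : (catalan m : ℝ) ≤ (2 ^ 2) ^ m := by
    have := catalan_le_four_pow m
    norm_num
    exact_mod_cast this
  have : 0 ≤ M ^ (2 * m) := by rw [pow_mul]; positivity
  gcongr

end RiemannSums

/-! ### Weak limits and moments -/

section WeakLimits

open Topology BoundedContinuousFunction

/-- A continuous cutoff: it vanishes on `[-a, a]` and equals `1` outside of `[-a-1, a+1]`. -/
noncomputable def outerCutoff (a : ℝ) : BoundedContinuousFunction ℝ ℝ :=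
  BoundedContinuousFunction.ofNormedAddCommGroup (fun t => min 1 (max 0 (|t| - a)))
    (by fun_prop) 1 (fun t => by
      rw [Real.norm_of_nonneg (le_min zero_le_one (le_max_left _ _))]
      exact min_le_left _ _)

theorem outerCutoff_apply (a t : ℝ) : outerCutoff a t = min 1 (max 0 (|t| - a)) := rfl

theorem outerCutoff_nonneg (a t : ℝ) : 0 ≤ outerCutoff a t :=
  le_min zero_le_one (le_max_left _ _)

theorem outerCutoff_le_one (a t : ℝ) : outerCutoff a t ≤ 1 := min_le_left _ _

theorem outerCutoff_eq_zero {a t : ℝ} (h : |t| ≤ a) : outerCutoff a t = 0 := by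
  rw [outerCutoff_apply, max_eq_left (by linarith), min_eq_right zero_le_one]

theorem outerCutoff_eq_one {a t : ℝ} (h : a + 1 ≤ |t|) : outerCutoff a t = 1 := by
  rw [outerCutoff_apply, min_eq_left]
  exact le_max_of_le_right (by linarith)

/-- **Prokhorov's theorem** for sequences of probability measures on the line. -/
theorem exists_subseq_tendsto_of_tight (ν : ℕ → Measure ℝ) [∀ n, IsProbabilityMeasure (ν n)]
    (h : ∀ δ : ℝ, 0 < δ → ∃ a : ℝ, ∀ n, ∫ t, outerCutoff a t ∂ν n ≤ δ) :
    ∃ μ : Measure ℝ, IsProbabilityMeasure μ ∧ ∃ s : ℕ → ℕ, StrictMono s ∧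
      ∀ φ : BoundedContinuousFunction ℝ ℝ,
        Tendsto (fun n => ∫ t, φ t ∂ν (s n)) atTop (𝓝 (∫ t, φ t ∂μ)) := by
  let P : ℕ → ProbabilityMeasure ℝ := fun n => ⟨ν n, inferInstance⟩
  have ht : IsTightMeasureSet {((μ : ProbabilityMeasure ℝ) : Measure ℝ) | μ ∈ Set.range P} := by
    rw [isTightMeasureSet_iff_exists_isCompact_measure_compl_le]
    intro ε hε
    have hε' : 0 < min ε 1 := lt_min hε one_pos
    have hfin : min ε 1 ≠ ⊤ := ne_top_of_le_ne_top ENNReal.one_ne_top (min_le_right _ _)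
    obtain ⟨a, ha⟩ := h (min ε 1).toReal (ENNReal.toReal_pos hε'.ne' hfin)
    refine ⟨Icc (-(a + 1)) (a + 1), isCompact_Icc, ?_⟩
    rintro _ ⟨_, ⟨n, rfl⟩, rfl⟩
    change ν n (Icc (-(a + 1)) (a + 1))ᶜ ≤ ε
    refine le_trans ?_ (min_le_left ε 1)
    rw [← ENNReal.ofReal_toReal hfin, ← ofReal_measureReal]
    refine ENNReal.ofReal_le_ofReal (le_trans ?_ (ha n))
    rw [← integral_indicator_one measurableSet_Icc.compl]
    refine integral_mono ?_ ((outerCutoff a).integrable _) fun t => ?_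
    · exact (integrable_const (1 : ℝ)).indicator measurableSet_Icc.compl
    · refine Set.indicator_le' (fun t ht => ?_) (fun t _ => outerCutoff_nonneg a t) t
      rw [outerCutoff_eq_one]
      · rfl
      · by_contra hcon
        exact ht (abs_le.1 (not_le.1 hcon).le)
  obtain ⟨Q, -, s, hs, hQ⟩ := (isCompact_closure_of_isTightMeasureSet ht).tendsto_subseq
    (fun n => subset_closure (Set.mem_range_self n))
  refine ⟨Q, inferInstance, s, hs, fun φ => ?_⟩
  exact ProbabilityMeasure.tendsto_iff_forall_integral_tendsto.1 hQ φ

theorem ae_abs_le_of_integral_outerCutoff {μ : Measure ℝ} [IsProbabilityMeasure μ] {R : ℝ}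
    (h : ∀ a, R < a → ∫ t, outerCutoff a t ∂μ = 0) : ∀ᵐ t ∂μ, |t| ≤ R := by
  have h1 : ∀ n : ℕ, ∀ᵐ t ∂μ, outerCutoff (R + 1 / ((n : ℝ) + 1)) t = 0 := by
    intro n
    have h2 := h (R + 1 / ((n : ℝ) + 1)) (by linarith [Nat.one_div_pos_of_nat (n := n) (α := ℝ)])
    exact (integral_eq_zero_iff_of_nonneg (outerCutoff_nonneg _)
      ((outerCutoff _).integrable _)).1 h2
  filter_upwards [ae_all_iff.2 h1] with t ht
  have hl : Tendsto (fun n : ℕ => R + 1 / ((n : ℝ) + 1)) atTop (𝓝 R) := by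
    simpa using (tendsto_const_nhds (x := R)).add tendsto_one_div_add_atTop_nhds_zero_nat
  refine ge_of_tendsto' hl fun n => ?_
  by_contra hcon
  have hpos : 0 < |t| - (R + 1 / ((n : ℝ) + 1)) := by linarith [not_le.1 hcon]
  have := ht n
  rw [outerCutoff_apply] at this
  exact (lt_min one_pos (lt_max_of_lt_right hpos)).ne' this

theorem integrable_pow_of_ae_abs_le {μ : Measure ℝ} [IsProbabilityMeasure μ] {R : ℝ}
    (h : ∀ᵐ t ∂μ, |t| ≤ R) (k : ℕ) : Integrable (fun t : ℝ => t ^ k) μ := by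
  refine (integrable_const (R ^ k)).mono' (by fun_prop) ?_
  filter_upwards [h] with t ht
  rw [norm_pow, Real.norm_eq_abs]
  gcongr

theorem integral_even_pow_le_of_ae_abs_le {μ : Measure ℝ} [IsProbabilityMeasure μ] {R : ℝ}
    (h : ∀ᵐ t ∂μ, |t| ≤ R) (k : ℕ) : ∫ t, t ^ (2 * k) ∂μ ≤ R ^ (2 * k) := by
  refine (integral_mono_ae (integrable_pow_of_ae_abs_le h _) (integrable_const (R ^ (2 * k)))
    ?_).trans (by simp)
  filter_upwards [h] with t ht
  have : t ^ (2 * k) = |t| ^ (2 * k) := by rw [pow_mul, pow_mul, sq_abs]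
  simp only [this]
  gcongr

/-- A bounded continuous function that agrees with `t ^ k` on `[-a, a]`. -/
noncomputable def clippedPow (a : ℝ) (k : ℕ) : BoundedContinuousFunction ℝ ℝ :=
  BoundedContinuousFunction.ofNormedAddCommGroup (fun t => (max (-|a|) (min |a| t)) ^ k)
    (by fun_prop) (|a| ^ k) (fun t => by
      rw [norm_pow, Real.norm_eq_abs]
      exact pow_le_pow_left₀ (abs_nonneg _) (abs_le.2
        ⟨le_max_left _ _, max_le (by linarith [abs_nonneg a]) (min_le_left _ _)⟩) k)

theorem clippedPow_apply (a : ℝ) (k : ℕ) (t : ℝ) :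
    clippedPow a k t = (max (-|a|) (min |a| t)) ^ k := rfl

theorem clippedPow_eq {a t : ℝ} (k : ℕ) (h : |t| ≤ a) : clippedPow a k t = t ^ k := by
  have h' := abs_le.1 (h.trans (le_abs_self a))
  rw [clippedPow_apply, min_eq_right h'.2, max_eq_right h'.1]

theorem abs_pow_sub_clippedPow_le {a : ℝ} (ha : 1 ≤ a) (k : ℕ) (t : ℝ) :
    |t ^ k - clippedPow a k t| ≤ 2 / a * t ^ (2 * (k + 1)) := by
  have ha0 : 0 < a := by linarith
  have h0 : 0 ≤ t ^ (2 * (k + 1)) := by rw [pow_mul]; positivity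
  rcases le_total |t| a with h | h
  · rw [clippedPow_eq k h, sub_self, abs_zero]
    positivity
  · have h1 : |clippedPow a k t| ≤ |t| ^ k := by
      rw [clippedPow_apply, abs_pow, abs_of_pos ha0]
      exact pow_le_pow_left₀ (abs_nonneg _) ((abs_le.2
        ⟨le_max_left _ _, max_le (by linarith) (min_le_left _ _)⟩).trans h) k
    have h2 : |t ^ k - clippedPow a k t| ≤ 2 * |t| ^ k := by
      refine (abs_sub _ _).trans ?_
      rw [abs_pow]
      linarith
    refine h2.trans ?_
    have e : t ^ (2 * (k + 1)) = |t| ^ k * |t| ^ (k + 1) * |t| := by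
      rw [pow_mul, ← sq_abs t, ← pow_mul]; ring
    have h3 : 1 ≤ |t| ^ (k + 1) := one_le_pow₀ (ha.trans h)
    rw [e, div_mul_eq_mul_div, le_div_iff₀ ha0]
    have h4 : |t| ^ k * 1 * a ≤ |t| ^ k * |t| ^ (k + 1) * |t| := by gcongr
    linarith

/-- A sequence of moments that is a limit of moments of probability measures and grows at most
exponentially is the sequence of moments of a compactly supported probability measure. -/
theorem exists_measure_of_moments (m : ℕ → ℝ) {R : ℝ} (hR : 0 ≤ R)
    (hm : ∀ n, 0 < n → m (2 * n) ≤ R ^ (2 * n))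
    (h : ∀ (K : ℕ) (δ : ℝ), 0 < δ → ∃ ν : Measure ℝ, IsProbabilityMeasure ν ∧
      (∀ k, Integrable (fun t : ℝ => t ^ k) ν) ∧ ∀ k ≤ K, |∫ t, t ^ k ∂ν - m k| < δ) :
    ∃ μ : Measure ℝ, IsProbabilityMeasure μ ∧ (∀ᵐ t ∂μ, |t| ≤ R) ∧
      ∀ k, ∫ t, t ^ k ∂μ = m k := by
  choose ν hν hint hmom using fun n : ℕ => h (n + 2) (1 / ((n : ℝ) + 1)) Nat.one_div_pos_of_nat
  have hlim : ∀ k, Tendsto (fun n => ∫ t, t ^ k ∂ν n) atTop (𝓝 (m k)) := by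
    intro k
    rw [tendsto_iff_dist_tendsto_zero]
    refine squeeze_zero' (Eventually.of_forall fun _ => dist_nonneg) ?_
      tendsto_one_div_add_atTop_nhds_zero_nat
    filter_upwards [eventually_ge_atTop k] with n hn
    rw [Real.dist_eq]
    exact (hmom n k (by omega)).le
  have hcut : ∀ a, 0 < a → ∀ j t, outerCutoff a t ≤ (a ^ (2 * j))⁻¹ * t ^ (2 * j) := by
    intro a ha j t
    have h0 : t ^ (2 * j) = |t| ^ (2 * j) := by rw [pow_mul, pow_mul, sq_abs]
    rw [h0]
    rcases le_total |t| a with h1 | h1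
    · rw [outerCutoff_eq_zero h1]
      positivity
    · refine (outerCutoff_le_one a t).trans ?_
      rw [inv_mul_eq_div, one_le_div (by positivity)]
      gcongr
  have hcutint : ∀ a, 0 < a → ∀ j n, ∫ t, outerCutoff a t ∂ν n ≤
      (a ^ (2 * j))⁻¹ * ∫ t, t ^ (2 * j) ∂ν n := by
    intro a ha j n
    rw [← integral_const_mul]
    exact integral_mono ((outerCutoff a).integrable _) ((hint n _).const_mul _) (hcut a ha j)
  obtain ⟨μ, hμ, s, hs, hconv⟩ := exists_subseq_tendsto_of_tight ν (by
    intro δ hδ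
    set a := (R ^ 2 + 1) / δ + 1 with ha
    have ha1 : 1 ≤ a := by rw [ha]; have : 0 ≤ (R ^ 2 + 1) / δ := by positivity
                           linarith
    refine ⟨a, fun n => (hcutint a (by linarith) 1 n).trans ?_⟩
    have h1 : ∫ t, t ^ (2 * 1) ∂ν n ≤ R ^ 2 + 1 := by
      have h2 := (abs_lt.1 (hmom n (2 * 1) (by omega))).2
      have h3 := hm 1 one_pos
      have h4 : 1 / ((n : ℝ) + 1) ≤ 1 := by
        rw [div_le_one (by positivity)]
        linarith [Nat.cast_nonneg (α := ℝ) n]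
      simp only [mul_one] at h2 h3 ⊢
      linarith
    have h5 : R ^ 2 + 1 ≤ δ * a := by
      have : δ * a = R ^ 2 + 1 + δ := by rw [ha]; field_simp
      linarith
    rw [inv_mul_le_iff₀ (by positivity)]
    have h6 : a ≤ a ^ (2 * 1) := le_self_pow₀ ha1 (by norm_num)
    nlinarith)
  have hsupp : ∀ᵐ t ∂μ, |t| ≤ R := by
    refine ae_abs_le_of_integral_outerCutoff fun a ha => ?_
    have ha0 : 0 < a := lt_of_le_of_lt hR ha
    have h1 : ∀ j, 0 < j → ∫ t, outerCutoff a t ∂μ ≤ ((R / a) ^ 2) ^ j := by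
      intro j hj
      refine le_of_tendsto_of_tendsto' (hconv (outerCutoff a))
        (((hlim (2 * j)).comp hs.tendsto_atTop).const_mul (a ^ (2 * j))⁻¹)
        (fun n => hcutint a ha0 j (s n)) |>.trans ?_
      rw [← pow_mul, div_pow, div_eq_inv_mul]
      gcongr
      exact hm j hj
    have h2 : Tendsto (fun j : ℕ => ((R / a) ^ 2) ^ j) atTop (𝓝 0) := by
      refine tendsto_pow_atTop_nhds_zero_of_lt_one (by positivity) ?_
      have : R / a < 1 := (div_lt_one ha0).2 ha
      have h0 : 0 ≤ R / a := by positivity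
      nlinarith
    refine le_antisymm (ge_of_tendsto h2 ?_) (integral_nonneg (outerCutoff_nonneg a))
    filter_upwards [eventually_gt_atTop 0] with j hj using h1 j hj
  refine ⟨μ, hμ, hsupp, fun k => ?_⟩
  have hA : ∀ a, max R 1 ≤ a → |∫ t, t ^ k ∂μ - m k| ≤ 2 / a * m (2 * (k + 1)) := by
    intro a ha
    have e1 : ∫ t, t ^ k ∂μ = ∫ t, clippedPow a k t ∂μ := by
      refine integral_congr_ae ?_
      filter_upwards [hsupp] with t ht
      exact (clippedPow_eq k (ht.trans ((le_max_left _ _).trans ha))).symm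
    rw [e1]
    have hl := ((hconv (clippedPow a k)).sub ((hlim k).comp hs.tendsto_atTop)).abs
    refine le_of_tendsto_of_tendsto' hl
      (((hlim (2 * (k + 1))).comp hs.tendsto_atTop).const_mul (2 / a)) fun n => ?_
    simp only [Function.comp]
    rw [← integral_sub ((clippedPow a k).integrable _) (hint _ k), ← integral_const_mul]
    refine (abs_integral_le_integral_abs).trans (integral_mono ?_ ((hint _ _).const_mul _) ?_)
    · exact (((clippedPow a k).integrable _).sub (hint _ k)).abs
    · intro t
      simp only
      rw [abs_sub_comm]
      exact abs_pow_sub_clippedPow_le ((le_max_right _ _).trans ha) k t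
  have h0 : Tendsto (fun a : ℝ => 2 / a * m (2 * (k + 1))) atTop (𝓝 0) := by
    have := (tendsto_const_nhds (x := (2 : ℝ))).div_atTop (tendsto_id (α := ℝ) (x := atTop))
    simpa using this.mul_const (m (2 * (k + 1)))
  have h1 : |∫ t, t ^ k ∂μ - m k| ≤ 0 := by
    refine ge_of_tendsto h0 ?_
    filter_upwards [eventually_ge_atTop (max R 1)] with a ha using hA a ha
  exact sub_eq_zero.1 (abs_eq_zero.1 (le_antisymm h1 (abs_nonneg _)))

/-- Convergence of moments to those of a compactly supported measure controls the integral of a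
bounded continuous function. -/
theorem exists_moment_criterion {μ : Measure ℝ} [IsProbabilityMeasure μ] {R : ℝ} (hR : 0 ≤ R)
    (hμ : ∀ᵐ t ∂μ, |t| ≤ R) (φ : BoundedContinuousFunction ℝ ℝ) {ε : ℝ} (hε : 0 < ε) :
    ∃ (K : ℕ) (δ : ℝ), 0 < δ ∧ ∀ ν : Measure ℝ, IsProbabilityMeasure ν →
      (∀ k, Integrable (fun t : ℝ => t ^ k) ν) →
      (∀ k ≤ K, |∫ t, t ^ k ∂ν - ∫ t, t ^ k ∂μ| < δ) →
      |∫ t, φ t ∂ν - ∫ t, φ t ∂μ| < ε := by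
  obtain ⟨e, he, hee⟩ : ∃ e : ℝ, 0 < e ∧ 8 * e = ε := ⟨ε / 8, by positivity, by ring⟩
  obtain ⟨p, hp⟩ := exists_polynomial_near_of_continuousOn (-(R + 1)) (R + 1) φ
    φ.continuous.continuousOn e he
  set d := p.natDegree with hd
  set C₀ := ∑ i ∈ Finset.range (d + 1), |p.coeff i| with hC₀
  have hC₀0 : 0 ≤ C₀ := Finset.sum_nonneg fun _ _ => abs_nonneg _
  set C := ‖φ‖ + C₀ with hC
  have hC0 : 0 ≤ C := by positivity
  have hq : (R / (R + 1)) ^ 2 < 1 := by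
    have h1 : R / (R + 1) < 1 := (div_lt_one (by positivity)).2 (by linarith)
    have h0 : 0 ≤ R / (R + 1) := by positivity
    nlinarith
  obtain ⟨n, hn⟩ : ∃ n : ℕ, C * R ^ (2 * d) * ((R / (R + 1)) ^ 2) ^ n < e := by
    have := (tendsto_pow_atTop_nhds_zero_of_lt_one (by positivity) hq).const_mul (C * R ^ (2 * d))
    rw [mul_zero] at this
    exact (this.eventually (gt_mem_nhds he)).exists
  have hpoly : ∀ t, |φ t - p.eval t| ≤ e + C * ((R + 1) ^ (2 * n))⁻¹ * t ^ (2 * (d + n)) := by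
    intro t
    have h0 : t ^ (2 * (d + n)) = |t| ^ (2 * (d + n)) := by rw [pow_mul, pow_mul, sq_abs]
    rcases le_total |t| (R + 1) with ht | ht
    · have := hp t (abs_le.1 ht)
      rw [abs_sub_comm] at this
      have h1 : 0 ≤ C * ((R + 1) ^ (2 * n))⁻¹ * t ^ (2 * (d + n)) := by
        rw [h0]; positivity
      linarith
    · have ht1 : 1 ≤ |t| := by linarith
      have h1 : |p.eval t| ≤ C₀ * |t| ^ (2 * d) := by
        rw [Polynomial.eval_eq_sum_range, hC₀, Finset.sum_mul]
        refine (Finset.abs_sum_le_sum_abs _ _).trans (Finset.sum_le_sum fun i hi => ?_)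
        rw [abs_mul, abs_pow]
        have hi : i ≤ 2 * d := by
          have := Finset.mem_range.1 hi
          omega
        gcongr
      have h2 : |φ t - p.eval t| ≤ C * |t| ^ (2 * d) := by
        refine (abs_sub _ _).trans ?_
        have h3 : |φ t| ≤ ‖φ‖ * |t| ^ (2 * d) := by
          refine (φ.norm_coe_le_norm t).trans (le_mul_of_one_le_right (norm_nonneg _) ?_)
          exact one_le_pow₀ ht1
        rw [hC, add_mul]
        linarith
      have h3 : 1 ≤ ((R + 1) ^ (2 * n))⁻¹ * |t| ^ (2 * n) := by
        rw [inv_mul_eq_div, one_le_div (by positivity)]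
        gcongr
      calc |φ t - p.eval t| ≤ C * |t| ^ (2 * d) * 1 := by rwa [mul_one]
        _ ≤ C * |t| ^ (2 * d) * (((R + 1) ^ (2 * n))⁻¹ * |t| ^ (2 * n)) := by gcongr
        _ = C * ((R + 1) ^ (2 * n))⁻¹ * t ^ (2 * (d + n)) := by rw [h0, mul_add, pow_add]; ring
        _ ≤ _ := by linarith
  have hpint : ∀ ν : Measure ℝ, (∀ k, Integrable (fun t : ℝ => t ^ k) ν) →
      Integrable (fun t => p.eval t) ν ∧
      ∫ t, p.eval t ∂ν = ∑ i ∈ Finset.range (d + 1), p.coeff i * ∫ t, t ^ i ∂ν := by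
    intro ν hν
    simp only [Polynomial.eval_eq_sum_range]
    refine ⟨integrable_finsetSum _ fun i _ => (hν i).const_mul _, ?_⟩
    rw [integral_finsetSum _ fun i _ => (hν i).const_mul _]
    simp only [integral_const_mul]
    rfl
  have hdiff : ∀ ν : Measure ℝ, IsProbabilityMeasure ν →
      (∀ k, Integrable (fun t : ℝ => t ^ k) ν) → |∫ t, φ t ∂ν - ∫ t, p.eval t ∂ν| ≤
        e + C * ((R + 1) ^ (2 * n))⁻¹ * ∫ t, t ^ (2 * (d + n)) ∂ν := by
    intro ν _ hν
    rw [← integral_sub (φ.integrable _) (hpint ν hν).1]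
    refine abs_integral_le_integral_abs.trans ((integral_mono
      ((φ.integrable _).sub (hpint ν hν).1).abs
      ((integrable_const e).add ((hν _).const_mul _)) hpoly).trans ?_)
    simp only [Pi.add_apply]
    rw [integral_add (integrable_const e) ((hν _).const_mul _), integral_const_mul]
    simp
  have hμint := integrable_pow_of_ae_abs_le hμ
  have hμm := integral_even_pow_le_of_ae_abs_le hμ (d + n)
  have hRn : C * ((R + 1) ^ (2 * n))⁻¹ * R ^ (2 * (d + n)) < e := by
    refine lt_of_eq_of_lt ?_ hn
    rw [mul_add, pow_add, ← pow_mul, div_pow]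
    ring
  have hinv : ((R + 1) ^ (2 * n))⁻¹ ≤ 1 := inv_le_one_of_one_le₀ (one_le_pow₀ (by linarith))
  have hinv0 : 0 ≤ ((R + 1) ^ (2 * n))⁻¹ := by positivity
  refine ⟨2 * (d + n), e / (C + 1), by positivity, fun ν hν hint hmom => ?_⟩
  have hδ : C * (e / (C + 1)) ≤ e := by
    rw [mul_div_assoc', div_le_iff₀ (by positivity)]
    nlinarith
  have h1 := hdiff ν hν hint
  have h2 := hdiff μ inferInstance hμint
  have h3 : |∫ t, p.eval t ∂ν - ∫ t, p.eval t ∂μ| ≤ e := by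
    rw [(hpint ν hint).2, (hpint μ hμint).2, ← Finset.sum_sub_distrib]
    refine (Finset.abs_sum_le_sum_abs _ _).trans ?_
    refine (Finset.sum_le_sum (g := fun i => |p.coeff i| * (e / (C + 1))) fun i hi => ?_).trans ?_
    · rw [← mul_sub, abs_mul]
      have := Finset.mem_range.1 hi
      exact mul_le_mul_of_nonneg_left (hmom i (by omega)).le (abs_nonneg _)
    · rw [← Finset.sum_mul, ← hC₀]
      refine le_trans ?_ hδ
      gcongr
      linarith [norm_nonneg φ]
  have h4 : ∫ t, t ^ (2 * (d + n)) ∂ν ≤ R ^ (2 * (d + n)) + e / (C + 1) := by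
    have := (abs_lt.1 (hmom (2 * (d + n)) le_rfl)).2
    linarith
  have h5 : C * ((R + 1) ^ (2 * n))⁻¹ * ∫ t, t ^ (2 * (d + n)) ∂ν ≤ e + e := by
    calc _ ≤ C * ((R + 1) ^ (2 * n))⁻¹ * (R ^ (2 * (d + n)) + e / (C + 1)) := by gcongr
      _ = C * ((R + 1) ^ (2 * n))⁻¹ * R ^ (2 * (d + n)) +
          ((R + 1) ^ (2 * n))⁻¹ * (C * (e / (C + 1))) := by ring
      _ ≤ e + 1 * e := by gcongr
      _ = e + e := by ring
  have h6 : C * ((R + 1) ^ (2 * n))⁻¹ * ∫ t, t ^ (2 * (d + n)) ∂μ ≤ e := by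
    refine le_trans ?_ hRn.le
    gcongr
  have h7 : ∫ t, φ t ∂ν - ∫ t, φ t ∂μ = (∫ t, φ t ∂ν - ∫ t, p.eval t ∂ν) +
      (∫ t, p.eval t ∂ν - ∫ t, p.eval t ∂μ) - (∫ t, φ t ∂μ - ∫ t, p.eval t ∂μ) := by ring
  rw [abs_le] at h1 h2 h3
  rw [h7, abs_lt]
  constructor <;> linarith

end WeakLimits

/-! ### Empirical spectral distributions -/

section Spectral

variable {N : ℕ} {A B : Matrix (Fin N) (Fin N) ℝ}

theorem isProbabilityMeasure_esd (hN : 0 < N) (hA : A.IsHermitian) :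
    IsProbabilityMeasure (esd hA) := by
  constructor
  simp only [esd, Measure.smul_apply, Measure.finsetSum_apply, measure_univ, smul_eq_mul]
  simp only [Finset.sum_const, Finset.card_univ, Fintype.card_fin, nsmul_eq_mul, mul_one]
  exact ENNReal.inv_mul_cancel (by simpa using hN.ne') (by simp)

theorem integrable_esd (hN : 0 < N) (hA : A.IsHermitian) (g : ℝ → ℝ) : Integrable g (esd hA) := by
  refine Integrable.smul_measure ?_ (by simpa using hN.ne')
  exact integrable_finsetSum_measure.2 fun i _ => integrable_dirac (by simp)

theorem integral_esd (hA : A.IsHermitian) (g : ℝ → ℝ) :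
    ∫ t, g t ∂esd hA = (N : ℝ)⁻¹ * ∑ i, g (hA.eigenvalues i) := by
  rw [esd, integral_smul_measure, integral_finsetSum_measure fun i _ => integrable_dirac (by simp)]
  simp

theorem trace_pow_eq_sum_eigenvalues (hA : A.IsHermitian) (k : ℕ) :
    ∑ i, (A ^ k) i i = ∑ i, hA.eigenvalues i ^ k := by
  change (A ^ k).trace = _
  conv_lhs => rw [hA.spectral_theorem]
  rw [← map_pow, Unitary.conjStarAlgAut_apply, Matrix.trace_mul_comm, ← mul_assoc]
  simp [Matrix.diagonal_pow, Matrix.trace]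

theorem inner_toEuclideanLin_eq_sum (hA : A.IsHermitian) (x : EuclideanSpace ℝ (Fin N)) :
    inner ℝ x (A.toEuclideanLin x) =
      ∑ i, hA.eigenvalues i * inner ℝ (hA.eigenvectorBasis i) x ^ 2 := by
  rw [← hA.eigenvectorBasis.sum_inner_mul_inner]
  refine Finset.sum_congr rfl fun i _ => ?_
  have h1 : A.toEuclideanLin (hA.eigenvectorBasis i) =
      hA.eigenvalues i • hA.eigenvectorBasis i := by
    rw [Matrix.toLpLin_apply, hA.mulVec_eigenvectorBasis]
    rfl
  rw [← Matrix.isSymmetric_toEuclideanLin_iff.2 hA _ x, h1, real_inner_smul_left,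
    real_inner_comm x]
  ring

/-- If two symmetric matrices agree outside the rows and columns indexed by `S`, their
eigenvalue counting functions differ by at most `#S`. If the bound failed, then, by dimension
count, there would be `x ≠ 0` vanishing on `S`, orthogonal to the eigenvectors of `A` with
eigenvalue `> t` and to those of `B` with eigenvalue `≤ t`; but then
`xᵀ A x ≤ t ‖x‖² < xᵀ B x`, whereas `xᵀ A x = xᵀ B x`. -/
theorem card_eigenvalues_le_card_add (hA : A.IsHermitian) (hB : B.IsHermitian)
    (S : Finset (Fin N)) (h : ∀ i ∉ S, ∀ j ∉ S, A i j = B i j) (t : ℝ) :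
    (Finset.univ.filter fun i => hA.eigenvalues i ≤ t).card ≤
      (Finset.univ.filter fun i => hB.eigenvalues i ≤ t).card + S.card := by
  by_contra! hlt
  set P := Finset.univ.filter fun i => ¬ hA.eigenvalues i ≤ t with hP
  set Q := Finset.univ.filter fun i => hB.eigenvalues i ≤ t with hQ
  have hPc : (Finset.univ.filter fun i => hA.eigenvalues i ≤ t).card + P.card = N := by
    have := Finset.card_filter_add_card_filter_not (s := (Finset.univ : Finset (Fin N)))
      (fun i => hA.eigenvalues i ≤ t)
    rw [Finset.card_univ, Fintype.card_fin] at this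
    convert this using 2
  let F : EuclideanSpace ℝ (Fin N) →ₗ[ℝ] (P → ℝ) × (Q → ℝ) × (S → ℝ) :=
    (LinearMap.pi fun i : P => innerₗ _ (hA.eigenvectorBasis i)).prod
      ((LinearMap.pi fun i : Q => innerₗ _ (hB.eigenvectorBasis i)).prod
        (LinearMap.pi fun i : S => (EuclideanSpace.proj (i : Fin N)).toLinearMap))
  have hker : LinearMap.ker F ≠ ⊥ := by
    refine F.ker_ne_bot_of_finrank_lt ?_
    simp only [Module.finrank_prod, Module.finrank_fintype_fun_eq_card, Fintype.card_coe,
      finrank_euclideanSpace, Fintype.card_fin]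
    omega
  obtain ⟨x, hx, hx0⟩ := (Submodule.ne_bot_iff _).1 hker
  rw [LinearMap.mem_ker, Prod.ext_iff, Prod.ext_iff] at hx
  obtain ⟨hxP, hxQ, hxS⟩ := hx
  have hxP : ∀ i ∈ P, inner ℝ (hA.eigenvectorBasis i) x = 0 := fun i hi => congrFun hxP ⟨i, hi⟩
  have hxQ : ∀ i ∈ Q, inner ℝ (hB.eigenvectorBasis i) x = 0 := fun i hi => congrFun hxQ ⟨i, hi⟩
  have hxS : ∀ i ∈ S, x i = 0 := fun i hi => congrFun hxS ⟨i, hi⟩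
  have hAB : inner ℝ x (A.toEuclideanLin x) = inner ℝ x (B.toEuclideanLin x) := by
    simp only [PiLp.inner_apply, Matrix.toLpLin_apply, Matrix.mulVec, dotProduct]
    refine Finset.sum_congr rfl fun i _ => ?_
    by_cases hi : i ∈ S
    · simp [hxS i hi]
    · congr 1
      refine Finset.sum_congr rfl fun j _ => ?_
      by_cases hj : j ∈ S
      · simp [hxS j hj]
      · rw [h i hi j hj]
  rw [inner_toEuclideanLin_eq_sum hA, inner_toEuclideanLin_eq_sum hB] at hAB
  have hnA := hA.eigenvectorBasis.sum_sq_inner_right x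
  have hnB := hB.eigenvectorBasis.sum_sq_inner_right x
  have h1 : ∑ i, hA.eigenvalues i * inner ℝ (hA.eigenvectorBasis i) x ^ 2 ≤ t * ‖x‖ ^ 2 := by
    rw [← hnA, Finset.mul_sum]
    refine Finset.sum_le_sum fun i _ => ?_
    by_cases hi : hA.eigenvalues i ≤ t
    · gcongr
    · rw [hxP i (by simpa [hP] using hi)]
      simp
  have hpos : 0 < ‖x‖ ^ 2 := by positivity
  have h2 : t * ‖x‖ ^ 2 < ∑ i, hB.eigenvalues i * inner ℝ (hB.eigenvectorBasis i) x ^ 2 := by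
    rw [← hnB] at hpos
    obtain ⟨i₀, -, hi₀⟩ := Finset.exists_ne_zero_of_sum_ne_zero hpos.ne'
    rw [← hnB, Finset.mul_sum]
    have hi : ∀ i, inner ℝ (hB.eigenvectorBasis i) x ^ 2 ≠ 0 → t < hB.eigenvalues i := by
      intro i hi
      by_contra! hle
      exact hi (by rw [hxQ i (by simpa [hQ] using hle)]; simp)
    refine Finset.sum_lt_sum (fun i _ => ?_) ⟨i₀, Finset.mem_univ _, ?_⟩
    · by_cases h0 : inner ℝ (hB.eigenvectorBasis i) x ^ 2 = 0
      · simp [h0]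
      · exact mul_le_mul_of_nonneg_right (hi i h0).le (sq_nonneg _)
    · exact mul_lt_mul_of_pos_right (hi i₀ hi₀) (lt_of_le_of_ne (sq_nonneg _) (Ne.symm hi₀))
  linarith

/-- The number of indices `i` with `x i ≤ t`. -/
noncomputable def countLE (x : Fin N → ℝ) (t : ℝ) : ℝ := ∑ i, if x i ≤ t then (1 : ℝ) else 0

theorem abs_countLE_eigenvalues_sub_le (hA : A.IsHermitian) (hB : B.IsHermitian)
    (S : Finset (Fin N)) (h : ∀ i ∉ S, ∀ j ∉ S, A i j = B i j) (t : ℝ) :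
    |countLE hA.eigenvalues t - countLE hB.eigenvalues t| ≤ S.card := by
  have h1 := card_eigenvalues_le_card_add hA hB S h t
  have h2 := card_eigenvalues_le_card_add hB hA S (fun i hi j hj => (h i hi j hj).symm) t
  have h1' : ((Finset.univ.filter fun i => hA.eigenvalues i ≤ t).card : ℝ) ≤
      (Finset.univ.filter fun i => hB.eigenvalues i ≤ t).card + S.card := by exact_mod_cast h1
  have h2' : ((Finset.univ.filter fun i => hB.eigenvalues i ≤ t).card : ℝ) ≤
      (Finset.univ.filter fun i => hA.eigenvalues i ≤ t).card + S.card := by exact_mod_cast h2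
  simp only [countLE, Finset.sum_boole]
  rw [abs_le]
  constructor <;> linarith

/-- A compactly supported uniformly continuous function is nearly a step function, so its average
over a family of reals is controlled by the counting function. -/
theorem exists_abs_avg_sub_avg_le {φ : ℝ → ℝ} (hφ : UniformContinuous φ) {K : ℝ}
    (hK : ∀ t, K < |t| → φ t = 0) {δ : ℝ} (hδ : 0 < δ) :
    ∃ V : ℝ, 0 ≤ V ∧ ∀ (N : ℕ) (x y : Fin N → ℝ) (r : ℝ),
      (∀ t, |countLE x t - countLE y t| ≤ r) →
      |(N : ℝ)⁻¹ * ∑ i, φ (x i) - (N : ℝ)⁻¹ * ∑ i, φ (y i)| ≤ δ + V * ((N : ℝ)⁻¹ * r) := by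
  obtain ⟨e, he, hφe⟩ := Metric.uniformContinuous_iff.1 hφ (δ / 2) (half_pos hδ)
  set η := e / 2 with hη
  have hη0 : 0 < η := half_pos he
  obtain ⟨L, hL⟩ := exists_nat_gt (K / η)
  rw [div_lt_iff₀ hη0] at hL
  set I : Finset ℤ := Finset.Icc (-(L : ℤ)) L with hI
  have hstep : ∀ t, |φ t - φ (η * ⌈t / η⌉)| ≤ δ / 2 := by
    intro t
    have h1 := Int.le_ceil (t / η)
    have h2 := Int.ceil_lt_add_one (t / η)
    rw [div_le_iff₀ hη0] at h1
    rw [div_add_one hη0.ne', lt_div_iff₀ hη0] at h2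
    have : dist t (η * ⌈t / η⌉) < e := by
      rw [Real.dist_eq, abs_lt]
      constructor <;> nlinarith
    exact (hφe this).le
  have hval : ∀ t, φ (η * ⌈t / η⌉) = ∑ l ∈ I, φ (η * l) *
      ((if t ≤ η * l then (1 : ℝ) else 0) - if t ≤ η * (l - 1) then (1 : ℝ) else 0) := by
    intro t
    have hind : ∀ l : ℤ, ((if t ≤ η * l then (1 : ℝ) else 0) -
        if t ≤ η * (l - 1) then (1 : ℝ) else 0) = if ⌈t / η⌉ = l then 1 else 0 := by
      intro l
      have h1 : t ≤ η * l ↔ ⌈t / η⌉ ≤ l := by rw [Int.ceil_le, div_le_iff₀ hη0, mul_comm]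
      have h2 : t ≤ η * (l - 1) ↔ ⌈t / η⌉ ≤ l - 1 := by
        rw [Int.ceil_le, div_le_iff₀ hη0, mul_comm]
        push_cast
        rfl
      simp only [h1, h2]
      split_ifs <;> first | omega | simp
    simp only [hind, mul_ite, mul_one, mul_zero, Finset.sum_ite_eq]
    split_ifs with hmem
    · rfl
    · refine hK _ (hL.trans_le ?_)
      rw [abs_mul, abs_of_pos hη0, mul_comm]
      gcongr
      have : (L : ℤ) ≤ |⌈t / η⌉| := by
        rw [hI, Finset.mem_Icc, ← abs_le, not_le] at hmem
        exact hmem.le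
      exact_mod_cast this
  have hsum : ∀ {N : ℕ} (x : Fin N → ℝ), ∑ i, φ (η * ⌈x i / η⌉) =
      ∑ l ∈ I, φ (η * l) * (countLE x (η * l) - countLE x (η * (l - 1))) := by
    intro N x
    simp only [hval, countLE]
    rw [Finset.sum_comm]
    simp only [← Finset.mul_sum, Finset.sum_sub_distrib]
  have havg : ∀ {N : ℕ} (x : Fin N → ℝ),
      |(N : ℝ)⁻¹ * ∑ i, φ (x i) - (N : ℝ)⁻¹ * ∑ i, φ (η * ⌈x i / η⌉)| ≤ δ / 2 := by
    intro N x
    rcases Nat.eq_zero_or_pos N with rfl | hN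
    · simp; positivity
    rw [← mul_sub, ← Finset.sum_sub_distrib, abs_mul, abs_of_nonneg (by positivity)]
    rw [inv_mul_le_iff₀ (by positivity)]
    refine (Finset.abs_sum_le_sum_abs _ _).trans
      ((Finset.sum_le_sum fun i _ => hstep (x i)).trans_eq ?_)
    simp
  refine ⟨∑ l ∈ I, |φ (η * l)| * 2, by positivity, fun N x y r hr => ?_⟩
  have hxy : |(N : ℝ)⁻¹ * ∑ i, φ (η * ⌈x i / η⌉) - (N : ℝ)⁻¹ * ∑ i, φ (η * ⌈y i / η⌉)| ≤
      (∑ l ∈ I, |φ (η * l)| * 2) * ((N : ℝ)⁻¹ * r) := by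
    rw [← mul_sub, hsum, hsum, ← Finset.sum_sub_distrib, abs_mul, abs_of_nonneg (by positivity),
      mul_left_comm, Finset.sum_mul]
    gcongr
    refine (Finset.abs_sum_le_sum_abs _ _).trans (Finset.sum_le_sum fun l _ => ?_)
    rw [← mul_sub, abs_mul, mul_assoc]
    gcongr
    have h1 := abs_le.1 (hr (η * l))
    have h2 := abs_le.1 (hr (η * (l - 1)))
    rw [abs_le]
    constructor <;> linarith
  have h1 := abs_le.1 (havg x)
  have h2 := abs_le.1 (havg y)
  have h3 := abs_le.1 hxy
  rw [abs_le]
  constructor <;> linarith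

theorem avg_outerCutoff_le {x y : Fin N → ℝ} {r : ℝ}
    (hr : ∀ t, |countLE x t - countLE y t| ≤ r) {a : ℝ} (ha : 0 ≤ a) :
    (N : ℝ)⁻¹ * ∑ i, outerCutoff (a + 1) (x i) ≤
      (N : ℝ)⁻¹ * ∑ i, outerCutoff a (y i) + (N : ℝ)⁻¹ * (2 * r) := by
  rw [← mul_add]
  gcongr
  set b := a + 1 with hb
  have hx : ∑ i, outerCutoff b (x i) ≤ N - countLE x b + countLE x (-b) := by
    have : (N : ℝ) = ∑ _i : Fin N, (1 : ℝ) := by simp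
    rw [this, countLE, countLE, ← Finset.sum_sub_distrib, ← Finset.sum_add_distrib]
    refine Finset.sum_le_sum fun i _ => ?_
    rcases le_or_gt |x i| b with h | h
    · rw [outerCutoff_eq_zero h]
      split_ifs <;> norm_num
    · refine (outerCutoff_le_one _ _).trans ?_
      rcases lt_abs.1 h with h | h
      · rw [if_neg (by linarith)]
        split_ifs <;> norm_num
      · rw [if_pos (by linarith), if_pos (by linarith)]
        norm_num
  have hy : N - countLE y b + countLE y (-b) ≤ ∑ i, outerCutoff a (y i) := by
    have : (N : ℝ) = ∑ _i : Fin N, (1 : ℝ) := by simp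
    rw [this, countLE, countLE, ← Finset.sum_sub_distrib, ← Finset.sum_add_distrib]
    refine Finset.sum_le_sum fun i _ => ?_
    have h0 := outerCutoff_nonneg a (y i)
    by_cases h1 : y i ≤ b
    · by_cases h2 : y i ≤ -b
      · rw [outerCutoff_eq_one (by rw [← hb]; exact le_abs.2 (Or.inr (by linarith)))]
        simp [h1, h2]
      · simpa [h1, h2] using h0
    · rw [outerCutoff_eq_one (by rw [← hb]; exact le_abs.2 (Or.inl (by linarith)))]
      rw [if_neg h1, if_neg (by linarith)]
      norm_num
  have h1 := abs_le.1 (hr b)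
  have h2 := abs_le.1 (hr (-b))
  linarith

end Spectral

/-! ### Convergence in probability under the Gaussian product measures -/

section TendstoInGaussian

open Topology

/-- Convergence in probability to the constant `a` of random variables `F N`, where `F N` is a
function of independent standard normal variables indexed by the entries of a symmetric
`N × N` matrix. -/
def TendstoInGaussian (F : ∀ N : ℕ, (Sym2 (Fin N) → ℝ) → ℝ) (a : ℝ) : Prop :=
  ∀ ε : ℝ, 0 < ε →
    Tendsto (fun N => stdGaussianPi (Sym2 (Fin N)) {v | ε ≤ |F N v - a|}) atTop (𝓝 0)

/-- Chebyshev's inequality. -/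
theorem TendstoInGaussian.of_integral_sq_le {F : ∀ N : ℕ, (Sym2 (Fin N) → ℝ) → ℝ} {b : ℕ → ℝ}
    {a C : ℝ} (hint : ∀ N, Integrable (fun v => (F N v - b N) ^ 2) (stdGaussianPi (Sym2 (Fin N))))
    (hle : ∀ N, 0 < N → ∫ v, (F N v - b N) ^ 2 ∂stdGaussianPi (Sym2 (Fin N)) ≤ C / N)
    (hb : Tendsto b atTop (𝓝 a)) : TendstoInGaussian F a := by
  intro ε hε
  have hlim : Tendsto (fun N : ℕ => ENNReal.ofReal ((C / N) / (ε / 2) ^ 2)) atTop (𝓝 0) := by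
    have h := ENNReal.tendsto_ofReal
      ((tendsto_const_div_atTop_nhds_zero_nat C).div_const ((ε / 2) ^ 2))
    simpa using h
  refine tendsto_of_tendsto_of_tendsto_of_le_of_le' tendsto_const_nhds hlim
    (Eventually.of_forall fun _ => zero_le) ?_
  filter_upwards [eventually_gt_atTop 0, Metric.tendsto_nhds.1 hb (ε / 2) (half_pos hε)]
    with N hN hbN
  rw [Real.dist_eq] at hbN
  have h1 : {v | ε ≤ |F N v - a|} ⊆ {v | (ε / 2) ^ 2 ≤ (F N v - b N) ^ 2} := by
    intro v hv
    have hv : ε ≤ |F N v - a| := hv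
    have h2 : |F N v - a| ≤ |F N v - b N| + |b N - a| := abs_sub_le _ _ _
    change (ε / 2) ^ 2 ≤ (F N v - b N) ^ 2
    rw [← sq_abs (F N v - b N)]
    gcongr
    linarith
  have h2 := mul_meas_ge_le_integral_of_nonneg
    (Eventually.of_forall fun v => sq_nonneg (F N v - b N)) (hint N) ((ε / 2) ^ 2)
  refine (measure_mono h1).trans ?_
  rw [← ofReal_measureReal]
  refine ENNReal.ofReal_le_ofReal ?_
  rw [le_div_iff₀ (by positivity), mul_comm]
  exact h2.trans (hle N hN)

theorem TendstoInGaussian.const (c : ℝ) : TendstoInGaussian (fun _ _ => c) c := by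
  intro ε hε
  simp [hε.not_ge]

theorem TendstoInGaussian.const_mul_one_sub {F : ∀ N : ℕ, (Sym2 (Fin N) → ℝ) → ℝ} {a : ℝ}
    (hF : TendstoInGaussian F a) {c : ℝ} (hc : 0 ≤ c) :
    TendstoInGaussian (fun N v => c * (1 - F N v)) (c * (1 - a)) := by
  intro ε hε
  refine tendsto_of_tendsto_of_tendsto_of_le_of_le tendsto_const_nhds
    (hF (ε / (c + 1)) (by positivity)) (fun _ => zero_le) fun N => measure_mono fun v hv => ?_
  have hv : ε ≤ |c * (1 - F N v) - c * (1 - a)| := hv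
  change ε / (c + 1) ≤ |F N v - a|
  rw [← mul_sub, abs_mul, abs_of_nonneg hc, sub_sub_sub_cancel_left, abs_sub_comm] at hv
  rw [div_le_iff₀ (by positivity)]
  linarith [abs_nonneg (F N v - a)]

/-- Limits in probability are stable under approximation, up to an error `H` that is small in
probability. -/
theorem TendstoInGaussian.of_approx {F : ∀ N : ℕ, (Sym2 (Fin N) → ℝ) → ℝ} {a : ℝ}
    (h : ∀ δ : ℝ, 0 < δ → ∃ (G H : ∀ N : ℕ, (Sym2 (Fin N) → ℝ) → ℝ) (b c : ℝ),
      TendstoInGaussian G b ∧ TendstoInGaussian H c ∧ |b - a| ≤ δ ∧ c ≤ δ ∧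
      ∀ᶠ N in atTop, ∀ v, |F N v - G N v| ≤ H N v) :
    TendstoInGaussian F a := by
  intro ε hε
  obtain ⟨G, H, b, c, hG, hH, hba, hc, hFG⟩ := h (ε / 4) (by positivity)
  have hsum := (hG (ε / 4) (by positivity)).add (hH (ε / 4) (by positivity))
  rw [add_zero] at hsum
  refine tendsto_of_tendsto_of_tendsto_of_le_of_le' tendsto_const_nhds hsum
    (Eventually.of_forall fun _ => zero_le) ?_
  filter_upwards [hFG] with N hN
  refine (measure_mono fun v hv => ?_).trans (measure_union_le _ _)
  by_contra hcon
  have hv : ε ≤ |F N v - a| := hv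
  simp only [Set.mem_union, Set.mem_ofPred_eq, not_or, not_le] at hcon
  have h1 := abs_sub_le (F N v) (G N v) a
  have h2 := abs_sub_le (G N v) b a
  have h3 := hN v
  linarith [(abs_lt.1 hcon.2).2]

/-- Finitely many limits in probability hold simultaneously. -/
theorem tendsto_measure_exists_ge {F : ℕ → ∀ N : ℕ, (Sym2 (Fin N) → ℝ) → ℝ} {a : ℕ → ℝ}
    (h : ∀ k, TendstoInGaussian (F k) (a k)) (K : ℕ) {δ : ℝ} (hδ : 0 < δ) :
    Tendsto (fun N => stdGaussianPi (Sym2 (Fin N)) {v | ∃ k ≤ K, δ ≤ |F k N v - a k|})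
      atTop (𝓝 0) := by
  have hlim : Tendsto (fun N => ∑ k ∈ Finset.range (K + 1),
      stdGaussianPi (Sym2 (Fin N)) {v | δ ≤ |F k N v - a k|}) atTop (𝓝 0) := by
    have := tendsto_finsetSum (Finset.range (K + 1)) fun k _ => h k δ hδ
    simpa using this
  refine tendsto_of_tendsto_of_tendsto_of_le_of_le tendsto_const_nhds hlim (fun _ => zero_le)
    fun N => ?_
  refine (measure_mono ?_).trans (measure_biUnion_finset_le _ _)
  rintro v ⟨k, hk, hv⟩
  exact Set.mem_biUnion (Finset.mem_coe.2 (Finset.mem_range.2 (Nat.lt_succ_of_le hk))) hv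

theorem TendstoInGaussian.exists_forall_lt {F : ℕ → ∀ N : ℕ, (Sym2 (Fin N) → ℝ) → ℝ} {a : ℕ → ℝ}
    (h : ∀ k, TendstoInGaussian (F k) (a k)) (K : ℕ) {δ : ℝ} (hδ : 0 < δ) :
    ∃ N, 0 < N ∧ ∃ v, ∀ k ≤ K, |F k N v - a k| < δ := by
  obtain ⟨N, hN, hN0⟩ := (((tendsto_measure_exists_ge h K hδ).eventually_lt_const
    zero_lt_one).and (eventually_gt_atTop 0)).exists
  refine ⟨N, hN0, ?_⟩
  by_contra! hcon
  refine hN.ne ?_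
  rw [show {v | ∃ k ≤ K, δ ≤ |F k N v - a k|} = Set.univ from Set.eq_univ_of_forall hcon,
    measure_univ]

theorem TendstoInGaussian.le_of_eventually_le {F G : ∀ N : ℕ, (Sym2 (Fin N) → ℝ) → ℝ} {a b : ℝ}
    (hF : TendstoInGaussian F a) (hG : TendstoInGaussian G b) {c : ℝ}
    (h : ∀ᶠ N in atTop, ∀ v, F N v ≤ G N v + c) : a ≤ b + c := by
  refine le_of_forall_pos_le_add fun ε hε => ?_
  have hsum := (hF (ε / 2) (half_pos hε)).add (hG (ε / 2) (half_pos hε))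
  rw [add_zero] at hsum
  obtain ⟨N, hN, hle⟩ := ((hsum.eventually_lt_const zero_lt_one).and h).exists
  have hex : ∃ v, v ∉ {v | ε / 2 ≤ |F N v - a|} ∪ {v | ε / 2 ≤ |G N v - b|} := by
    by_contra! hcon
    have := (measure_union_le (μ := stdGaussianPi (Sym2 (Fin N))) {v | ε / 2 ≤ |F N v - a|}
      {v | ε / 2 ≤ |G N v - b|}).trans_lt hN
    rw [Set.eq_univ_of_forall hcon, measure_univ] at this
    exact this.false
  obtain ⟨v, hv⟩ := hex
  simp only [Set.mem_union, Set.mem_ofPred_eq, not_or, not_le, abs_lt] at hv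
  have := hle v
  linarith [hv.1.1, hv.2.2]

end TendstoInGaussian

/-! ### The limit for bounded variance profiles -/

section BoundedProfile

open Topology

/-- The random matrix with variance profile `f`, as a function of independent normal variables
indexed by unordered pairs. -/
noncomputable def profileMatrix (f : ℝ → ℝ → ℝ) (N : ℕ) (v : Sym2 (Fin N) → ℝ) :
    Matrix (Fin N) (Fin N) ℝ :=
  Matrix.of fun i j => f (gridPoint N i) (gridPoint N j) * (Real.sqrt N)⁻¹ * v s(i, j)

theorem profileMatrix_isHermitian {f : ℝ → ℝ → ℝ} (hf : ClassR f) (N : ℕ)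
    (v : Sym2 (Fin N) → ℝ) : (profileMatrix f N v).IsHermitian := by
  ext i j
  simp only [profileMatrix, Matrix.conjTranspose_apply, Matrix.of_apply, star_trivial]
  rw [hf.symm _ (gridPoint_mem N j) _ (gridPoint_mem N i), Sym2.eq_swap]

theorem eval_polyWigner_pow (f : ℝ → ℝ → ℝ) (N : ℕ) (v : Sym2 (Fin N) → ℝ) (k : ℕ) (i : Fin N) :
    MvPolynomial.eval v
      ((polyWigner (fun i j => f (gridPoint N i) (gridPoint N j)) ^ k) i i) =
      (profileMatrix f N v ^ k) i i := by
  have h : (MvPolynomial.eval v).mapMatrix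
      (polyWigner fun i j => f (gridPoint N i) (gridPoint N j)) = profileMatrix f N v := by
    ext i j
    simp [polyWigner, profileMatrix, MvPolynomial.smul_eval]
  rw [← h, ← map_pow]
  rfl

variable {f : ℝ → ℝ → ℝ}

/-- The empirical spectral distribution of `profileMatrix`. -/
noncomputable def profileESD (hf : ClassR f) (N : ℕ) (v : Sym2 (Fin N) → ℝ) : Measure ℝ :=
  esd (profileMatrix_isHermitian hf N v)

theorem integral_pow_profileESD (hf : ClassR f) (N : ℕ) (v : Sym2 (Fin N) → ℝ) (k : ℕ) :
    ∫ t, t ^ k ∂profileESD hf N v = (N : ℝ)⁻¹ * ∑ i, MvPolynomial.eval v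
      ((polyWigner (fun i j => f (gridPoint N i) (gridPoint N j)) ^ k) i i) := by
  rw [profileESD, integral_esd, ← trace_pow_eq_sum_eigenvalues]
  simp only [eval_polyWigner_pow]

/-- The moments of the limit law. -/
noncomputable def limitMoment (f : ℝ → ℝ → ℝ) (k : ℕ) : ℝ :=
  if k = 0 then 1 else if Even k then
    ∑ σ : NCPair (k / 2), ∫ x in unitCube (k / 2 + 1), Lfun σ f x else 0

theorem limitMoment_two_mul (f : ℝ → ℝ → ℝ) {n : ℕ} (hn : 0 < n) :
    limitMoment f (2 * n) = ∑ σ : NCPair n, ∫ x in unitCube (n + 1), Lfun σ f x := by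
  rw [limitMoment, if_neg (by omega), if_pos (even_two_mul n), Nat.mul_div_cancel_left n two_pos]

theorem limitMoment_of_odd (f : ℝ → ℝ → ℝ) {k : ℕ} (hk : Odd k) : limitMoment f k = 0 := by
  rw [limitMoment, if_neg (by rintro rfl; simp at hk), if_neg (Nat.not_even_iff_odd.2 hk)]

theorem tendsto_avg_treeMoment (hf : ClassR f) {B : ℝ}
    (hB : ∀ x ∈ Ioo (0 : ℝ) 1, ∀ y ∈ Ioo (0 : ℝ) 1, |f x y| ≤ B) (k : ℕ) :
    Tendsto (fun N : ℕ => (N : ℝ)⁻¹ * ∑ i,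
      treeMoment (fun i j => f (gridPoint N i) (gridPoint N j)) k i) atTop
      (𝓝 (limitMoment f k)) := by
  have hseq := fun N : ℕ => isMomentSeq_treeMoment (N := N) (M := |B|) (R := 2 * |B|)
    (c := fun i j => f (gridPoint N i) (gridPoint N j))
    (fun i j => (hB _ (gridPoint_mem N i) _ (gridPoint_mem N j)).trans (le_abs_self B))
    (by positivity) le_rfl
  rcases Nat.even_or_odd' k with ⟨n, rfl | rfl⟩
  · rcases Nat.eq_zero_or_pos n with rfl | hn
    · refine tendsto_const_nhds.congr' ?_
      filter_upwards [eventually_gt_atTop 0] with N hN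
      have hN' : (N : ℝ) ≠ 0 := by exact_mod_cast hN.ne'
      simp [(hseq N).zero, limitMoment, hN']
    · rw [limitMoment_two_mul f hn]
      refine (tendsto_finsetSum _ fun σ _ => tendsto_avg_Lfun hf hB hn σ).congr' ?_
      filter_upwards [eventually_gt_atTop 0] with N hN
      exact (avg_treeMoment_eq_sum_avg_Lfun hN hn f fun i j =>
        hf.symm _ (gridPoint_mem N i) _ (gridPoint_mem N j)).symm
  · rw [limitMoment_of_odd f ⟨n, rfl⟩]
    simp [treeMoment_of_odd _ (⟨n, rfl⟩ : Odd (2 * n + 1))]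

theorem tendstoInGaussian_moment (hf : ClassR f) {B : ℝ}
    (hB : ∀ x ∈ Ioo (0 : ℝ) 1, ∀ y ∈ Ioo (0 : ℝ) 1, |f x y| ≤ B) (k : ℕ) :
    TendstoInGaussian (fun N v => ∫ t, t ^ k ∂profileESD hf N v) (limitMoment f k) := by
  obtain ⟨C, -, hC⟩ := exists_momentApprox |B| (2 * |B| + 1)
    (by linarith [abs_nonneg B]) (2 * k) 2
  have hc : ∀ (N : ℕ) (i j : Fin N), |f (gridPoint N i) (gridPoint N j)| ≤ |B| := fun N i j =>
    (hB _ (gridPoint_mem N i) _ (gridPoint_mem N j)).trans (le_abs_self B)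
  have hseq := fun N : ℕ => isMomentSeq_treeMoment (R := 2 * |B| + 1) (hc N)
    (by positivity) (by linarith)
  refine TendstoInGaussian.of_integral_sq_le (C := C + 2 * (2 * |B| + 1) ^ k * C)
    (fun N => ?_) (fun N hN => ?_) (tendsto_avg_treeMoment hf hB k)
  · simp only [integral_pow_profileESD]
    have h := integrable_eval ((MvPolynomial.C (N : ℝ)⁻¹ * ∑ i : Fin N,
      (polyWigner (fun i j => f (gridPoint N i) (gridPoint N j)) ^ k) i i -
      MvPolynomial.C ((N : ℝ)⁻¹ * ∑ i,
        treeMoment (fun i j => f (gridPoint N i) (gridPoint N j)) k i)) ^ 2)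
    simpa only [map_pow, map_sub, map_mul, map_sum, MvPolynomial.eval_C] using h
  · simp only [integral_pow_profileESD]
    exact gaussianExp_trace_sub_sq_le hN (by linarith [abs_nonneg B]) (hseq N) k
      (hC N _ _ hN (fun i j => hf.symm _ (gridPoint_mem N i) _ (gridPoint_mem N j)) (hc N)
        (hseq N))

/-- For a bounded profile, the limit law is the solution of the moment problem. -/
theorem exists_limit_of_bounded (hf : ClassR f) {B : ℝ}
    (hB : ∀ x ∈ Ioo (0 : ℝ) 1, ∀ y ∈ Ioo (0 : ℝ) 1, |f x y| ≤ B) {M : ℝ} (hM0 : 0 ≤ M)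
    (hM : ∀ᵐ z ∂(volume.restrict (Ioo (0 : ℝ) 1 ×ˢ Ioo (0 : ℝ) 1)),
      |Function.uncurry f z| ≤ M) :
    ∃ μ : Measure ℝ, IsProbabilityMeasure μ ∧ (∀ᵐ t ∂μ, |t| ≤ 2 * M) ∧
      (∀ k, ∫ t, t ^ k ∂μ = limitMoment f k) ∧
      (∀ φ : BoundedContinuousFunction ℝ ℝ, ∫ t, φ (-t) ∂μ = ∫ t, φ t ∂μ) ∧
      ∀ φ : BoundedContinuousFunction ℝ ℝ,
        TendstoInGaussian (fun N v => ∫ t, φ t ∂profileESD hf N v) (∫ t, φ t ∂μ) := by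
  have hmom := tendstoInGaussian_moment hf hB
  obtain ⟨μ, hμ, hsupp, hμm⟩ := exists_measure_of_moments (limitMoment f) (R := 2 * M)
    (by positivity) (fun n hn => by
      rw [limitMoment_two_mul f hn]
      exact sum_integral_Lfun_le hf hM hn) (fun K δ hδ => by
      obtain ⟨N, hN, v, hv⟩ := TendstoInGaussian.exists_forall_lt hmom K hδ
      exact ⟨profileESD hf N v, isProbabilityMeasure_esd hN _, fun k => integrable_esd hN _ _, hv⟩)
  refine ⟨μ, hμ, hsupp, hμm, fun φ => ?_, fun φ ε hε => ?_⟩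
  · refine eq_of_abs_sub_le_all fun ε hε => ?_
    obtain ⟨K, δ, hδ, h⟩ := exists_moment_criterion (by positivity) hsupp φ hε
    have hint : ∀ g : ℝ → ℝ, Continuous g → ∫ t, g t ∂(μ.map fun t => -t) = ∫ t, g (-t) ∂μ :=
      fun g hg => integral_map (by fun_prop) hg.aestronglyMeasurable
    have h1 := h (μ.map fun t => -t) (Measure.isProbabilityMeasure_map (by fun_prop)) (fun k => by
        rw [integrable_map_measure (by fun_prop) (by fun_prop)]
        refine ((integrable_pow_of_ae_abs_le hsupp k).const_mul ((-1) ^ k)).congr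
          (Eventually.of_forall fun t => ?_)
        simp only [Function.comp]
        rw [← mul_pow, neg_one_mul]) (fun k _ => by
        rw [hint (fun t => t ^ k) (by fun_prop)]
        rcases Nat.even_or_odd k with hk | hk
        · simpa [hk.neg_pow] using hδ
        · simp only [hk.neg_pow, integral_neg, hμm, limitMoment_of_odd f hk]
          simpa using hδ)
    rw [hint φ φ.continuous] at h1
    exact h1.le
  · obtain ⟨K, δ, hδ, h⟩ := exists_moment_criterion (by positivity) hsupp φ hε
    refine tendsto_of_tendsto_of_tendsto_of_le_of_le' tendsto_const_nhds
      (tendsto_measure_exists_ge hmom K hδ) (Eventually.of_forall fun _ => zero_le) ?_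
    filter_upwards [eventually_gt_atTop 0] with N hN
    refine measure_mono fun v hv => ?_
    by_contra! hcon
    have h2 : ∀ k ≤ K, |∫ t, t ^ k ∂profileESD hf N v - limitMoment f k| < δ := by
      intro k hk
      by_contra! h3
      exact hcon ⟨k, hk, h3⟩
    refine absurd (h _ (isProbabilityMeasure_esd hN (profileMatrix_isHermitian hf N v))
      (fun k => integrable_esd hN _ _) fun k hk => ?_) (not_lt.2 hv)
    rw [hμm]
    exact h2 k hk

end BoundedProfile

/-! ### Truncation of the variance profile -/

section Truncation

open Topology

/-- The profile `f` set to zero near the boundary of the unit square. -/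
noncomputable def truncate (f : ℝ → ℝ → ℝ) (ε x y : ℝ) : ℝ :=
  if x ∈ Icc ε (1 - ε) ∧ y ∈ Icc ε (1 - ε) then f x y else 0

variable {f : ℝ → ℝ → ℝ} {ε : ℝ}

theorem abs_truncate_le (f : ℝ → ℝ → ℝ) (ε x y : ℝ) : |truncate f ε x y| ≤ |f x y| := by
  unfold truncate
  split_ifs <;> simp

theorem volume_prod_fst_eq (c : ℝ) : volume {p : ℝ × ℝ | p.1 = c} = 0 := by
  have : {p : ℝ × ℝ | p.1 = c} = {c} ×ˢ Set.univ := by ext p; simp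
  rw [this, Measure.volume_eq_prod, Measure.prod_prod]
  simp

theorem volume_prod_snd_eq (c : ℝ) : volume {p : ℝ × ℝ | p.2 = c} = 0 := by
  have : {p : ℝ × ℝ | p.2 = c} = Set.univ ×ˢ {c} := by ext p; simp
  rw [this, Measure.volume_eq_prod, Measure.prod_prod]
  simp

theorem continuousAt_truncate {p : ℝ × ℝ} (hp : ContinuousAt (Function.uncurry f) p)
    (h1 : p.1 ≠ ε) (h2 : p.1 ≠ 1 - ε) (h3 : p.2 ≠ ε) (h4 : p.2 ≠ 1 - ε) :
    ContinuousAt (Function.uncurry (truncate f ε)) p := by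
  by_cases hx : p.1 ∈ Icc ε (1 - ε)
  · by_cases hy : p.2 ∈ Icc ε (1 - ε)
    · have hmem : Ioo ε (1 - ε) ×ˢ Ioo ε (1 - ε) ∈ 𝓝 p :=
        (isOpen_Ioo.prod isOpen_Ioo).mem_nhds
          ⟨⟨lt_of_le_of_ne hx.1 h1.symm, lt_of_le_of_ne hx.2 h2⟩,
            ⟨lt_of_le_of_ne hy.1 h3.symm, lt_of_le_of_ne hy.2 h4⟩⟩
      refine hp.congr ?_
      filter_upwards [hmem] with q hq
      exact (if_pos ⟨Ioo_subset_Icc_self hq.1, Ioo_subset_Icc_self hq.2⟩).symm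
    · have hmem : {q : ℝ × ℝ | q.2 ∈ (Icc ε (1 - ε))ᶜ} ∈ 𝓝 p :=
        (isClosed_Icc.isOpen_compl.preimage continuous_snd).mem_nhds hy
      refine (continuousAt_const (y := (0 : ℝ))).congr ?_
      filter_upwards [hmem] with q hq
      exact (if_neg fun h => hq h.2).symm
  · have hmem : {q : ℝ × ℝ | q.1 ∈ (Icc ε (1 - ε))ᶜ} ∈ 𝓝 p :=
      (isClosed_Icc.isOpen_compl.preimage continuous_fst).mem_nhds hx
    refine (continuousAt_const (y := (0 : ℝ))).congr ?_
    filter_upwards [hmem] with q hq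
    exact (if_neg fun h => hq h.1).symm

theorem Icc_subset_unitInterval (hε : 0 < ε) : Icc ε (1 - ε) ⊆ Ioo (0 : ℝ) 1 :=
  fun _ h => ⟨hε.trans_le h.1, h.2.trans_lt (by linarith)⟩

theorem exists_abs_truncate_le (hf : ClassR f) (hε : 0 < ε) (hε' : ε < 1 / 2) :
    ∃ B, ∀ x y, |truncate f ε x y| ≤ B := by
  obtain ⟨B, hB⟩ := hf.bounded ε hε hε'
  refine ⟨|B|, fun x y => ?_⟩
  unfold truncate
  split_ifs with h
  · rw [abs_of_nonneg (hf.nonneg _ (Icc_subset_unitInterval hε h.1) _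
      (Icc_subset_unitInterval hε h.2))]
    exact (hB _ h.1 _ h.2).trans (le_abs_self B)
  · simp

theorem classR_truncate (hf : ClassR f) (hε : 0 < ε) (hε' : ε < 1 / 2) :
    ClassR (truncate f ε) where
  nonneg x hx y hy := by
    unfold truncate
    split_ifs
    · exact hf.nonneg x hx y hy
    · exact le_rfl
  bounded _ _ _ := by
    obtain ⟨B, hB⟩ := exists_abs_truncate_le hf hε hε'
    exact ⟨B, fun x _ y _ => (le_abs_self _).trans (hB x y)⟩
  discont_null := by
    have h := measure_union_null hf.discont_null (measure_union_null
      (measure_union_null (volume_prod_fst_eq ε) (volume_prod_fst_eq (1 - ε)))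
      (measure_union_null (volume_prod_snd_eq ε) (volume_prod_snd_eq (1 - ε))))
    refine measure_mono_null (fun p hp => ?_) h
    by_contra hcon
    simp only [Set.mem_union, Set.mem_ofPred_eq, not_or, not_and, not_not] at hcon
    exact hp.2 (continuousAt_truncate (hcon.1 hp.1) hcon.2.1.1 hcon.2.1.2 hcon.2.2.1 hcon.2.2.2)
  symm x hx y hy := by
    simp only [truncate, hf.symm x hx y hy, and_comm]

/-- The indices of the rows that are affected by a truncation. -/
noncomputable def boundaryIndices (N : ℕ) (ε : ℝ) : Finset (Fin N) :=
  Finset.univ.filter fun i => gridPoint N i ∉ Icc ε (1 - ε)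

theorem card_filter_add_one_lt_le {a : ℝ} (ha : 0 ≤ a) (N : ℕ) :
    ((Finset.univ.filter fun i : Fin N => (i : ℝ) + 1 < a).card : ℝ) ≤ a := by
  refine le_trans ?_ (Nat.floor_le ha)
  rw [← Finset.card_range ⌊a⌋₊]
  refine Nat.cast_le.2 (Finset.card_le_card_of_injOn (fun i => (i : ℕ)) (fun i hi => ?_)
    (fun i _ j _ h => Fin.ext h))
  simp only [Finset.coe_filter, Finset.mem_univ, true_and, Set.mem_ofPred_eq] at hi
  have : (i : ℕ) + 1 ≤ ⌊a⌋₊ := Nat.le_floor (by push_cast; exact hi.le)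
  simpa using this

theorem card_boundaryIndices_le {N : ℕ} (hN : 0 < N) (hε : 0 < ε) :
    ((boundaryIndices N ε).card : ℝ) ≤ 4 * ε * N := by
  have hN1 : (1 : ℝ) ≤ N := by exact_mod_cast hN
  set a := ε * ((N : ℝ) + 1) with ha
  have ha0 : 0 ≤ a := by positivity
  set L := Finset.univ.filter fun i : Fin N => (i : ℝ) + 1 < a with hL
  have hsub : boundaryIndices N ε ⊆ L ∪ L.image Fin.rev := by
    intro i hi
    simp only [boundaryIndices, Finset.mem_filter, Finset.mem_univ, true_and, Set.mem_Icc,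
      not_and_or, not_le, gridPoint] at hi
    rw [Finset.mem_union]
    rcases hi with hi | hi
    · left
      rw [div_lt_iff₀ (by positivity)] at hi
      simpa [hL] using hi
    · right
      rw [lt_div_iff₀ (by positivity)] at hi
      refine Finset.mem_image.2 ⟨Fin.rev i, ?_, Fin.rev_rev i⟩
      have hval : ((Fin.rev i : Fin N) : ℝ) = N - (i + 1) := by
        rw [Fin.val_rev, Nat.cast_sub i.isLt]
        push_cast
        ring
      simp only [hL, Finset.mem_filter, Finset.mem_univ, true_and, hval]
      rw [ha]
      linarith
  have h1 := Finset.card_le_card hsub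
  have h2 := Finset.card_union_le L (L.image Fin.rev)
  have h3 := Finset.card_image_le (s := L) (f := Fin.rev)
  have h4 : ((boundaryIndices N ε).card : ℝ) ≤ L.card + L.card := by
    exact_mod_cast (by omega : (boundaryIndices N ε).card ≤ L.card + L.card)
  have h5 := card_filter_add_one_lt_le ha0 N
  have h6 : a ≤ 2 * ε * N := by
    rw [ha]
    nlinarith
  linarith

theorem abs_countLE_profile_sub_le {g : ℝ → ℝ → ℝ} (hf : ClassR f) (hg : ClassR g) (hε : 0 < ε)
    (h : ∀ x ∈ Icc ε (1 - ε), ∀ y ∈ Icc ε (1 - ε), f x y = g x y) {N : ℕ} (hN : 0 < N)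
    (v : Sym2 (Fin N) → ℝ) (t : ℝ) :
    |countLE (profileMatrix_isHermitian hf N v).eigenvalues t -
      countLE (profileMatrix_isHermitian hg N v).eigenvalues t| ≤ 4 * ε * N := by
  refine (abs_countLE_eigenvalues_sub_le _ _ (boundaryIndices N ε) (fun i hi j hj => ?_) t).trans
    (card_boundaryIndices_le hN hε)
  simp only [boundaryIndices, Finset.mem_filter, Finset.mem_univ, true_and, not_not] at hi hj
  simp only [profileMatrix, Matrix.of_apply, h _ hi _ hj]

theorem exists_abs_integral_profileESD_sub_le {φ : ℝ → ℝ} (hφ : UniformContinuous φ) {K : ℝ}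
    (hK : ∀ t, K < |t| → φ t = 0) {δ : ℝ} (hδ : 0 < δ) :
    ∃ V : ℝ, 0 ≤ V ∧ ∀ {f g : ℝ → ℝ → ℝ} (hf : ClassR f) (hg : ClassR g) {ε : ℝ}, 0 < ε →
      (∀ x ∈ Icc ε (1 - ε), ∀ y ∈ Icc ε (1 - ε), f x y = g x y) → ∀ {N : ℕ}, 0 < N → ∀ v,
      |∫ t, φ t ∂profileESD hf N v - ∫ t, φ t ∂profileESD hg N v| ≤ δ + V * (4 * ε) := by
  obtain ⟨V, hV, h⟩ := exists_abs_avg_sub_avg_le hφ hK hδ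
  refine ⟨V, hV, fun {f g} hf hg {ε} hε hfg {N} hN v => ?_⟩
  have hN' : (N : ℝ) ≠ 0 := by exact_mod_cast hN.ne'
  have := h N _ _ _ (abs_countLE_profile_sub_le hf hg hε hfg hN v)
  rw [profileESD, profileESD, integral_esd, integral_esd]
  rwa [mul_comm (4 * ε), inv_mul_cancel_left₀ hN'] at this

theorem integral_outerCutoff_profileESD_le {g : ℝ → ℝ → ℝ} (hf : ClassR f) (hg : ClassR g)
    (hε : 0 < ε) (h : ∀ x ∈ Icc ε (1 - ε), ∀ y ∈ Icc ε (1 - ε), f x y = g x y) {N : ℕ}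
    (hN : 0 < N) (v : Sym2 (Fin N) → ℝ) {a : ℝ} (ha : 0 ≤ a) :
    ∫ t, outerCutoff (a + 1) t ∂profileESD hf N v ≤
      ∫ t, outerCutoff a t ∂profileESD hg N v + 8 * ε := by
  have hN' : (N : ℝ) ≠ 0 := by exact_mod_cast hN.ne'
  have := avg_outerCutoff_le (abs_countLE_profile_sub_le hf hg hε h hN v) ha
  rw [profileESD, profileESD, integral_esd, integral_esd]
  refine this.trans_eq ?_
  field_simp
  ring

/-! ### The limit for general variance profiles -/

/-- The width of the boundary strip that the `k`-th truncation removes. -/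
noncomputable def stripWidth (k : ℕ) : ℝ := 1 / ((k : ℝ) + 3)

theorem stripWidth_pos (k : ℕ) : 0 < stripWidth k := by
  unfold stripWidth
  positivity

theorem stripWidth_lt_half (k : ℕ) : stripWidth k < 1 / 2 := by
  unfold stripWidth
  exact one_div_lt_one_div_of_lt two_pos (by linarith [(Nat.cast_nonneg k : (0 : ℝ) ≤ k)])

theorem stripWidth_antitone : Antitone stripWidth := fun k l h => by
  unfold stripWidth
  gcongr

theorem tendsto_stripWidth : Tendsto stripWidth atTop (𝓝 0) := by
  have := (tendsto_add_atTop_iff_nat 2).2 (tendsto_one_div_add_atTop_nhds_zero_nat (𝕜 := ℝ))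
  refine this.congr fun k => ?_
  rw [stripWidth]
  push_cast
  ring

theorem truncate_eq_truncate {k l : ℕ} (hkl : k ≤ l) :
    ∀ x ∈ Icc (stripWidth k) (1 - stripWidth k), ∀ y ∈ Icc (stripWidth k) (1 - stripWidth k),
      truncate f (stripWidth l) x y = truncate f (stripWidth k) x y := by
  intro x hx y hy
  have h := stripWidth_antitone hkl
  have hsub : Icc (stripWidth k) (1 - stripWidth k) ⊆ Icc (stripWidth l) (1 - stripWidth l) :=
    Icc_subset_Icc h (by linarith)
  rw [truncate, truncate, if_pos ⟨hsub hx, hsub hy⟩, if_pos ⟨hx, hy⟩]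

theorem truncate_eq :
    ∀ x ∈ Icc ε (1 - ε), ∀ y ∈ Icc ε (1 - ε), f x y = truncate f ε x y :=
  fun _ hx _ hy => (if_pos ⟨hx, hy⟩).symm

theorem tendsto_integral_outerCutoff (μ : Measure ℝ) [IsProbabilityMeasure μ] :
    Tendsto (fun n : ℕ => ∫ t, outerCutoff n t ∂μ) atTop (𝓝 0) := by
  have h := tendsto_integral_of_dominated_convergence (μ := μ) (fun _ : ℝ => (1 : ℝ))
    (F := fun (n : ℕ) t => outerCutoff n t) (f := fun _ => 0)
    (fun n => (outerCutoff n).continuous.aestronglyMeasurable) (integrable_const 1)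
    (fun n => Eventually.of_forall fun t => by
      rw [Real.norm_of_nonneg (outerCutoff_nonneg _ _)]
      exact outerCutoff_le_one _ _)
    (Eventually.of_forall fun t => by
      refine tendsto_const_nhds.congr' ?_
      filter_upwards [eventually_ge_atTop ⌈|t|⌉₊] with n hn
      exact (outerCutoff_eq_zero ((Nat.le_ceil _).trans (by exact_mod_cast hn))).symm)
  simpa using h

theorem integral_outerCutoff_eq_zero {μ : Measure ℝ} {R a : ℝ} (h : ∀ᵐ t ∂μ, |t| ≤ R)
    (ha : R ≤ a) : ∫ t, outerCutoff a t ∂μ = 0 := by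
  rw [integral_eq_zero_of_ae]
  filter_upwards [h] with t ht
  exact outerCutoff_eq_zero (ht.trans ha)

/-- If integrals of compactly supported functions converge in probability to those of a
probability measure, then no mass escapes to infinity, so integrals of all bounded continuous
functions converge. -/
theorem tendstoInGaussian_of_compactSupport (hf : ClassR f) {μ : Measure ℝ}
    [IsProbabilityMeasure μ]
    (h : ∀ ψ : BoundedContinuousFunction ℝ ℝ, ∀ K : ℝ, (∀ t, K < |t| → ψ t = 0) →
      TendstoInGaussian (fun N v => ∫ t, ψ t ∂profileESD hf N v) (∫ t, ψ t ∂μ))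
    (φ : BoundedContinuousFunction ℝ ℝ) :
    TendstoInGaussian (fun N v => ∫ t, φ t ∂profileESD hf N v) (∫ t, φ t ∂μ) := by
  refine TendstoInGaussian.of_approx fun δ hδ => ?_
  have hlim := (tendsto_integral_outerCutoff μ).const_mul (‖φ‖)
  rw [mul_zero] at hlim
  obtain ⟨n, hn⟩ := (hlim.eventually_le_const hδ).exists
  set χ := 1 - outerCutoff n with hχ
  have hχ0 : ∀ t, (n : ℝ) + 1 < |t| → χ t = 0 := fun t ht => by
    simp [hχ, outerCutoff_eq_one ht.le]
  have hbound : ∀ t, |φ t - (φ * χ) t| ≤ ‖φ‖ * outerCutoff n t := by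
    intro t
    have : φ t - (φ * χ) t = φ t * outerCutoff n t := by
      simp [hχ]
      ring
    rw [this, abs_mul, abs_of_nonneg (outerCutoff_nonneg _ _)]
    exact mul_le_mul_of_nonneg_right (φ.norm_coe_le_norm t) (outerCutoff_nonneg _ _)
  have hint : ∀ ν : Measure ℝ, IsProbabilityMeasure ν →
      |∫ t, φ t ∂ν - ∫ t, (φ * χ) t ∂ν| ≤ ‖φ‖ * ∫ t, outerCutoff n t ∂ν := by
    intro ν _
    rw [← integral_sub (φ.integrable ν) ((φ * χ).integrable ν), ← integral_const_mul]
    exact abs_integral_le_integral_abs.trans (integral_mono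
      ((φ.integrable ν).sub ((φ * χ).integrable ν)).abs
      (((outerCutoff n).integrable ν).const_mul _) hbound)
  have hone : ∀ ν : Measure ℝ, IsProbabilityMeasure ν →
      ∫ t, outerCutoff n t ∂ν = 1 - ∫ t, χ t ∂ν := by
    intro ν _
    have : ∫ t, χ t ∂ν = ∫ t, (1 - outerCutoff n t) ∂ν := rfl
    rw [this, integral_sub (integrable_const 1) ((outerCutoff n).integrable ν)]
    simp
  have hχlim := h χ (n + 1) hχ0
  refine ⟨_, fun N v => ‖φ‖ * (1 - ∫ t, χ t ∂profileESD hf N v), _,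
    ‖φ‖ * ∫ t, outerCutoff n t ∂μ, h (φ * χ) (n + 1) fun t ht => by simp [hχ0 t ht], ?_, ?_, hn, ?_⟩
  · rw [hone μ inferInstance]
    exact hχlim.const_mul_one_sub (norm_nonneg φ)
  · rw [abs_sub_comm]
    exact (hint μ inferInstance).trans hn
  · filter_upwards [eventually_gt_atTop 0] with N hN v
    have hP := isProbabilityMeasure_esd hN (profileMatrix_isHermitian hf N v)
    have := hint _ hP
    rwa [hone _ hP] at this

end Truncation

section GeneralProfile

open Topology

variable {f : ℝ → ℝ → ℝ}

/-- The limit laws of the truncated profiles are tight, because truncating further moves only a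
small proportion of the eigenvalues; every limit point of them is the limit law of `f`, for the
same reason. -/
theorem exists_limit (hf : ClassR f) (κ : ℕ → Measure ℝ) [∀ k, IsProbabilityMeasure (κ k)]
    {M : ℕ → ℝ} (hM : ∀ k, ∀ᵐ t ∂κ k, |t| ≤ 2 * M k) (hM0 : ∀ k, 0 ≤ M k)
    (hκ : ∀ k, ∀ φ : BoundedContinuousFunction ℝ ℝ, TendstoInGaussian (fun N v => ∫ t, φ t
      ∂profileESD (classR_truncate hf (stripWidth_pos k) (stripWidth_lt_half k)) N v)
      (∫ t, φ t ∂κ k)) :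
    ∃ μ : Measure ℝ, IsProbabilityMeasure μ ∧
      (∀ φ : BoundedContinuousFunction ℝ ℝ,
        TendstoInGaussian (fun N v => ∫ t, φ t ∂profileESD hf N v) (∫ t, φ t ∂μ)) ∧
      ∃ s : ℕ → ℕ, StrictMono s ∧ ∀ φ : BoundedContinuousFunction ℝ ℝ,
        Tendsto (fun n => ∫ t, φ t ∂κ (s n)) atTop (𝓝 (∫ t, φ t ∂μ)) := by
  have htight : ∀ δ : ℝ, 0 < δ → ∃ a : ℝ, ∀ n, ∫ t, outerCutoff a t ∂κ n ≤ δ := by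
    intro δ hδ
    have h8 := tendsto_stripWidth.const_mul 8
    rw [mul_zero] at h8
    obtain ⟨l, hl⟩ := (h8.eventually_le_const hδ).exists
    set a := ∑ k ∈ Finset.range (l + 1), 2 * M k with ha
    have hMa : ∀ k ≤ l, 2 * M k ≤ a := fun k hk =>
      Finset.single_le_sum (f := fun k => 2 * M k) (fun k _ => by have := hM0 k; positivity)
        (Finset.mem_range.2 (Nat.lt_succ_of_le hk))
    have ha0 : 0 ≤ a := le_trans (by have := hM0 l; positivity) (hMa l le_rfl)
    refine ⟨a + 1, fun k => ?_⟩
    rcases le_total k l with hk | hk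
    · rw [integral_outerCutoff_eq_zero (hM k) (by linarith [hMa k hk])]
      exact hδ.le
    · have h1 := (hκ k (outerCutoff (a + 1))).le_of_eventually_le (hκ l (outerCutoff a))
        (c := 8 * stripWidth l) (by
          filter_upwards [eventually_gt_atTop 0] with N hN v
          exact integral_outerCutoff_profileESD_le _ _ (stripWidth_pos l)
            (truncate_eq_truncate hk) hN v ha0)
      rw [integral_outerCutoff_eq_zero (hM l) (hMa l le_rfl), zero_add] at h1
      exact h1.trans hl
  obtain ⟨μ, hμ, s, hs, hlim⟩ := exists_subseq_tendsto_of_tight κ htight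
  refine ⟨μ, hμ, tendstoInGaussian_of_compactSupport hf fun ψ K hK => ?_, s, hs, hlim⟩
  have huc : UniformContinuous ψ := by
    refine HasCompactSupport.uniformContinuous_of_continuous
      (HasCompactSupport.intro (isCompact_Icc (a := -K) (b := K)) fun t ht => hK t ?_) ψ.continuous
    by_contra! hcon
    exact ht (abs_le.1 hcon)
  refine TendstoInGaussian.of_approx fun δ hδ => ?_
  obtain ⟨V, hV, hVle⟩ := exists_abs_integral_profileESD_sub_le huc hK (half_pos hδ)
  have hw := ((tendsto_stripWidth.comp hs.tendsto_atTop).const_mul 4).const_mul V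
  rw [mul_zero, mul_zero] at hw
  obtain ⟨n, hn1, hn2⟩ := ((hw.eventually_le_const (half_pos hδ)).and
    (Metric.tendsto_nhds.1 (hlim ψ) δ hδ)).exists
  refine ⟨_, fun _ _ => δ, _, δ, hκ (s n) ψ, TendstoInGaussian.const δ, hn2.le, le_rfl, ?_⟩
  filter_upwards [eventually_gt_atTop 0] with N hN v
  refine (hVle hf _ (stripWidth_pos (s n)) truncate_eq hN v).trans ?_
  have hn1 : V * (4 * stripWidth (s n)) ≤ δ / 2 := hn1
  linarith

theorem tendsto_limitMoment_truncate (hf : ClassR f) {M : ℝ}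
    (hM : ∀ᵐ z ∂(volume.restrict (Ioo (0 : ℝ) 1 ×ˢ Ioo (0 : ℝ) 1)),
      |Function.uncurry f z| ≤ M) {n : ℕ} (hn : 0 < n) :
    Tendsto (fun k => limitMoment (truncate f (stripWidth k)) (2 * n)) atTop
      (𝓝 (limitMoment f (2 * n))) := by
  simp only [limitMoment_two_mul _ hn, volume_restrict_unitCube]
  refine tendsto_finsetSum _ fun σ _ => ?_
  refine tendsto_integral_of_dominated_convergence (fun _ => M ^ (2 * n))
    (fun k => aestronglyMeasurable_Lfun
      (classR_truncate hf (stripWidth_pos k) (stripWidth_lt_half k)) σ)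
    (integrable_const _) (fun k => ?_) ?_
  · have hMk : ∀ᵐ z ∂(volume.restrict (Ioo (0 : ℝ) 1 ×ˢ Ioo (0 : ℝ) 1)),
        |Function.uncurry (truncate f (stripWidth k)) z| ≤ M := by
      filter_upwards [hM] with z hz
      exact (abs_truncate_le f _ z.1 z.2).trans hz
    filter_upwards [ae_Lfun_le hMk hn σ] with x hx
    rw [Real.norm_of_nonneg (Lfun_nonneg _ _ _)]
    exact hx
  · filter_upwards [ae_mem_unitCube (n + 1)] with x hx
    refine tendsto_finsetProd _ fun p _ => Tendsto.pow ?_ 2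
    refine tendsto_const_nhds.congr' ?_
    have hmem : ∀ i, ∀ᶠ k in atTop, x i ∈ Icc (stripWidth k) (1 - stripWidth k) := by
      intro i
      filter_upwards [tendsto_stripWidth.eventually_le_const (hx i).1,
        tendsto_stripWidth.eventually_le_const (sub_pos.2 (hx i).2)] with k h1 h2
      exact ⟨h1, by linarith⟩
    filter_upwards [hmem (blockIndex σ p.1), hmem (blockIndex σ p.2)] with k h1 h2
    exact truncate_eq _ h1 _ h2

/-- The limit law of a general profile, together with its description in the essentially bounded
case. -/
theorem exists_limit_law (hf : ClassR f) :
    ∃ μ : Measure ℝ, IsProbabilityMeasure μ ∧ μ.map (fun t => -t) = μ ∧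
      (∀ φ : BoundedContinuousFunction ℝ ℝ,
        TendstoInGaussian (fun N v => ∫ t, φ t ∂profileESD hf N v) (∫ t, φ t ∂μ)) ∧
      ∀ M : ℝ, (∀ᵐ z ∂(volume.restrict (Ioo (0 : ℝ) 1 ×ˢ Ioo (0 : ℝ) 1)),
        |Function.uncurry f z| ≤ M) → (∃ R : ℝ, ∀ᵐ t ∂μ, |t| ≤ R) ∧
        ∀ n, 0 < n → ∫ t, t ^ (2 * n) ∂μ = limitMoment f (2 * n) := by
  have hB := fun k => exists_abs_truncate_le hf (stripWidth_pos k) (stripWidth_lt_half k)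
  choose B hB using hB
  -- If `f` has an essential bound, all truncations are to be treated with this same bound.
  obtain ⟨M, hM0, hM, hunif⟩ : ∃ M : ℕ → ℝ, (∀ k, 0 ≤ M k) ∧
      (∀ k, ∀ᵐ z ∂(volume.restrict (Ioo (0 : ℝ) 1 ×ˢ Ioo (0 : ℝ) 1)),
        |Function.uncurry (truncate f (stripWidth k)) z| ≤ M k) ∧
      ((∃ C : ℝ, ∀ᵐ z ∂(volume.restrict (Ioo (0 : ℝ) 1 ×ˢ Ioo (0 : ℝ) 1)),
        |Function.uncurry f z| ≤ C) → ∃ C, ∀ k, M k = C) := by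
    by_cases hC : ∃ C : ℝ, ∀ᵐ z ∂(volume.restrict (Ioo (0 : ℝ) 1 ×ˢ Ioo (0 : ℝ) 1)),
        |Function.uncurry f z| ≤ C
    · obtain ⟨C, hC'⟩ := hC
      refine ⟨fun _ => |C|, fun _ => abs_nonneg C, fun k => ?_, fun _ => ⟨|C|, fun _ => rfl⟩⟩
      filter_upwards [hC'] with z hz
      exact (abs_truncate_le f _ z.1 z.2).trans (hz.trans (le_abs_self C))
    · exact ⟨fun k => |B k|, fun k => abs_nonneg _, fun k => Eventually.of_forall fun z =>
        (hB k z.1 z.2).trans (le_abs_self _), fun h => absurd h hC⟩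
  choose κ hκP hκM hκmom hκsymm hκ using fun k => exists_limit_of_bounded
    (classR_truncate hf (stripWidth_pos k) (stripWidth_lt_half k))
    (fun x _ y _ => hB k x y) (hM0 k) (hM k)
  obtain ⟨μ, hμ, hconv, s, hs, hlim⟩ := exists_limit hf κ hκM hM0 hκ
  refine ⟨μ, hμ, ?_, hconv, fun C hC => ?_⟩
  · have := Measure.isProbabilityMeasure_map (μ := μ) (f := fun t : ℝ => -t) (by fun_prop)
    refine ext_of_forall_integral_eq_of_IsFiniteMeasure fun φ => ?_
    rw [integral_map (by fun_prop) φ.continuous.aestronglyMeasurable]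
    have h := hlim (φ.compContinuous ⟨fun t => -t, continuous_neg⟩)
    refine tendsto_nhds_unique (h.congr fun n => ?_) (hlim φ)
    exact hκsymm (s n) φ
  · obtain ⟨D, hD⟩ := hunif ⟨C, hC⟩
    have hsupp : ∀ᵐ t ∂μ, |t| ≤ 2 * D := by
      refine ae_abs_le_of_integral_outerCutoff fun a ha => ?_
      refine tendsto_nhds_unique (hlim (outerCutoff a)) (tendsto_const_nhds.congr fun n => ?_)
      rw [integral_outerCutoff_eq_zero (hκM (s n)) (by rw [hD]; exact ha.le)]
    refine ⟨⟨_, hsupp⟩, fun n hn => ?_⟩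
    have hclip : ∀ ν : Measure ℝ, (∀ᵐ t ∂ν, |t| ≤ 2 * D) →
        ∫ t, clippedPow (2 * D) (2 * n) t ∂ν = ∫ t, t ^ (2 * n) ∂ν := by
      intro ν hν
      refine integral_congr_ae ?_
      filter_upwards [hν] with t ht
      exact clippedPow_eq _ ht
    have h1 := hlim (clippedPow (2 * D) (2 * n))
    rw [hclip μ hsupp] at h1
    refine tendsto_nhds_unique h1
      (((tendsto_limitMoment_truncate hf hC hn).comp hs.tendsto_atTop).congr fun k => ?_)
    rw [hclip _ (by rw [← hD (s k)]; exact hκM (s k)), hκmom]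
    rfl

end GeneralProfile

/-! ### Arrays of independent normal variables -/

section Transfer

open Topology

/-- The entries on and above the diagonal, indexed by unordered pairs of indices. -/
def arrayRestrict (N : ℕ) (x : ℕ → ℕ → ℝ) (s : Sym2 (Fin N)) : ℝ :=
  x ((s.inf : ℕ) + 1) ((s.sup : ℕ) + 1)

theorem hadamardZ_eq_profileMatrix (f : ℝ → ℝ → ℝ) (x : ℕ → ℕ → ℝ) (N : ℕ) :
    hadamardZ f x N = profileMatrix f N (arrayRestrict N x) := by
  ext i j
  have h1 : min ((i : ℕ) + 1) ((j : ℕ) + 1) = ((i ⊓ j : Fin N) : ℕ) + 1 := by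
    rw [min_add_add_right]
    rfl
  have h2 : max ((i : ℕ) + 1) ((j : ℕ) + 1) = ((i ⊔ j : Fin N) : ℕ) + 1 := by
    rw [max_add_add_right]
    rfl
  simp only [hadamardZ, gridMatrix, wignerMatrix, Matrix.hadamard_apply, Matrix.of_apply,
    profileMatrix, arrayRestrict, Sym2.inf_mk, Sym2.sup_mk, h1, h2, mul_assoc]

theorem esd_hadamardZ {f : ℝ → ℝ → ℝ} (hf : ClassR f) (x : ℕ → ℕ → ℝ) (N : ℕ) :
    esd (hadamardZ_isHermitian hf x N) = profileESD hf N (arrayRestrict N x) := by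
  have h := hadamardZ_eq_profileMatrix f x N
  unfold profileESD
  congr 1

theorem hasLaw_arrayRestrict {Ω : Type*} [MeasurableSpace Ω] {P : Measure Ω}
    [IsProbabilityMeasure P] {X : ℕ → ℕ → Ω → ℝ}
    (hX : ∀ i j, 1 ≤ i → i ≤ j → HasLaw (X i j) (gaussianReal 0 1) P)
    (hind : iIndepFun (fun p : {p : ℕ × ℕ // 1 ≤ p.1 ∧ p.1 ≤ p.2} => X p.1.1 p.1.2) P) (N : ℕ) :
    HasLaw (fun ω => arrayRestrict N fun i j => X i j ω) (stdGaussianPi (Sym2 (Fin N))) P := by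
  let g : Sym2 (Fin N) → {p : ℕ × ℕ // 1 ≤ p.1 ∧ p.1 ≤ p.2} := fun s =>
    ⟨((s.inf : ℕ) + 1, (s.sup : ℕ) + 1), by simp, by simpa using Sym2.inf_le_sup s⟩
  have hg : Function.Injective g := by
    intro s t h
    have h := Subtype.ext_iff.1 h
    simp only [g, Prod.mk.injEq, add_left_inj] at h
    exact Sym2.inf_eq_inf_and_sup_eq_sup.1 ⟨Fin.ext h.1, Fin.ext h.2⟩
  have hlaw : ∀ s, HasLaw (X (g s).1.1 (g s).1.2) (gaussianReal 0 1) P := fun s =>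
    hX _ _ (g s).2.1 (g s).2.2
  have hmeas : ∀ s, AEMeasurable (X (g s).1.1 (g s).1.2) P := fun s => (hlaw s).aemeasurable
  refine ⟨aemeasurable_pi_lambda _ hmeas, ?_⟩
  have h := (iIndepFun_iff_map_fun_eq_pi_map hmeas).1 (hind.precomp hg)
  simp only [(hlaw _).map_eq] at h
  exact h

/-- The set where the integral is far from its limit need not be checked to be measurable:
the outer measure of a preimage is at most the outer measure under the image law. -/
theorem TendstoInGaussian.tendstoInMeasure {Ω : Type*} [MeasurableSpace Ω] {P : Measure Ω}
    {F : ∀ N : ℕ, (Sym2 (Fin N) → ℝ) → ℝ} {a : ℝ} (hF : TendstoInGaussian F a)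
    {V : ∀ N : ℕ, Ω → Sym2 (Fin N) → ℝ}
    (hV : ∀ N, HasLaw (V N) (stdGaussianPi (Sym2 (Fin N))) P) :
    TendstoInMeasure P (fun N ω => F N (V N ω)) atTop (fun _ => a) := by
  rw [tendstoInMeasure_iff_norm]
  intro ε hε
  refine tendsto_of_tendsto_of_tendsto_of_le_of_le tendsto_const_nhds (hF ε hε)
    (fun _ => zero_le) fun N => ?_
  simp only
  rw [← (hV N).map_eq]
  exact Measure.le_map_apply (hV N).aemeasurable {v | ε ≤ |F N v - a|}

end Transfer

theorem theorem1 (f : ℝ → ℝ → ℝ) (hf : ClassR f) :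
    ∃ μ : Measure ℝ, IsProbabilityMeasure μ ∧ μ.map (fun t => -t) = μ ∧
      (∀ (Ω : Type*) [MeasurableSpace Ω] (P : Measure Ω) [IsProbabilityMeasure P]
        (X : ℕ → ℕ → Ω → ℝ),
        (∀ i j, 1 ≤ i → i ≤ j → HasLaw (X i j) (gaussianReal 0 1) P) →
        iIndepFun (fun p : {p : ℕ × ℕ // 1 ≤ p.1 ∧ p.1 ≤ p.2} => X p.1.1 p.1.2) P →
        WeaklyInProbability P
          (fun N ω => esd (hadamardZ_isHermitian hf (fun i j => X i j ω) N)) μ) ∧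
      (MemLp (Function.uncurry f) ⊤ (volume.restrict (Ioo (0 : ℝ) 1 ×ˢ Ioo (0 : ℝ) 1)) →
        IsCompact μ.support ∧
        ∀ n : ℕ, 1 ≤ n →
          Integrable (fun t : ℝ => t ^ (2 * n)) μ ∧
          (∀ σ : NCPair n, IntegrableOn (Lfun σ f) (unitCube (n + 1))) ∧
          ∫ t, t ^ (2 * n) ∂μ = ∑ σ : NCPair n, ∫ x in unitCube (n + 1), Lfun σ f x) := by
  obtain ⟨μ, hμ, hsymm, hconv, hbdd⟩ := exists_limit_law hf
  refine ⟨μ, hμ, hsymm, fun Ω _ P _ X hX hind φ => ?_, fun hmem => ?_⟩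
  · have h := (hconv φ).tendstoInMeasure (hasLaw_arrayRestrict hX hind)
    simp only [← esd_hadamardZ] at h
    exact h
  · have hM := ae_le_lpNorm_exponent_top hmem
    simp only [Real.norm_eq_abs] at hM
    obtain ⟨⟨R, hR⟩, hmom⟩ := hbdd _ hM
    refine ⟨?_, fun n hn => ⟨integrable_pow_of_ae_abs_le hR _,
      fun σ => integrable_Lfun hf hM hn σ, ?_⟩⟩
    · have hsub : μ.support ⊆ Icc (-R) R := by
        refine Measure.support_subset_of_isClosed isClosed_Icc ?_
        filter_upwards [hR] with t ht
        exact abs_le.1 ht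
      exact isCompact_Icc.of_isClosed_subset Measure.isClosed_support hsub
    · rw [hmom n hn, limitMoment_two_mul f hn]
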